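/- **Setting.** Let $\mathcal A\neq 0$ be a unital C*-algebra. For unital *-endomorphisms $\rho,\sigma$ of $\mathcal A$ put $\mathrm{Hom}(\rho,\sigma)=\{t\in\mathcal A:\ t\rho(a)=\sigma(a)t\ \ \forall a\}$; $\rho$ is irreducible if $\mathrm{Hom}(\rho,\rho)=\mathbb C1$, and $\tau\prec\rho$ means that $\mathrm{Hom}(\tau,\rho)$ contains an isometry. A conjugate of $\rho$ is an endomorphism $\overline\rho$ with $R\in\mathrm{Hom}(\mathrm{id},\overline\rho\rho)$, $\overline R\in\mathrm{Hom}(\mathrm{id},\rho\overline\rho)$, $\overline R^*\rho(R)=1=R^*\overline\rho(\overline R)$; $\dim(\rho)$ is the infimum of $d$ over all such solutions (for all $\overline\rho$) with $R^*R=\overline R^*\overline R=d\cdot 1$, and a solution attaining it is called standard. Let $\mathcal C$ be a full subcategory of endomorphisms of $\mathcal A$ (such as the DHR endomorphisms of finite dimension of a local net), closed under composition, containing $\mathrm{id}$, with $\mathrm{Hom}(\mathrm{id},\mathrm{id})=\mathbb C1$ and with a unitary braiding $\varepsilon_{\rho,\sigma}:\rho\sigma\to\sigma\rho$. A Q-system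 $A=(\Theta,W,X)$ consists of $W\in\mathrm{Hom}(\mathrm{id},\Theta)$, $X\in\mathrm{Hom}(\Theta,\Theta^2)$ with $W^*X=\Theta(W^*)X=1$, $XX=\Theta(X)X$, $XX^*=\Theta(X^*)X$, $W^*W=X^*X=d_A\cdot 1$, $d_A=\sqrt{\dim\Theta}$; it is commutative if $\varepsilon_{\Theta,\Theta}X=X$. Its extension is the *-algebra of elements $\iota(a)V$ ($a\in\mathcal A$, uniquely determined) with $V\iota(a)=\iota(\Theta(a))V$, $VV=\iota(X)V$, $\iota(W^*)V=1$, $V^*=\iota(W^*X^*)V$. **Proposition.** Let $A^Y=(\Theta^Y,W^Y,X^Y)$, $Y=L,R$, be commutative Q-systems with $\Theta^Y\in\mathcal C$, of dimensions $d_Y$, and let $\mathcal B$ be the extension given by their braided product $$\Theta=\Theta^L\Theta^R,\quad W=\Theta^L(W^R)W^L,\quad X=\Theta^L(\varepsilon_{\Theta^R,\Theta^L}^*)\,X^L\,\Theta^L(X^R).$$ Let $(\rho)$ be a finite family of pairwise inequivalent irreducible objects of $\mathcal C$ with conjugates $\overline\rho$ and standard solutions $R_\rho,\overline R_\rho$,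 and let $W^Y_{\rho,k}\in\mathrm{Hom}(\rho,\Theta^Y)$ ($k$ a multiplicity index) satisfy $W^{Y*}_{\rho,k}W^Y_{\rho,l}=\delta_{kl}\,d_Y/\dim(\rho)$ and $\sum_{\rho,k}\frac{\dim(\rho)}{d_Y}W^Y_{\rho,k}W^{Y*}_{\rho,k}=1$. Put $$\Psi^L_{\rho,k}=\iota\big(W^{L*}_{\rho,k}\Theta^L(W^{R*})\big)V,\qquad \Psi^R_{\rho,l}=\iota\big(W^{R*}_{\rho,l}W^{L*}\big)V,\qquad B_{\rho,kl}=\Psi^{L*}_{\rho,k}\Psi^R_{\rho,l}.$$ Let $W^Y_{\overline\rho,k}=R_\rho^*\,\overline\rho\big(W^{Y*}_{\rho,k}X^YW^Y\big)$; these lie in $\mathrm{Hom}(\overline\rho,\Theta^Y)$ and satisfy $W^{Y*}_{\overline\rho,k}W^Y_{\overline\rho,l}=\delta_{kl}\,d_Y/\dim(\overline\rho)$, and let $B_{\overline\rho,kl}$ be the operators formed with them in the same way. Then the $B_{\rho,kl}$ are a linear basis of the centre of $\mathcal B$, and $$B_{\rho,kl}^*=B_{\overline\rho,kl},\qquad B_{\rho,kl}\,B_{\sigma,mn}=\sum_{\tau\prec\rho\sigma}\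 \sum_{p,q} f^{\tau,pq}_{\rho,kl;\,\sigma,mn}\,B_{\tau,pq},$$ where the complex numbers $f^{\tau,pq}_{\rho,kl;\,\sigma,mn}=f^{\tau,pq}_{\sigma,mn;\,\rho,kl}$ are given by $$f^{\tau,pq}_{\rho,kl;\,\sigma,mn}\cdot 1=\frac{\dim(\tau)^2}{d_Ld_R}\;W^{L*}_{\tau,p}\Big(\big(W^L_{\rho,k}W^{R*}_{\rho,l}\big)\ast\big(W^L_{\sigma,m}W^{R*}_{\sigma,n}\big)\Big)W^R_{\tau,q},$$ with the commutative product $T_1\ast T_2=X^{L*}\,\Theta^L(T_1)\,T_2\,X^R$ on $\mathrm{Hom}(\Theta^R,\Theta^L)$. **Canonical/canonical case.** Let $\mathcal C$ have finitely many classes of irreducible objects, with representatives $\rho$ including $\mathrm{id}$, and let $t_a\in\mathrm{Hom}(\tau,\rho\sigma)$, $a=1,\dots,N^\tau_{\rho\sigma}=\dim\mathrm{Hom}(\tau,\rho\sigma)$, be orthonormal isometries which give complete decompositions of the products $\rho\sigma$. Let $j$ be an involutive antilinear *-automorphism of $\mathcal A$ such that $\overline\rho:=j\rho j$ maps $\mathcal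 C$ to itself, $j(\varepsilon_{\rho,\sigma})=\varepsilon_{\overline\sigma,\overline\rho}^*$, and $\overline\rho$ is a conjugate of $\rho$ (with a standard solution) for each representative. Let $\mathcal A_2$ be a unital C*-algebra containing commuting images of two copies of $\mathcal A$ (elements $a\otimes b$), and let $\mathcal C_2$ be a braided category of endomorphisms of $\mathcal A_2$, as above, which contains $\mathcal C\otimes\mathcal C^{\mathrm{opp}}$ as a full braided tensor subcategory: objects $\rho\otimes\sigma$ with $(\rho\otimes\sigma)(a\otimes b)=\rho(a)\otimes\sigma(b)$, compatible with composition, intertwiner spaces spanned by the $t\otimes s$, and braiding $\varepsilon_{\rho,\rho'}\otimes\varepsilon_{\sigma',\sigma}^*$. Let $\Theta\in\mathcal C_2$ be a direct sum of the $\rho\otimes\overline\rho$ (one for each representative), by isometries $T_\rho\in\mathrm{Hom}(\rho\otimes\overline\rho,\Theta)$ with $T_\rho^*T_\sigma=\delta_{\rho\sigma}$, $\sum_\rho T_\rho T_\rho^*=1$. Then, with $d=\big(\sum_\rho\dim(\rho)^2\big)^{1/2}$, $$\Theta,\qquad W=d^{1/2}\,T_{\mathrm{id}},\qquad X=d^{-1/2}\sum_{\rho,\sigma,\tau}\Big(\frac{\dim(\rho)\dim(\sigma)}{\dim(\tau)}\Big)^{1/2}\Theta(T_\sigma)T_\rho\Big(\sum_a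 t_a\otimes j(t_a)\Big)T_\tau^*$$ is a commutative Q-system of dimension $d=\sqrt{\dim\Theta}$. Take $A^L=A^R$ to be this Q-system, and let $W_\rho\in\mathrm{Hom}(\rho\otimes\overline\rho,\Theta)$ with $W_\rho^*W_\rho=d/\dim(\rho\otimes\overline\rho)$ be used both as $W^L_\rho$ and as $W^R_\rho$. Then the coefficients are $$f_{\rho\otimes\overline\rho,\,\sigma\otimes\overline\sigma}^{\tau\otimes\overline\tau}=N_{\rho\sigma}^\tau\,\frac{\dim(\tau)}{\dim(\rho)\dim(\sigma)},$$ and the elements $b_\rho=\dim(\rho)\,B_{\rho\otimes\overline\rho}$ represent the fusion rules: $b_{\mathrm{id}}=1$ and $b_\rho b_\sigma=\sum_\tau N_{\rho\sigma}^\tau\,b_\tau$. -/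

import Mathlib

noncomputable section

open scoped ComplexConjugate

namespace Sectors

/-- Unital *-endomorphisms of `A`. -/
abbrev End (A : Type*) [CStarAlgebra A] := A →⋆ₐ[ℂ] A

section Basic

variable {A : Type*} [CStarAlgebra A]

/-- The identity endomorphism. -/
abbrev idEnd (A : Type*) [CStarAlgebra A] : End A := StarAlgHom.id ℂ A

/-- The space of intertwiners `t : ρ → σ`, i.e. `t ρ(a) = σ(a) t` for all `a`. -/
def Hom (ρ σ : End A) : Submodule ℂ A where
  carrier := {t | ∀ a, t * ρ a = σ a * t}
  add_mem' := by
    intro s t hs ht a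
    rw [add_mul, mul_add, hs a, ht a]
  zero_mem' := by intro a; simp
  smul_mem' := by
    intro c t ht a
    rw [smul_mul_assoc, mul_smul_comm, ht a]

/-- `ρ` is irreducible: its self-intertwiners are scalars. -/
def IsIrred (ρ : End A) : Prop := ∀ t ∈ Hom ρ ρ, ∃ c : ℂ, t = c • (1 : A)

/-- Unitary equivalence of endomorphisms. -/
def Equivalent (ρ σ : End A) : Prop := ∃ u ∈ Hom ρ σ, star u * u = 1 ∧ u * star u = 1

/-- `τ ≺ ρ`: `τ` is contained in `ρ`, i.e. there is an isometry in `Hom τ ρ`. -/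
def Contained (τ ρ : End A) : Prop := ∃ s ∈ Hom τ ρ, star s * s = 1

/-- A solution `R : id → ρ' ρ`, `R' : id → ρ ρ'` of the conjugacy relations. -/
def IsConjPair (ρ ρ' : End A) (R R' : A) : Prop :=
  R ∈ Hom (idEnd A) (ρ'.comp ρ) ∧ R' ∈ Hom (idEnd A) (ρ.comp ρ') ∧
    star R' * ρ R = 1 ∧ star R * ρ' R' = 1

/-- The dimension of an endomorphism: the infimum of `d` over all normalized solutions
of the conjugacy relations. (Only used for endomorphisms for which a solution exists.) -/
def dim (ρ : End A) : ℝ :=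
  sInf {d : ℝ | ∃ (ρ' : End A) (R R' : A), IsConjPair ρ ρ' R R' ∧
    star R * R = (d : ℂ) • (1 : A) ∧ star R' * R' = (d : ℂ) • (1 : A)}

/-- A standard solution of the conjugacy relations: one which attains the dimension. -/
def IsStandardPair (ρ ρ' : End A) (R R' : A) : Prop :=
  IsConjPair ρ ρ' R R' ∧
    star R * R = (dim ρ : ℂ) • (1 : A) ∧ star R' * R' = (dim ρ : ℂ) • (1 : A)

/-- A full subcategory of the tensor category of endomorphisms of `A`, which is simple
(`Hom(id,id) = ℂ`), closed under composition, and equipped with a unitary braiding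
`ε ρ σ : ρ σ → σ ρ`. Only the values of `ε` on objects matter. -/
structure BraidedEnd (A : Type*) [CStarAlgebra A] where
  obj : Set (End A)
  id_mem : idEnd A ∈ obj
  comp_mem : ∀ {ρ σ}, ρ ∈ obj → σ ∈ obj → ρ.comp σ ∈ obj
  simple : IsIrred (idEnd A)
  ε : End A → End A → A
  ε_mem : ∀ {ρ σ}, ρ ∈ obj → σ ∈ obj → ε ρ σ ∈ Hom (ρ.comp σ) (σ.comp ρ)
  star_ε_mul : ∀ {ρ σ}, ρ ∈ obj → σ ∈ obj → star (ε ρ σ) * ε ρ σ = 1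
  ε_mul_star : ∀ {ρ σ}, ρ ∈ obj → σ ∈ obj → ε ρ σ * star (ε ρ σ) = 1
  natural_left : ∀ {ρ ρ' σ}, ρ ∈ obj → ρ' ∈ obj → σ ∈ obj → ∀ t ∈ Hom ρ ρ',
    ε ρ' σ * t = σ t * ε ρ σ
  natural_right : ∀ {ρ σ σ'}, ρ ∈ obj → σ ∈ obj → σ' ∈ obj → ∀ s ∈ Hom σ σ',
    ε ρ σ' * ρ s = s * ε ρ σ
  hexagon_left : ∀ {ρ ρ' σ}, ρ ∈ obj → ρ' ∈ obj → σ ∈ obj →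
    ε (ρ.comp ρ') σ = ε ρ σ * ρ (ε ρ' σ)
  hexagon_right : ∀ {ρ σ σ'}, ρ ∈ obj → σ ∈ obj → σ' ∈ obj →
    ε ρ (σ.comp σ') = σ (ε ρ σ') * ε ρ σ

/-- A Q-system `(θ, w, x)` with `w^* w = x^* x = d`. The condition `d = √(dim θ)` is the
separate predicate `QSystem.IsStandard`. -/
structure QSystem (A : Type*) [CStarAlgebra A] where
  θ : End A
  w : A
  x : A
  d : ℝ
  w_mem : w ∈ Hom (idEnd A) θ
  x_mem : x ∈ Hom θ (θ.comp θ)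
  unit_left : star w * x = 1
  unit_right : θ (star w) * x = 1
  assoc : x * x = θ x * x
  frobenius : x * star x = θ (star x) * x
  star_w_mul : star w * w = (d : ℂ) • (1 : A)
  star_x_mul : star x * x = (d : ℂ) • (1 : A)

/-- The dimension of the Q-system is `d = √(dim θ)`. -/
def QSystem.IsStandard (Q : QSystem A) : Prop := Q.d = Real.sqrt (dim Q.θ)

/-- Commutativity of a Q-system in the braided category `C`: `ε_{θ,θ} x = x`. -/
def QSystem.IsCommutative (C : BraidedEnd A) (Q : QSystem A) : Prop :=
  C.ε Q.θ Q.θ * Q.x = Q.x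

/-- The canonical solution `r = x w : id → θ θ` of the conjugacy relations for `θ`. -/
def QSystem.r (Q : QSystem A) : A := Q.x * Q.w

namespace QSystem

variable (Q : QSystem A)

lemma w_mul (a : A) : Q.w * a = Q.θ a * Q.w := Q.w_mem a

lemma star_w_mul_θ (a : A) : star Q.w * Q.θ a = a * star Q.w := by
  have h := congrArg star (Q.w_mul (star a))
  simpa [map_star] using h.symm

lemma x_mul_θ (a : A) : Q.x * Q.θ a = Q.θ (Q.θ a) * Q.x := Q.x_mem a

lemma star_x_mul_θθ (a : A) : star Q.x * Q.θ (Q.θ a) = Q.θ a * star Q.x := by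
  have h := congrArg star (Q.x_mul_θ (star a))
  simpa [map_star] using h.symm

lemma star_x_mul_θ_x : star Q.x * Q.θ Q.x = Q.x * star Q.x := by
  have h := congrArg star Q.frobenius
  simpa [map_star] using h.symm

lemma star_x_mul_star_x : star Q.x * star Q.x = star Q.x * Q.θ (star Q.x) := by
  have h := congrArg star Q.assoc
  simpa [map_star] using h

end QSystem

/-- The extension `B ⊃ A` defined by a Q-system: the algebra generated by `ι(A)` and one
further element `v` with relations `v ι(a) = ι(θ(a)) v`, `v v = ι(x) v`, `ι(w^*) v = 1`,
`v^* = ι(w^* x^*) v`. Every element is uniquely of the form `ι(a) v`, and `a : A` stands here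
for `ι(a) v`. -/
def Ext (_Q : QSystem A) : Type _ := A

namespace Ext

variable (Q : QSystem A)

instance : AddCommGroup (Ext Q) := inferInstanceAs (AddCommGroup A)
instance : Module ℂ (Ext Q) := inferInstanceAs (Module ℂ A)

/-- The element `ι(a) v`. -/
def mk (a : A) : Ext Q := a

variable {Q}

/-- The coefficient `a` of `ι(a) v`. -/
def coeff (b : Ext Q) : A := b

instance : Mul (Ext Q) := ⟨fun b c => mk Q (coeff b * Q.θ (coeff c) * Q.x)⟩
instance : One (Ext Q) := ⟨mk Q (star Q.w)⟩
instance : Star (Ext Q) := ⟨fun b => mk Q (star Q.w * star Q.x * Q.θ (star (coeff b)))⟩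

lemma mul_def (b c : Ext Q) : b * c = mk Q (coeff b * Q.θ (coeff c) * Q.x) := rfl
lemma one_def : (1 : Ext Q) = mk Q (star Q.w) := rfl
lemma star_def (b : Ext Q) :
    star b = mk Q (star Q.w * star Q.x * Q.θ (star (coeff b))) := rfl
@[simp] lemma coeff_mk (a : A) : coeff (mk Q a) = a := rfl
@[simp] lemma mk_coeff (b : Ext Q) : mk Q (coeff b) = b := rfl
@[simp] lemma coeff_add (b c : Ext Q) : coeff (b + c) = coeff b + coeff c := rfl
@[simp] lemma coeff_zero : coeff (0 : Ext Q) = 0 := rfl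
@[simp] lemma coeff_smul (z : ℂ) (b : Ext Q) : coeff (z • b) = z • coeff b := rfl
lemma ext' {b c : Ext Q} (h : coeff b = coeff c) : b = c := h

lemma mul_assoc' (b c e : Ext Q) : b * c * e = b * (c * e) := by
  apply ext'
  simp only [mul_def, coeff_mk, map_mul]
  calc coeff b * Q.θ (coeff c) * Q.x * Q.θ (coeff e) * Q.x
      = coeff b * Q.θ (coeff c) * (Q.x * Q.θ (coeff e)) * Q.x := by noncomm_ring
    _ = coeff b * Q.θ (coeff c) * Q.θ (Q.θ (coeff e)) * (Q.x * Q.x) := by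
        rw [Q.x_mul_θ]; noncomm_ring
    _ = _ := by rw [Q.assoc]; noncomm_ring

instance : Ring (Ext Q) :=
  { (inferInstance : AddCommGroup (Ext Q)) with
    mul := (· * ·)
    one := 1
    left_distrib := by
      intro b c e; apply ext'
      simp only [mul_def, coeff_mk, coeff_add, map_add]; noncomm_ring
    right_distrib := by
      intro b c e; apply ext'
      simp only [mul_def, coeff_mk, coeff_add]; noncomm_ring
    zero_mul := by intro b; apply ext'; simp [mul_def]
    mul_zero := by intro b; apply ext'; simp [mul_def]
    mul_assoc := mul_assoc'
    one_mul := by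
      intro b; apply ext'
      simp only [mul_def, one_def, coeff_mk]
      rw [Q.star_w_mul_θ, mul_assoc, Q.unit_left, mul_one]
    mul_one := by
      intro b; apply ext'
      simp only [mul_def, one_def, coeff_mk]
      rw [mul_assoc, Q.unit_right, mul_one] }

instance : Algebra ℂ (Ext Q) :=
  Algebra.ofModule
    (by intro z b c; apply ext'; simp [mul_def])
    (by intro z b c; apply ext'; simp [mul_def])

instance : StarRing (Ext Q) where
  star_involutive := by
    intro b; apply ext'
    simp only [star_def, coeff_mk, star_mul, star_star, map_mul, map_star]
    calc star Q.w * star Q.x * (Q.θ (Q.θ (coeff b)) * (Q.θ Q.x * Q.θ Q.w))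
        = star Q.w * (star Q.x * Q.θ (Q.θ (coeff b))) * Q.θ Q.x * Q.θ Q.w := by noncomm_ring
      _ = star Q.w * Q.θ (coeff b) * (star Q.x * Q.θ Q.x) * Q.θ Q.w := by
          rw [Q.star_x_mul_θθ]; noncomm_ring
      _ = coeff b * (star Q.w * Q.x) * star (Q.θ (star Q.w) * Q.x) := by
          rw [Q.star_x_mul_θ_x, Q.star_w_mul_θ]
          simp only [star_mul, map_star, star_star]; noncomm_ring
      _ = coeff b := by rw [Q.unit_left, Q.unit_right]; simp
  star_mul := by
    intro b c; apply ext'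
    simp only [star_def, mul_def, coeff_mk, star_mul, map_mul]
    have h1 : Q.θ (star Q.w) * Q.θ (star Q.x) * Q.x = star Q.x := by
      rw [mul_assoc, ← Q.frobenius, ← mul_assoc, Q.unit_right, one_mul]
    symm
    calc star Q.w * star Q.x * Q.θ (star (coeff c)) *
          (Q.θ (star Q.w) * Q.θ (star Q.x) * Q.θ (Q.θ (star (coeff b)))) * Q.x
        = star Q.w * star Q.x * Q.θ (star (coeff c)) *
          (Q.θ (star Q.w) * Q.θ (star Q.x) * (Q.θ (Q.θ (star (coeff b))) * Q.x)) := by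
          noncomm_ring
      _ = star Q.w * star Q.x * Q.θ (star (coeff c)) *
          (Q.θ (star Q.w) * Q.θ (star Q.x) * Q.x) * Q.θ (star (coeff b)) := by
          rw [← Q.x_mul_θ]; noncomm_ring
      _ = star Q.w * star Q.x * (Q.θ (star (coeff c)) * star Q.x) * Q.θ (star (coeff b)) := by
          rw [h1]; noncomm_ring
      _ = star Q.w * (star Q.x * star Q.x) * Q.θ (Q.θ (star (coeff c))) *
          Q.θ (star (coeff b)) := by
          rw [← Q.star_x_mul_θθ]; noncomm_ring
      _ = _ := by
          rw [Q.star_x_mul_star_x]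
          simp only [map_star]
          noncomm_ring
  star_add := by
    intro b c; apply ext'
    simp only [star_def, coeff_mk, coeff_add, star_add, map_add]; noncomm_ring

/-- The generator `v`. -/
def v (Q : QSystem A) : Ext Q := mk Q 1

/-- The embedding `ι : A → B`. -/
def incl (Q : QSystem A) (a : A) : Ext Q := mk Q (a * star Q.w)

lemma incl_mul_v (a : A) : incl Q a * v Q = mk Q a := by
  apply ext'
  simp [incl, v, mul_def, mul_assoc, Q.unit_left]

lemma v_mul_incl (a : A) : v Q * incl Q a = incl Q (Q.θ a) * v Q := by
  rw [incl_mul_v]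
  apply ext'
  simp [incl, v, mul_def, mul_assoc, Q.unit_right]

lemma v_mul_v : v Q * v Q = incl Q Q.x * v Q := by
  rw [incl_mul_v]
  apply ext'
  simp [v, mul_def]

lemma star_v : star (v Q) = incl Q (star Q.w * star Q.x) * v Q := by
  rw [incl_mul_v]
  apply ext'
  simp [v, star_def]

lemma incl_star_w_mul_v : incl Q (star Q.w) * v Q = 1 := incl_mul_v _

lemma incl_one : incl Q 1 = 1 := by apply ext'; simp [incl, one_def]

lemma incl_mul (a b : A) : incl Q (a * b) = incl Q a * incl Q b := by
  apply ext'
  simp only [incl, mul_def, coeff_mk, map_mul]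
  rw [show a * star Q.w * (Q.θ b * Q.θ (star Q.w)) * Q.x
    = a * (star Q.w * Q.θ b) * (Q.θ (star Q.w) * Q.x) by noncomm_ring,
    Q.unit_right, Q.star_w_mul_θ]
  noncomm_ring

lemma incl_star (a : A) : incl Q (star a) = star (incl Q a) := by
  apply ext'
  simp only [incl, star_def, coeff_mk, star_mul, star_star, map_mul]
  have h : star Q.x * Q.θ Q.w = 1 := by
    have := congrArg star Q.unit_right
    simpa [map_star] using this
  rw [show star Q.w * star Q.x * (Q.θ Q.w * Q.θ (star a))
    = star Q.w * (star Q.x * Q.θ Q.w) * Q.θ (star a) by noncomm_ring, h, mul_one,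
    Q.star_w_mul_θ]

end Ext

namespace QSystem

/-- The opposite braiding `ε⁻(θL,θR) = ε(θR,θL)^* : θL θR → θR θL`. -/
def εMinus (C : BraidedEnd A) (QL QR : QSystem A) : A := star (C.ε QR.θ QL.θ)

lemma star_εMinus_mul (C : BraidedEnd A) {QL QR : QSystem A} (hL : QL.θ ∈ C.obj)
    (hR : QR.θ ∈ C.obj) : star (εMinus C QL QR) * εMinus C QL QR = 1 := by
  simpa [εMinus] using C.ε_mul_star hR hL

lemma εMinus_mul_star (C : BraidedEnd A) {QL QR : QSystem A} (hL : QL.θ ∈ C.obj)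
    (hR : QR.θ ∈ C.obj) : εMinus C QL QR * star (εMinus C QL QR) = 1 := by
  simpa [εMinus] using C.star_ε_mul hR hL

lemma εMinus_mul_θθ (C : BraidedEnd A) {QL QR : QSystem A} (hL : QL.θ ∈ C.obj)
    (hR : QR.θ ∈ C.obj) (a : A) :
    εMinus C QL QR * QL.θ (QR.θ a) = QR.θ (QL.θ a) * εMinus C QL QR := by
  have := congrArg star (C.ε_mem hR hL (star a))
  simpa [εMinus, map_star] using this.symm

lemma θ_x_mul_εMinus (C : BraidedEnd A) {QL QR : QSystem A} (hL : QL.θ ∈ C.obj)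
    (hR : QR.θ ∈ C.obj) :
    QR.θ QL.x * εMinus C QL QR = εMinus C QL QR * QL.θ (εMinus C QL QR) * QL.x := by
  have h := C.natural_right hR hL (C.comp_mem hL hL) _ QL.x_mem
  rw [C.hexagon_right hR hL hL] at h
  have e1 : εMinus C QL QR * C.ε QR.θ QL.θ = 1 := C.star_ε_mul hR hL
  have e2 : C.ε QR.θ QL.θ * εMinus C QL QR = 1 := C.ε_mul_star hR hL
  generalize C.ε QR.θ QL.θ = f at *
  generalize εMinus C QL QR = e at *
  have e3 : QL.θ e * QL.θ f = 1 := by rw [← map_mul, e1, map_one]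
  calc QR.θ QL.x * e = e * (QL.θ e * QL.θ f) * f * QR.θ QL.x * e := by
        rw [e3, mul_one, e1, one_mul]
    _ = e * QL.θ e * (QL.θ f * f * QR.θ QL.x) * e := by noncomm_ring
    _ = e * QL.θ e * QL.x * (f * e) := by rw [h]; noncomm_ring
    _ = _ := by rw [e2, mul_one]

lemma x_mul_εMinus (C : BraidedEnd A) {QL QR : QSystem A} (hL : QL.θ ∈ C.obj)
    (hR : QR.θ ∈ C.obj) :
    QR.x * εMinus C QL QR = QR.θ (εMinus C QL QR) * εMinus C QL QR * QL.θ QR.x := by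
  have h := C.natural_left hR (C.comp_mem hR hR) hL _ QR.x_mem
  rw [C.hexagon_left hR hR hL] at h
  have e1 : εMinus C QL QR * C.ε QR.θ QL.θ = 1 := C.star_ε_mul hR hL
  have e2 : C.ε QR.θ QL.θ * εMinus C QL QR = 1 := C.ε_mul_star hR hL
  generalize C.ε QR.θ QL.θ = f at *
  generalize εMinus C QL QR = e at *
  have e3 : QR.θ e * QR.θ f = 1 := by rw [← map_mul, e1, map_one]
  calc QR.x * e = QR.θ e * (e * f) * QR.θ f * QR.x * e := by
        rw [e1, mul_one, e3, one_mul]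
    _ = QR.θ e * e * (f * QR.θ f * QR.x) * e := by noncomm_ring
    _ = QR.θ e * e * QL.θ QR.x * (f * e) := by rw [h]; noncomm_ring
    _ = _ := by rw [e2, mul_one]

lemma θ_star_w_mul_εMinus (C : BraidedEnd A) {QL QR : QSystem A} (hL : QL.θ ∈ C.obj)
    (hR : QR.θ ∈ C.obj) : QR.θ (star QL.w) * εMinus C QL QR = star QL.w := by
  have h := C.natural_right hR C.id_mem hL _ QL.w_mem
  have h1 := C.hexagon_right hR C.id_mem C.id_mem
  have h2 : C.ε QR.θ (idEnd A) = 1 := by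
    have h3 := C.star_ε_mul hR C.id_mem
    change C.ε QR.θ (idEnd A) = C.ε QR.θ (idEnd A) * C.ε QR.θ (idEnd A) at h1
    rw [← h3]; nth_rw 3 [h1]
    rw [← mul_assoc, h3, one_mul]
  rw [h2, mul_one] at h
  have := congrArg star h
  simpa [εMinus, map_star] using this

lemma star_w_mul_εMinus (C : BraidedEnd A) {QL QR : QSystem A} (hL : QL.θ ∈ C.obj)
    (hR : QR.θ ∈ C.obj) : star QR.w * εMinus C QL QR = QL.θ (star QR.w) := by
  have h := C.natural_left C.id_mem hR hL _ QR.w_mem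
  have h1 := C.hexagon_left C.id_mem C.id_mem hL
  have h2 : C.ε (idEnd A) QL.θ = 1 := by
    have h3 := C.star_ε_mul C.id_mem hL
    change C.ε (idEnd A) QL.θ = C.ε (idEnd A) QL.θ * C.ε (idEnd A) QL.θ at h1
    rw [← h3]; nth_rw 3 [h1]
    rw [← mul_assoc, h3, one_mul]
  rw [h2, mul_one] at h
  have := congrArg star h
  simpa [εMinus, map_star] using this

/-- The braided product `QL ×⁻ QR` of two Q-systems in `C`:
`θ = θL θR`, `w = θL(wR) wL`, `x = θL(ε⁻) xL θL(xR)`. -/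
def braidedProd (C : BraidedEnd A) (QL QR : QSystem A) (hL : QL.θ ∈ C.obj)
    (hR : QR.θ ∈ C.obj) : QSystem A where
  θ := QL.θ.comp QR.θ
  w := QL.θ QR.w * QL.w
  x := QL.θ (εMinus C QL QR) * QL.x * QL.θ QR.x
  d := QL.d * QR.d
  w_mem := by
    intro a
    change QL.θ QR.w * QL.w * a = QL.θ (QR.θ a) * (QL.θ QR.w * QL.w)
    rw [mul_assoc, QL.w_mul, ← mul_assoc, ← map_mul, QR.w_mul, map_mul, mul_assoc]
  x_mem := by
    intro a
    have he := εMinus_mul_θθ C hL hR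
    change QL.θ (εMinus C QL QR) * QL.x * QL.θ QR.x * QL.θ (QR.θ a)
      = QL.θ (QR.θ (QL.θ (QR.θ a))) * (QL.θ (εMinus C QL QR) * QL.x * QL.θ QR.x)
    generalize εMinus C QL QR = e at *
    calc QL.θ e * QL.x * QL.θ QR.x * QL.θ (QR.θ a)
        = QL.θ e * QL.x * QL.θ (QR.x * QR.θ a) := by rw [map_mul]; noncomm_ring
      _ = QL.θ e * (QL.x * QL.θ (QR.θ (QR.θ a))) * QL.θ QR.x := by
          rw [QR.x_mul_θ, map_mul]; noncomm_ring
      _ = QL.θ (e * QL.θ (QR.θ (QR.θ a))) * QL.x * QL.θ QR.x := by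
          rw [QL.x_mul_θ, map_mul]; noncomm_ring
      _ = _ := by rw [he, map_mul]; noncomm_ring
  unit_left := by
    have he := star_w_mul_εMinus C hL hR
    generalize εMinus C QL QR = e at *
    rw [star_mul, ← map_star]
    calc star QL.w * QL.θ (star QR.w) * (QL.θ e * QL.x * QL.θ QR.x)
        = star QL.w * QL.θ (star QR.w * e) * QL.x * QL.θ QR.x := by
          rw [map_mul]; noncomm_ring
      _ = star QL.w * (QL.θ (QL.θ (star QR.w)) * QL.x) * QL.θ QR.x := by
          rw [he]; noncomm_ring
      _ = (star QL.w * QL.x) * QL.θ (star QR.w * QR.x) := by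
          rw [← QL.x_mul_θ, map_mul]; noncomm_ring
      _ = 1 := by rw [QL.unit_left, QR.unit_left, map_one, one_mul]
  unit_right := by
    have he := εMinus_mul_θθ C hL hR (star QR.w)
    have hw := θ_star_w_mul_εMinus C hL hR
    generalize εMinus C QL QR = e at *
    change QL.θ (QR.θ (star (QL.θ QR.w * QL.w))) * (QL.θ e * QL.x * QL.θ QR.x) = 1
    rw [star_mul, ← map_star]
    calc QL.θ (QR.θ (star QL.w * QL.θ (star QR.w))) * (QL.θ e * QL.x * QL.θ QR.x)
        = QL.θ (QR.θ (star QL.w) * (QR.θ (QL.θ (star QR.w)) * e)) * QL.x * QL.θ QR.x := by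
          simp only [map_mul]; noncomm_ring
      _ = QL.θ ((QR.θ (star QL.w) * e) * QL.θ (QR.θ (star QR.w))) * QL.x * QL.θ QR.x := by
          rw [← he, ← mul_assoc (QR.θ (star QL.w))]
      _ = QL.θ (QR.θ (star QR.w) * star QL.w) * QL.x * QL.θ QR.x := by
          rw [hw, QL.star_w_mul_θ]
      _ = QL.θ (QR.θ (star QR.w)) * (QL.θ (star QL.w) * QL.x) * QL.θ QR.x := by
          rw [map_mul]; noncomm_ring
      _ = QL.θ (QR.θ (star QR.w) * QR.x) := by
          rw [QL.unit_right, mul_one, map_mul]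
      _ = 1 := by rw [QR.unit_right, map_one]
  assoc := by
    have he := εMinus_mul_θθ C hL hR
    have hq := x_mul_εMinus C hL hR
    have hp := θ_x_mul_εMinus C hL hR
    generalize εMinus C QL QR = e at *
    change (QL.θ e * QL.x * QL.θ QR.x) * (QL.θ e * QL.x * QL.θ QR.x)
      = QL.θ (QR.θ (QL.θ e * QL.x * QL.θ QR.x)) * (QL.θ e * QL.x * QL.θ QR.x)
    have hA := QL.assoc
    have hB := QR.assoc
    have hx := QL.x_mul_θ
    generalize QL.x = p at *
    generalize QR.x = q at *
    generalize QL.θ = α at *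
    generalize QR.θ = β at *
    trans α e * α (α (β e)) * α (α e) * (p * p) * α (q * q)
    · calc (α e * p * α q) * (α e * p * α q)
          = α e * p * α (q * e) * p * α q := by rw [map_mul]; noncomm_ring
        _ = α e * (p * α (β e * e * α q)) * p * α q := by rw [hq]; noncomm_ring
        _ = α e * α (α (β e)) * α (α e) * (α (α (α q)) * p) * p * α q := by
            rw [hx]; simp only [map_mul]; noncomm_ring
        _ = α e * α (α (β e)) * α (α e) * p * (α (α q) * p) * α q := by
            rw [← hx]; noncomm_ring
        _ = _ := by rw [← hx, map_mul]; noncomm_ring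
    · symm
      calc α (β (α e * p * α q)) * (α e * p * α q)
          = α (β (α e)) * α (β p) * α (β (α q) * e) * p * α q := by
            simp only [map_mul]; noncomm_ring
        _ = α (β (α e)) * α (β p * e) * α (α (β q)) * p * α q := by
            rw [← he]; simp only [map_mul]; noncomm_ring
        _ = α (β (α e) * e) * α (α e) * α p * (α (α (β q)) * p) * α q := by
            rw [hp]; simp only [map_mul]; noncomm_ring
        _ = α e * α (α (β e)) * α (α e) * (α p * p) * α (β q * q) := by
            rw [← he, ← hx]; simp only [map_mul]; noncomm_ring
        _ = _ := by rw [← hA, ← hB]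
  frobenius := by
    have he := εMinus_mul_θθ C hL hR
    have hq := x_mul_εMinus C hL hR
    have hp := θ_x_mul_εMinus C hL hR
    have h1 := star_εMinus_mul C hL hR
    have h2 := εMinus_mul_star C hL hR
    generalize εMinus C QL QR = e at *
    change (QL.θ e * QL.x * QL.θ QR.x) * star (QL.θ e * QL.x * QL.θ QR.x)
      = QL.θ (QR.θ (star (QL.θ e * QL.x * QL.θ QR.x))) * (QL.θ e * QL.x * QL.θ QR.x)
    have hA := QL.frobenius
    have hB := QR.frobenius
    have hx := QL.x_mul_θ
    have hx' := QL.star_x_mul_θθ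
    generalize QL.x = p at *
    generalize QR.x = q at *
    generalize QL.θ = α at *
    generalize QR.θ = β at *
    have hp' : β (star p) * e = e * star p * α (star e) := by
      have h3 : e * star p = β (star p) * e * α e := by
        have h4 : star e * β p = α e * p * star e := by
          calc star e * β p = star e * (β p * e) * star e := by
                rw [mul_assoc, mul_assoc, h2, mul_one]
            _ = (star e * e) * α e * p * star e := by rw [hp]; noncomm_ring
            _ = _ := by rw [h1, one_mul]
        have h5 := congrArg star h4
        have h6 : β (star p) * e = e * star p * α (star e) := by
          simpa [map_star, mul_assoc] using h5
        rw [h6, mul_assoc, ← map_mul, h1, map_one, mul_one]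
      rw [h3, mul_assoc, ← map_mul, h2, map_one, mul_one]
    have hq' : star e * β (star e) * q = α q * star e := by
      have h3 : β (star e) * β e = 1 := by rw [← map_mul, h1, map_one]
      calc star e * β (star e) * q = star e * β (star e) * (q * e) * star e := by
            rw [mul_assoc _ (q * e), mul_assoc q, h2, mul_one]
        _ = star e * (β (star e) * β e) * e * α q * star e := by rw [hq]; noncomm_ring
        _ = _ := by rw [h3, mul_one, h1, one_mul]
    simp only [star_mul, ← map_star]
    trans α e * p * α (β (star q) * q) * star p * α (star e)
    · rw [← hB]; simp only [map_mul]; noncomm_ring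
    · symm
      calc α (β (α (star q) * (star p * α (star e)))) * (α e * p * α q)
          = α (β (α (star q))) * α (β (star p)) * α (β (α (star e)) * e) * p * α q := by
            simp only [map_mul]; noncomm_ring
        _ = α (β (α (star q))) * α (β (star p) * e) * α (α (β (star e))) * p * α q := by
            rw [← he]; simp only [map_mul]; noncomm_ring
        _ = α (β (α (star q)) * e) * α (star p) * α (α (star e)) * α (α (β (star e)))
              * p * α q := by
            rw [hp']; simp only [map_mul]; noncomm_ring
        _ = α e * α (α (β (star q))) * α (star p) * (α (α (star e * β (star e))) * p)
              * α q := by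
            rw [← he]; simp only [map_mul]; noncomm_ring
        _ = α e * α (α (β (star q))) * (α (star p) * p) * α (star e * β (star e) * q) := by
            rw [← hx]; simp only [map_mul]; noncomm_ring
        _ = α e * (α (α (β (star q))) * p) * (star p * α (α q)) * α (star e) := by
            rw [← hA, hq']; simp only [map_mul]; noncomm_ring
        _ = _ := by rw [← hx, hx']; simp only [map_mul]; noncomm_ring
  star_w_mul := by
    rw [star_mul, ← map_star]
    calc star QL.w * QL.θ (star QR.w) * (QL.θ QR.w * QL.w)
        = star QL.w * QL.θ (star QR.w * QR.w) * QL.w := by rw [map_mul]; noncomm_ring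
      _ = _ := by
        rw [QR.star_w_mul, map_smul, map_one, mul_smul_comm, smul_mul_assoc, mul_one,
          QL.star_w_mul, smul_smul, Complex.ofReal_mul, mul_comm]
  star_x_mul := by
    have h1 := star_εMinus_mul C hL hR
    generalize εMinus C QL QR = e at *
    simp only [star_mul, ← map_star]
    calc QL.θ (star QR.x) * (star QL.x * QL.θ (star e)) * (QL.θ e * QL.x * QL.θ QR.x)
        = QL.θ (star QR.x) * (star QL.x * QL.θ (star e * e) * QL.x) * QL.θ QR.x := by
          rw [map_mul]; noncomm_ring
      _ = (QL.d : ℂ) • QL.θ (star QR.x * QR.x) := by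
          rw [h1, map_one, mul_one, QL.star_x_mul, mul_smul_comm, smul_mul_assoc, mul_one,
            map_mul]
      _ = _ := by
          rw [QR.star_x_mul, map_smul, map_one, smul_smul, Complex.ofReal_mul]

end QSystem

/-- `W i k : ρ i → θ` (`k < n i`) is a complete decomposition of `θ` into the sectors `ρ i`,
`n i` being the multiplicity of `ρ i` in `θ`. For fixed `i` the `W i k` are mutually
orthogonal with the normalization `W^* W = d / dim ρ` (the one for which the charged fields of
an irreducible extension are isometries). -/
structure IsDecomposition {ι : Type*} [Fintype ι] (Q : QSystem A) (ρ : ι → End A) (n : ι → ℕ)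
    (W : (i : ι) → Fin (n i) → A) : Prop where
  mem : ∀ i k, W i k ∈ Hom (ρ i) Q.θ
  orthonormal : ∀ i k l, star (W i k) * W i l =
    if k = l then ((Q.d / dim (ρ i) : ℝ) : ℂ) • (1 : A) else 0
  complete : ∑ i, ∑ k, ((dim (ρ i) / Q.d : ℝ) : ℂ) • (W i k * star (W i k)) = 1

/-- The Frobenius conjugate `R^* ρ'(W^* r) : ρ' → θ` of a charge intertwiner `W : ρ → θ`, where
`R : id → ρ' ρ` belongs to a standard solution for `ρ` and its conjugate `ρ'`. -/
def conjCharge (Q : QSystem A) (ρ' : End A) (R W : A) : A := star R * ρ' (star W * Q.r)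

/-- The product `T₁ ∗ T₂ = xL^* θL(T₁) T₂ xR` on `Hom(θR, θL)`. -/
def ast (QL QR : QSystem A) (T₁ T₂ : A) : A := star QL.x * (QL.θ T₁ * T₂) * QR.x

/-- The element `dim(τ)² / (dL dR) · VL^* (T₁ ∗ T₂) VR` of `Hom(τ,τ)`, for `VL : τ → θL`,
`VR : τ → θR`. -/
def fusionElement (QL QR : QSystem A) (τ : End A) (VL VR T₁ T₂ : A) : A :=
  ((dim τ ^ 2 / (QL.d * QR.d) : ℝ) : ℂ) • (star VL * ast QL QR T₁ T₂ * VR)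

section BraidedProduct

variable (C : BraidedEnd A) (QL QR : QSystem A) (hL : QL.θ ∈ C.obj) (hR : QR.θ ∈ C.obj)

/-- The algebra of the braided product extension, `B^L ×⁻ B^R`. -/
abbrev ProdExt : Type _ := Ext (QSystem.braidedProd C QL QR hL hR)

/-- The generator `V` of the braided product extension. -/
def V : ProdExt C QL QR hL hR := Ext.v _

/-- The charged field `Ψ^L = ι(W^* θL(wR^*)) V` for `W : ρ → θL`. -/
def fieldL (W : A) : ProdExt C QL QR hL hR :=
  Ext.incl _ (star W * QL.θ (star QR.w)) * V C QL QR hL hR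

/-- The charged field `Ψ^R = ι(W^* wL^*) V` for `W : ρ → θR`. -/
def fieldR (W : A) : ProdExt C QL QR hL hR :=
  Ext.incl _ (star W * star QL.w) * V C QL QR hL hR

/-- The operator `B = Ψ^{L*} Ψ^R` for `WL : ρ → θL`, `WR : ρ → θR`. -/
def boundaryOp (WL WR : A) : ProdExt C QL QR hL hR :=
  star (fieldL C QL QR hL hR WL) * fieldR C QL QR hL hR WR

end BraidedProduct

/-- An antilinear conjugation `j` of `A` preserving the category `C`: an involutive antilinear
*-automorphism such that `ρ ↦ j ρ j` maps `C` to `C` and such that `j`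
carries the braiding to the opposite braiding, `j(ε(ρ,σ)) = ε⁻(jρj, jσj) = ε(jσj, jρj)^*`. -/
structure Conjugation (C : BraidedEnd A) where
  j : A ≃⋆+* A
  j_smul : ∀ (c : ℂ) (a : A), j (c • a) = conj c • j a
  j_j : ∀ a, j (j a) = a
  conjEnd : End A → End A
  conjEnd_apply : ∀ ρ a, conjEnd ρ a = j (ρ (j a))
  conjEnd_mem : ∀ ρ ∈ C.obj, conjEnd ρ ∈ C.obj
  j_ε : ∀ ρ ∈ C.obj, ∀ σ ∈ C.obj, j (C.ε ρ σ) = star (C.ε (conjEnd σ) (conjEnd ρ))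

end Basic

/-- `C₂` contains the tensor product `C ⊗ C^opp` (`opp` = same category, opposite braiding) as
a full braided tensor subcategory, where `A₂` is the algebra of two-dimensional observables
`a ⊗ b = l a * r b`, `a, b ∈ A`: for objects `ρ`, `σ` of `C` there is the object
`ρ ⊗ σ = box ρ σ` of `C₂`,
the intertwiners between such objects are the linear combinations of the `t ⊗ s`, and the
braiding of `ρ ⊗ σ` with `ρ' ⊗ σ'` is `ε(ρ,ρ') ⊗ ε(σ',σ)^*`. -/
structure TensorSquare {A A₂ : Type*} [CStarAlgebra A] [CStarAlgebra A₂]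
    (C : BraidedEnd A) (C₂ : BraidedEnd A₂) where
  l : A →⋆ₐ[ℂ] A₂
  r : A →⋆ₐ[ℂ] A₂
  commute : ∀ a b, l a * r b = r b * l a
  box : End A → End A → End A₂
  box_mem : ∀ {ρ σ}, ρ ∈ C.obj → σ ∈ C.obj → box ρ σ ∈ C₂.obj
  box_apply : ∀ {ρ σ}, ρ ∈ C.obj → σ ∈ C.obj → ∀ a b,
    box ρ σ (l a * r b) = l (ρ a) * r (σ b)
  box_id : box (idEnd A) (idEnd A) = idEnd A₂
  box_comp : ∀ {ρ σ ρ' σ'}, ρ ∈ C.obj → σ ∈ C.obj → ρ' ∈ C.obj → σ' ∈ C.obj →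
    (box ρ σ).comp (box ρ' σ') = box (ρ.comp ρ') (σ.comp σ')
  hom_box : ∀ {ρ σ ρ' σ'}, ρ ∈ C.obj → σ ∈ C.obj → ρ' ∈ C.obj → σ' ∈ C.obj →
    Hom (box ρ σ) (box ρ' σ') =
      Submodule.span ℂ {y | ∃ t ∈ Hom ρ ρ', ∃ s ∈ Hom σ σ', y = l t * r s}
  ε_box : ∀ {ρ σ ρ' σ'}, ρ ∈ C.obj → σ ∈ C.obj → ρ' ∈ C.obj → σ' ∈ C.obj →
    C₂.ε (box ρ σ) (box ρ' σ') = l (C.ε ρ ρ') * r (star (C.ε σ' σ))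

section Canonical

variable {A A₂ : Type*} [CStarAlgebra A] [CStarAlgebra A₂]

/-- The fusion coefficient `N = dim Hom(τ, ρ σ)`. -/
def fusionN (ρ σ τ : End A) : ℕ := Module.finrank ℂ (Hom τ (ρ.comp σ))

/-- `ρ i` (`i ∈ ι`, finite) are representatives of all irreducible objects of `C`, with
`ρ i₀ = id`, and `t i j k a : ρ k → ρ i ρ j` are orthonormal bases of isometries, which give
the complete decompositions of the products `ρ i ρ j`. -/
structure IsFusionSystem {ι : Type*} [Fintype ι] (C : BraidedEnd A) (ρ : ι → End A) (i₀ : ι)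
    (t : (i j k : ι) → Fin (fusionN (ρ i) (ρ j) (ρ k)) → A) : Prop where
  mem : ∀ i, ρ i ∈ C.obj
  irred : ∀ i, IsIrred (ρ i)
  inequivalent : ∀ i j, Equivalent (ρ i) (ρ j) → i = j
  exhaustive : ∀ σ ∈ C.obj, IsIrred σ → ∃ i, Equivalent (ρ i) σ
  unit : ρ i₀ = idEnd A
  t_mem : ∀ i j k a, t i j k a ∈ Hom (ρ k) ((ρ i).comp (ρ j))
  t_orthonormal : ∀ i j k a b, star (t i j k a) * t i j k b = if a = b then 1 else 0
  t_complete : ∀ i j, ∑ k, ∑ a, t i j k a * star (t i j k a) = 1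

/-- `Q` is the canonical Q-system: with isometries `T i : ρ i ⊗ ρ̄ i → Θ`, `ρ̄ = jρj`, which
decompose `Θ`, and `d² = Σ dim(ρ i)²`,
`w = d^{1/2} T i₀` and
`x = d^{-1/2} Σ_{i,j,k} (d_i d_j / d_k)^{1/2} Θ(T j) T i (Σ_a t_a ⊗ j(t_a)) T_k^*`. -/
structure IsCanonical {ι : Type*} [Fintype ι] {C : BraidedEnd A} {C₂ : BraidedEnd A₂}
    (J : Conjugation C) (S : TensorSquare C C₂) (ρ : ι → End A) (i₀ : ι)
    (t : (i j k : ι) → Fin (fusionN (ρ i) (ρ j) (ρ k)) → A)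
    (Θ : End A₂) (T : ι → A₂) (Q : QSystem A₂) : Prop where
  θ_eq : Q.θ = Θ
  d_eq : Q.d = Real.sqrt (∑ i, dim (ρ i) ^ 2)
  w_eq : Q.w = (Real.sqrt Q.d : ℂ) • T i₀
  x_eq : Q.x = ((Real.sqrt Q.d)⁻¹ : ℂ) • ∑ i, ∑ j, ∑ k,
    (Real.sqrt (dim (ρ i) * dim (ρ j) / dim (ρ k)) : ℂ) •
      (Θ (T j) * T i * (∑ a, S.l (t i j k a) * S.r (J.j (t i j k a))) * star (T k))

/-- `T i : ρ i ⊗ ρ̄ i → Θ` are isometries which express `Θ` as the direct sum of the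
`ρ i ⊗ ρ̄ i`. -/
structure IsDirectSum {ι : Type*} [Fintype ι] {C : BraidedEnd A} {C₂ : BraidedEnd A₂}
    (J : Conjugation C) (S : TensorSquare C C₂) (ρ : ι → End A)
    (Θ : End A₂) (T : ι → A₂) : Prop where
  mem : ∀ i, T i ∈ Hom (S.box (ρ i) (J.conjEnd (ρ i))) Θ
  isometry : ∀ i, star (T i) * T i = 1
  orthogonal : ∀ i j, i ≠ j → star (T i) * T j = 0
  complete : ∑ i, T i * star (T i) = 1

end Canonical

end Sectors

end

noncomputable section

open scoped ComplexConjugate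

namespace Sectors

section Basic

variable {A : Type*} [CStarAlgebra A]

/-! ### Intertwiners and scalars -/

section Intertwiners

variable {ρ σ τ : End A} {s t : A}

/-! The centre. An element `ι(a) V` commutes with `ι(A)` exactly when `a : Θ → id` is an
intertwiner, and with `V` exactly when `Θ(a) X = a X`. For a braided product the second condition
follows from the first. Naturality of the braiding pulls `a` through `θL` or through `θR`; by the
hexagon one of the braidings produced cancels the `ε⁻` inside `X`, and the other, `ε(θL,θL)` or
`ε(θR,θR)`, is absorbed by commutativity. Both sides become `θL(a) xL θL(xR)`. So the centre is
`Hom(θL θR, id)` (`mem_center_prodExt_iff`).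

The algebra. With `r = x w` every Q-system is its own conjugate, so `T ↦ rL^* θL(T)` identifies
`Hom(θR, θL)` with the centre. The multiplication becomes `∗` (`bdCoeff_ast`), and the operator
`Ψ^{L*} Ψ^R` corresponds to `WL WR^*` (`boundaryOp_eq`). By Schur's lemma these products are a
basis, whose dual functionals `WL^* (·) WR`, suitably normalized, give the structure constants.
Commutativity of `∗` is centrality read through this identification.

The adjoint. The adjoint of `rL^* θL(T)` is `rR^* T^*`; to recognize the conjugate charges in it,
the two ways of bending `W` to its conjugate must agree (`map_star_conjCharge_mul_r`). This rests on
minimality of dimension. A solution whose left and right traces coincide is minimal, all minimal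
solutions have the same traces, and direct sums and products of standard solutions of irreducibles
have coinciding traces. Since `d = √(dim θ)` makes `r` minimal, its traces can be computed from the
decomposition of `θ`; the two bent charges then have equal norm and the extremal inner product,
hence are equal.

The canonical case. As `j` is antilinear, `∑ e_a ⊗ j(e_a)` does not depend on the orthonormal basis
`e`: a unitary matrix meets its complex conjugate (`sum_tens_eq`). Associativity compares the two
bracketings of a triple product, commutativity compares `ε t` with `t`, and the Frobenius relation
compares direct and crossed bases of `Hom(ρ_m ρ_n, ρ_i ρ_j)`, with weights from partial traces. The
square roots in `X` make these weights match. The fusion coefficient is a squared component of `X`,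
which contains `(∑ t_a ⊗ j(t_a))^* (∑ t_a ⊗ j(t_a)) = N`. -/

theorem star_mem_Hom (ht : t ∈ Hom ρ σ) : star t ∈ Hom σ ρ := by
  intro a
  have h := congrArg star (ht (star a))
  simpa [map_star] using h.symm

theorem mul_mem_Hom (hs : s ∈ Hom σ τ) (ht : t ∈ Hom ρ σ) : s * t ∈ Hom ρ τ := by
  intro a
  rw [mul_assoc, ht a, ← mul_assoc, hs a, mul_assoc]

theorem map_mem_Hom (τ : End A) (ht : t ∈ Hom ρ σ) : τ t ∈ Hom (τ.comp ρ) (τ.comp σ) := by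
  intro a
  change τ t * τ (ρ a) = τ (σ a) * τ t
  rw [← map_mul, ht a, map_mul]

theorem comp_mem_Hom (τ : End A) (ht : t ∈ Hom ρ σ) : t ∈ Hom (ρ.comp τ) (σ.comp τ) :=
  fun a => ht (τ a)

theorem one_mem_Hom (ρ : End A) : (1 : A) ∈ Hom ρ ρ := by
  intro a; simp

end Intertwiners

section Scalars

variable [Nontrivial A]

theorem smul_one_injective {z w : ℂ} (h : z • (1 : A) = w • (1 : A)) : z = w :=
  smul_left_injective ℂ (one_ne_zero (α := A)) h

/-- In a nonzero algebra `r` is the spectrum of `r • 1`, and `y^* y` has nonnegative spectrum. -/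
theorem nonneg_of_star_mul_self {y : A} {r : ℝ} (h : star y * y = (r : ℂ) • (1 : A)) :
    0 ≤ r := by
  have h1 := spectrum_star_mul_self_nonneg (b := y) r
  apply h1
  have h2 : star y * y = algebraMap ℝ A r := by
    rw [h, Algebra.algebraMap_eq_smul_one]; exact Complex.coe_smul r (1 : A)
  rw [h2, spectrum.scalar_eq]
  rfl

theorem exists_real_of_star_mul_self {y : A} {z : ℂ} (h : star y * y = z • (1 : A)) :
    ∃ r : ℝ, 0 ≤ r ∧ z = r := by
  have h1 := congrArg star h
  rw [star_mul, star_star, h, star_smul, star_one] at h1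
  have h2 : conj z = z := (smul_one_injective h1).symm
  obtain ⟨r, rfl⟩ := Complex.conj_eq_iff_real.1 h2
  exact ⟨r, nonneg_of_star_mul_self h, rfl⟩

end Scalars

/-- The equality case of Cauchy–Schwarz: `(a - b)^* (a - b)` expands to zero. -/
theorem eq_of_star_sub_mul_sub {a b : A} {z : ℂ} (haa : star a * a = z • (1 : A))
    (hbb : star b * b = z • (1 : A)) (hab : star a * b = z • (1 : A)) : a = b := by
  have hr : star b * a = conj z • (1 : A) := by
    have := congrArg star hab
    simpa using this
  have hz : conj z • (1 : A) = z • (1 : A) := by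
    have := congrArg star haa
    rw [star_mul, star_star, haa, star_smul, star_one] at this
    exact this.symm
  have : star (a - b) * (a - b) = 0 := by
    rw [star_sub, sub_mul, mul_sub, mul_sub, haa, hab, hr, hz, hbb]; simp
  exact sub_eq_zero.1 ((CStarRing.star_mul_self_eq_zero_iff _).1 this)

/-! ### Solutions of the conjugacy relations -/

section Conjugates

variable {ρ ρ' ρ'' : End A} {R R' P P' : A}

namespace IsConjPair

variable (h : IsConjPair ρ ρ' R R')

include h

theorem mul_left (a : A) : R * a = ρ' (ρ a) * R := h.1 a

theorem mul_right (a : A) : R' * a = ρ (ρ' a) * R' := h.2.1 a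

theorem star_mul_left (a : A) : star R * ρ' (ρ a) = a * star R := star_mem_Hom h.1 a

theorem star_mul_right (a : A) : star R' * ρ (ρ' a) = a * star R' := star_mem_Hom h.2.1 a

theorem zigzag : star R' * ρ R = 1 := h.2.2.1

theorem zigzag' : star R * ρ' R' = 1 := h.2.2.2

theorem star_zigzag : ρ (star R) * R' = 1 := by
  simpa [map_star] using congrArg star h.zigzag

theorem star_zigzag' : ρ' (star R') * R = 1 := by
  simpa [map_star] using congrArg star h.zigzag'

theorem symm : IsConjPair ρ' ρ R' R := ⟨h.2.1, h.1, h.2.2.2, h.2.2.1⟩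

/-- An intertwiner out of the conjugate is determined by its product with `R`. -/
theorem eq_zero_of_mul {v : A} {σ : End A} (hv : v ∈ Hom ρ' σ) (h0 : v * R = 0) : v = 0 := by
  calc v = v * (ρ' (star R') * R) := by rw [h.star_zigzag', mul_one]
    _ = σ (star R') * (v * R) := by rw [← mul_assoc, hv, mul_assoc]
    _ = 0 := by rw [h0, mul_zero]

end IsConjPair

/-- The comparison `P^* ρ''(R') : ρ'' → ρ'` of two conjugates. -/
def compareConj (ρ'' : End A) (P R' : A) : A := star P * ρ'' R'

theorem compareConj_mem (hR : IsConjPair ρ ρ' R R') (hP : IsConjPair ρ ρ'' P P') :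
    compareConj ρ'' P R' ∈ Hom ρ'' ρ' := by
  intro a
  rw [compareConj, mul_assoc, ← map_mul, hR.mul_right, map_mul, ← mul_assoc, hP.star_mul_left,
    mul_assoc]

theorem star_compareConj_mul (hR : IsConjPair ρ ρ' R R') (hP : IsConjPair ρ ρ'' P P') :
    star (compareConj ρ'' P R') * R = P := by
  rw [compareConj, star_mul, star_star, ← map_star, mul_assoc, hP.mul_left, ← mul_assoc,
    ← map_mul, hR.zigzag, map_one, one_mul]

theorem map_compareConj_mul (hP : IsConjPair ρ ρ'' P P') (R' : A) :
    ρ (compareConj ρ'' P R') * P' = R' := by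
  rw [compareConj, map_mul, mul_assoc, ← hP.mul_right, ← mul_assoc, hP.star_zigzag, one_mul]

/-- Conjugates are unique up to isomorphism. The comparison need not be unitary: how far it is from
unitary measures how far the solutions are from minimal. -/
theorem compareConj_mul_compareConj (hR : IsConjPair ρ ρ' R R') (hP : IsConjPair ρ ρ'' P P') :
    compareConj ρ'' P R' * compareConj ρ' R P' = 1 := by
  calc compareConj ρ'' P R' * (star R * ρ' P')
      = star R * ρ' (ρ (compareConj ρ'' P R') * P') := by
        rw [map_mul, ← mul_assoc, ← mul_assoc, hR.star_mul_left]
    _ = 1 := by rw [map_compareConj_mul hP _, hR.zigzag']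

/-- A normalized solution of the conjugacy relations for which the left and the right trace
coincide. -/
structure IsSphericalPair (ρ ρ' : End A) (R R' : A) (d : ℝ) : Prop where
  isConj : IsConjPair ρ ρ' R R'
  norm_left : star R * R = (d : ℂ) • (1 : A)
  norm_right : star R' * R' = (d : ℂ) • (1 : A)
  trace_eq : ∀ h ∈ Hom ρ' ρ', star R * h * R = star R' * ρ h * R'

namespace IsSphericalPair

variable {d p : ℝ} (hR : IsSphericalPair ρ ρ' R R' d) (hP : IsConjPair ρ ρ'' P P')
  (hp : star P * P = (p : ℂ) • (1 : A)) (hp' : star P' * P' = (p : ℂ) • (1 : A))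

include hR hP hp hp'

/-- The source of both minimality and uniqueness. With comparisons `t`, `u` satisfying `t u = 1` one
has `P = t^* R`, so the inner product of `P` and `u R` is `R^* R = d`. Equality of the traces moves
`u^* u` from `R` to `R'`, where `ρ(u) R' = P'` gives `u R` squared norm `p`. Hence `p - d - d + p`.
-/
theorem star_sub_mul_sub :
    star (P - compareConj ρ' R P' * R) * (P - compareConj ρ' R P' * R) =
      ((2 * p - 2 * d : ℝ) : ℂ) • (1 : A) := by
  have h1 : compareConj ρ'' P R' * compareConj ρ' R P' = 1 :=
    compareConj_mul_compareConj hR.isConj hP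
  have h2 := star_compareConj_mul hR.isConj hP
  have h3 := map_compareConj_mul hR.isConj P'
  have hu := compareConj_mem hP hR.isConj
  generalize compareConj ρ'' P R' = t at *
  generalize compareConj ρ' R P' = u at *
  have h4 : star P * (u * R) = (d : ℂ) • (1 : A) := by
    rw [← hR.norm_left, ← h2, star_mul, star_star, mul_assoc, ← mul_assoc t, h1, one_mul]
  have h5 : star (u * R) * P = (d : ℂ) • (1 : A) := by
    have := congrArg star h4
    simpa using this
  have h6 : star (u * R) * (u * R) = (p : ℂ) • (1 : A) := by
    have := hR.trace_eq _ (mul_mem_Hom (star_mem_Hom hu) hu)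
    rw [← hp', ← h3]
    simpa only [star_mul, map_mul, map_star, mul_assoc] using this
  rw [star_sub, sub_mul, mul_sub, mul_sub, hp, h4, h5, h6, ← sub_smul, ← sub_smul, ← sub_smul]
  congr 1
  push_cast
  ring

theorem le [Nontrivial A] : d ≤ p := by
  have := nonneg_of_star_mul_self (star_sub_mul_sub hR hP hp hp')
  linarith

/-- At the minimum the squared distance vanishes, so `u R = P = t^* R`, and an intertwiner out of
`ρ'` is determined by its product with `R`. -/
theorem compareConj_eq (h : p = d) : compareConj ρ' R P' = star (compareConj ρ'' P R') := by
  have h1 := star_sub_mul_sub hR hP hp hp'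
  rw [h] at h1
  have h2 : P - compareConj ρ' R P' * R = 0 := by
    apply (CStarRing.star_mul_self_eq_zero_iff _).1
    rw [h1]; simp
  have h3 := star_compareConj_mul hR.isConj hP
  rw [← sub_eq_zero]
  apply hR.isConj.eq_zero_of_mul
    (Submodule.sub_mem _ (compareConj_mem hP hR.isConj) (star_mem_Hom (compareConj_mem hR.isConj hP)))
  rw [sub_mul, h3, ← neg_sub, h2, neg_zero]

theorem compareConj_mul_star (h : p = d) :
    compareConj ρ'' P R' * star (compareConj ρ'' P R') = 1 := by
  rw [← compareConj_eq hR hP hp hp' h, compareConj_mul_compareConj hR.isConj hP]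

/-- The left trace is the same for all minimal solutions. -/
theorem left_trace_eq (h : p = d) (T : A) :
    star P * ρ'' T * P = star R * ρ' T * R := by
  have h1 := compareConj_mul_star hR hP hp hp' h
  have h2 := star_compareConj_mul hR.isConj hP
  have ht := compareConj_mem hR.isConj hP
  generalize compareConj ρ'' P R' = t at *
  rw [← h2, star_mul, star_star, mul_assoc (star R), ht, mul_assoc, mul_assoc,
    ← mul_assoc t, h1, one_mul, ← mul_assoc]

/-- The right trace is the same for all minimal solutions. -/
theorem right_trace_eq (h : p = d) {T : A} (hT : T ∈ Hom ρ ρ) :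
    star P' * T * P' = star R' * T * R' := by
  have h1 := compareConj_mul_star hR hP hp hp' h
  have h2 : ρ (star (compareConj ρ'' P R')) * R' = P' := by
    rw [← compareConj_eq hR hP hp hp' h]; exact map_compareConj_mul hR.isConj P'
  have ht := star_mem_Hom (compareConj_mem hR.isConj hP)
  generalize compareConj ρ'' P R' = t at *
  rw [← h2, star_mul, ← map_star, star_star, mul_assoc (star R'), mul_assoc, mul_assoc,
    ← mul_assoc T, hT, mul_assoc, ← mul_assoc (ρ t), ← map_mul, h1, map_one, one_mul, ← mul_assoc]

end IsSphericalPair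

/-- Coincidence of the two traces forces minimality, so the infimum is attained. -/
theorem IsSphericalPair.dim_eq [Nontrivial A] {d : ℝ} (hR : IsSphericalPair ρ ρ' R R' d) :
    dim ρ = d := by
  apply IsLeast.csInf_eq
  refine ⟨⟨ρ', R, R', hR.isConj, hR.norm_left, hR.norm_right⟩, ?_⟩
  rintro p ⟨ρ'', P, P', hP, hp, hp'⟩
  exact hR.le hP hp hp'

/-! ### Irreducible endomorphisms -/

/-- Frobenius reciprocity: bending gives `t R = ρ'(g) R` with `g = R'^* ρ(t R)` a self-intertwiner
of `ρ`, hence a scalar. -/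
theorem IsIrred.conj (hρ : IsIrred ρ) (h : IsConjPair ρ ρ' R R') : IsIrred ρ' := by
  intro t ht
  have hg : star R' * ρ (t * R) ∈ Hom ρ ρ := by
    intro a
    rw [mul_assoc, ← map_mul, mul_assoc, h.mul_left, ← mul_assoc, ht, map_mul, map_mul,
      ← mul_assoc, ← mul_assoc, h.star_mul_right, map_mul]
    simp only [mul_assoc]
  obtain ⟨c, hc⟩ := hρ _ hg
  refine ⟨c, sub_eq_zero.1 (h.eq_zero_of_mul (σ := ρ') (Submodule.sub_mem _ ht
    (Submodule.smul_mem _ c (one_mem_Hom ρ'))) ?_)⟩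
  have h1 : ρ' (star R' * ρ (t * R)) * R = t * R := by
    rw [map_mul, mul_assoc, ← h.mul_left, ← mul_assoc, h.star_zigzag', one_mul]
  rw [hc, map_smul, map_one] at h1
  rw [sub_mul, h1, sub_self]

/-- The self-intertwiners of the conjugate are scalars, on which the two traces agree as soon as the
norms do. -/
theorem IsIrred.isSphericalPair (hρ : IsIrred ρ) {d : ℝ} (h : IsConjPair ρ ρ' R R')
    (hR : star R * R = (d : ℂ) • (1 : A)) (hR' : star R' * R' = (d : ℂ) • (1 : A)) :
    IsSphericalPair ρ ρ' R R' d := by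
  refine ⟨h, hR, hR', fun t ht => ?_⟩
  obtain ⟨c, rfl⟩ := hρ.conj h t ht
  simp [hR, hR']

theorem IsIrred.dim_eq [Nontrivial A] (hρ : IsIrred ρ) {d : ℝ} (h : IsConjPair ρ ρ' R R')
    (hR : star R * R = (d : ℂ) • (1 : A)) (hR' : star R' * R' = (d : ℂ) • (1 : A)) :
    dim ρ = d := (hρ.isSphericalPair h hR hR').dim_eq

theorem IsStandardPair.isSphericalPair (hρ : IsIrred ρ) (h : IsStandardPair ρ ρ' R R') :
    IsSphericalPair ρ ρ' R R' (dim ρ) := hρ.isSphericalPair h.1 h.2.1 h.2.2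

theorem IsStandardPair.dim_conj [Nontrivial A] (hρ : IsIrred ρ) (h : IsStandardPair ρ ρ' R R') :
    dim ρ' = dim ρ := (hρ.conj h.1).dim_eq h.1.symm h.2.2 h.2.1

theorem IsStandardPair.dim_pos [Nontrivial A] (h : IsStandardPair ρ ρ' R R') : 0 < dim ρ := by
  refine lt_of_le_of_ne (nonneg_of_star_mul_self h.2.1) fun h0 => ?_
  have h1 := h.2.1
  rw [← h0, Complex.ofReal_zero, zero_smul, CStarRing.star_mul_self_eq_zero_iff] at h1
  have h2 := h.1.zigzag
  rw [h1, map_zero, mul_zero] at h2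
  exact zero_ne_one h2

theorem dim_idEnd [Nontrivial A] (h : IsIrred (idEnd A)) : dim (idEnd A) = 1 :=
  h.dim_eq (ρ' := idEnd A) (R := 1) (R' := 1)
    ⟨one_mem_Hom _, one_mem_Hom _, by simp, by simp⟩ (by simp) (by simp)

variable {σ : End A}

/-- Schur's lemma. -/
theorem eq_zero_of_not_equivalent [Nontrivial A] (hρ : IsIrred ρ) (hσ : IsIrred σ)
    (h : ¬ Equivalent ρ σ) {t : A} (ht : t ∈ Hom ρ σ) : t = 0 := by
  by_contra h0
  obtain ⟨c, hc⟩ := hρ _ (mul_mem_Hom (star_mem_Hom ht) ht)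
  obtain ⟨e, he⟩ := hσ _ (mul_mem_Hom ht (star_mem_Hom ht))
  obtain ⟨r, hr, rfl⟩ := exists_real_of_star_mul_self hc
  have hr0 : r ≠ 0 := by
    rintro rfl
    rw [Complex.ofReal_zero, zero_smul, CStarRing.star_mul_self_eq_zero_iff] at hc
    exact h0 hc
  -- The scalars `t^* t` and `t t^*` coincide because both act on `t` as `t t^* t`.
  have hec : e • t = (r : ℂ) • t := by
    calc e • t = t * star t * t := by rw [he, smul_mul_assoc, one_mul]
      _ = (r : ℂ) • t := by rw [mul_assoc, hc, mul_smul_comm, mul_one]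
  have hec : e = r := smul_left_injective ℂ h0 hec
  have hs : (((Real.sqrt r)⁻¹ : ℝ) : ℂ) * (((Real.sqrt r)⁻¹ : ℝ) : ℂ) * (r : ℂ) = 1 := by
    rw [← Complex.ofReal_mul, ← Complex.ofReal_mul, ← mul_inv, Real.mul_self_sqrt hr,
      inv_mul_cancel₀ hr0, Complex.ofReal_one]
  refine h ⟨(((Real.sqrt r)⁻¹ : ℝ) : ℂ) • t, Submodule.smul_mem _ _ ht, ?_, ?_⟩
  · rw [star_smul, smul_mul_smul_comm, hc, smul_smul]
    simp only [RCLike.star_def, Complex.conj_ofReal, hs, one_smul]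
  · rw [star_smul, smul_mul_smul_comm, he, hec, smul_smul]
    simp only [RCLike.star_def, Complex.conj_ofReal, hs, one_smul]

theorem contained_of_ne_zero [Nontrivial A] (hρ : IsIrred ρ) {t : A} (ht : t ∈ Hom ρ σ)
    (h0 : t ≠ 0) : Contained ρ σ := by
  obtain ⟨c, hc⟩ := hρ _ (mul_mem_Hom (star_mem_Hom ht) ht)
  obtain ⟨r, hr, rfl⟩ := exists_real_of_star_mul_self hc
  have hr0 : r ≠ 0 := by
    rintro rfl
    rw [Complex.ofReal_zero, zero_smul, CStarRing.star_mul_self_eq_zero_iff] at hc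
    exact h0 hc
  refine ⟨(((Real.sqrt r)⁻¹ : ℝ) : ℂ) • t, Submodule.smul_mem _ _ ht, ?_⟩
  rw [star_smul, smul_mul_smul_comm, hc, smul_smul]
  simp only [RCLike.star_def, Complex.conj_ofReal]
  rw [← Complex.ofReal_mul, ← Complex.ofReal_mul, ← mul_inv, Real.mul_self_sqrt hr,
    inv_mul_cancel₀ hr0, Complex.ofReal_one, one_smul]

end Conjugates

end Basic

end Sectors

end

noncomputable section

open scoped ComplexConjugate

namespace Sectors

section Basic

variable {A : Type*} [CStarAlgebra A]

/-! ### Products and direct sums of solutions -/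

theorem IsConjPair.comp {ρ ρ' σ σ' : End A} {R R' S S' : A} (h₁ : IsConjPair ρ ρ' R R')
    (h₂ : IsConjPair σ σ' S S') :
    IsConjPair (ρ.comp σ) (σ'.comp ρ') (σ' R * S) (ρ S' * R') := by
  refine ⟨fun a => ?_, fun a => ?_, ?_, ?_⟩
  · change σ' R * S * a = σ' (ρ' (ρ (σ a))) * (σ' R * S)
    rw [mul_assoc, h₂.mul_left, ← mul_assoc, ← map_mul, h₁.mul_left, map_mul, mul_assoc]
  · change ρ S' * R' * a = ρ (σ (σ' (ρ' a))) * (ρ S' * R')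
    rw [mul_assoc, h₁.mul_right, ← mul_assoc, ← map_mul, h₂.mul_right, map_mul, mul_assoc]
  · change star (ρ S' * R') * ρ (σ (σ' R * S)) = 1
    rw [star_mul, ← map_star, mul_assoc, ← map_mul, map_mul σ, ← mul_assoc, h₂.star_mul_right,
      mul_assoc, h₂.zigzag, mul_one, h₁.zigzag]
  · change star (σ' R * S) * σ' (ρ' (ρ S' * R')) = 1
    rw [star_mul, ← map_star, mul_assoc, ← map_mul, map_mul ρ', ← mul_assoc, h₁.star_mul_left,
      mul_assoc, h₁.zigzag', mul_one, h₂.zigzag']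

/-- Tracing out one factor of `σ' ρ'` leaves a self-intertwiner of the other, a scalar by
irreducibility. It remains to relate the two scalars `x` and `y`. -/
theorem IsSphericalPair.comp {ρ ρ' σ σ' : End A} {R R' S S' : A} {d e : ℝ} (hρ : IsIrred ρ)
    (hσ : IsIrred σ) (h₁ : IsSphericalPair ρ ρ' R R' d) (h₂ : IsSphericalPair σ σ' S S' e) :
    IsSphericalPair (ρ.comp σ) (σ'.comp ρ') (σ' R * S) (ρ S' * R') (d * e) := by
  refine ⟨h₁.isConj.comp h₂.isConj, ?_, ?_, fun t ht => ?_⟩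
  · rw [star_mul, ← map_star, mul_assoc, ← mul_assoc (σ' (star R)), ← map_mul, h₁.norm_left,
      map_smul, map_one, smul_mul_assoc, one_mul, mul_smul_comm, h₂.norm_left, smul_smul,
      Complex.ofReal_mul]
  · rw [star_mul, ← map_star, mul_assoc, ← mul_assoc (ρ (star S')), ← map_mul, h₂.norm_right,
      map_smul, map_one, smul_mul_assoc, one_mul, mul_smul_comm, h₁.norm_right, smul_smul,
      Complex.ofReal_mul, mul_comm]
  · have ht' : ∀ a, t * σ' (ρ' a) = σ' (ρ' a) * t := ht
    have hx : σ' (star R) * t * σ' R ∈ Hom σ' σ' := by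
      intro a
      rw [mul_assoc, ← map_mul, h₁.isConj.mul_left, map_mul, ← mul_assoc, mul_assoc _ t, ht',
        ← mul_assoc, ← map_mul, h₁.isConj.star_mul_left, map_mul]
      simp only [mul_assoc]
    have hy : star S' * σ t * S' ∈ Hom ρ' ρ' := by
      intro a
      rw [mul_assoc, h₂.isConj.mul_right, ← mul_assoc, mul_assoc _ (σ t), ← map_mul, ht', map_mul,
        ← mul_assoc, h₂.isConj.star_mul_right]
      simp only [mul_assoc]
    obtain ⟨x, hx⟩ := hσ.conj h₂.isConj _ hx
    obtain ⟨y, hy⟩ := hρ.conj h₁.isConj _ hy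
    -- The mixed trace, on the left over `ρ'` and on the right over `σ'`, can be evaluated in either
    -- order.
    have hxy : (y * (d : ℂ)) • (1 : A) = (x * (e : ℂ)) • (1 : A) := by
      calc (y * (d : ℂ)) • (1 : A) = star R * (star S' * σ t * S') * R := by
            rw [hy, mul_smul_comm, mul_one, smul_mul_assoc, h₁.norm_left, smul_smul]
        _ = (star R * star S') * σ t * (S' * R) := by simp only [mul_assoc]
        _ = star S' * σ (σ' (star R) * t * σ' R) * S' := by
            rw [← h₂.isConj.star_mul_right, h₂.isConj.mul_right]
            simp only [map_mul, mul_assoc]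
        _ = _ := by
            rw [hx, map_smul, map_one, mul_smul_comm, mul_one, smul_mul_assoc, h₂.norm_right,
              smul_smul]
    change star (σ' R * S) * t * (σ' R * S) = star (ρ S' * R') * ρ (σ t) * (ρ S' * R')
    calc star (σ' R * S) * t * (σ' R * S) = star S * (σ' (star R) * t * σ' R) * S := by
          simp only [star_mul, map_star, mul_assoc]
      _ = (x * (e : ℂ)) • (1 : A) := by
          rw [hx, mul_smul_comm, mul_one, smul_mul_assoc, h₂.norm_left, smul_smul]
      _ = star R' * ρ (star S' * σ t * S') * R' := by
          rw [hy, map_smul, map_one, mul_smul_comm, mul_one, smul_mul_assoc, h₁.norm_right,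
            smul_smul, hxy]
      _ = _ := by simp only [star_mul, map_star, map_mul, mul_assoc]

/-- The isometries `T a : σ a → Θ` express `Θ` as a direct sum of the `σ a`. -/
structure IsOrthDecomp {κ : Type*} [Fintype κ] (Θ : End A) (σ : κ → End A) (T : κ → A) :
    Prop where
  mem : ∀ a, T a ∈ Hom (σ a) Θ
  isometry : ∀ a, star (T a) * T a = 1
  orthogonal : ∀ a b, a ≠ b → star (T a) * T b = 0
  complete : ∑ a, T a * star (T a) = 1

namespace IsOrthDecomp

variable {κ : Type*} [Fintype κ] {Θ : End A} {σ σ' : κ → End A} {T R R' : κ → A} {d : κ → ℝ}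
  (hT : IsOrthDecomp Θ σ T)

include hT

theorem star_mul_sum (f : κ → A) (b : κ) : star (T b) * ∑ a, T a * f a = f b := by
  rw [Finset.mul_sum, Finset.sum_eq_single b]
  · rw [← mul_assoc, hT.isometry, one_mul]
  · intro a _ hab
    rw [← mul_assoc, hT.orthogonal _ _ hab.symm, zero_mul]
  · simp

theorem sum_mul_self (f : κ → A) (b : κ) : (∑ a, f a * star (T a)) * T b = f b := by
  rw [Finset.sum_mul, Finset.sum_eq_single b]
  · rw [mul_assoc, hT.isometry, mul_one]
  · intro a _ hab
    rw [mul_assoc, hT.orthogonal _ _ hab, mul_zero]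
  · simp

theorem eq_sum (x : A) : x = ∑ a, T a * (star (T a) * x) := by
  simp only [← mul_assoc]
  rw [← Finset.sum_mul, hT.complete, one_mul]

theorem eq_sum_right (x : A) : x = ∑ a, x * T a * star (T a) := by
  simp only [mul_assoc]
  rw [← Finset.mul_sum, hT.complete, mul_one]

theorem ext_left {x y : A} (h : ∀ a, star (T a) * x = star (T a) * y) : x = y := by
  rw [hT.eq_sum x, hT.eq_sum y]
  exact Finset.sum_congr rfl fun a _ => by rw [h]

/-- The endomorphism `x ↦ ∑ a, T a (σ' a x) (T a)^*`. -/
def sumEnd (σ' : κ → End A) : End A where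
  toFun x := ∑ a, T a * σ' a x * star (T a)
  map_one' := by simpa using hT.complete
  map_mul' x y := by
    rw [Finset.sum_mul]
    refine Finset.sum_congr rfl fun a _ => ?_
    rw [mul_assoc _ (star (T a))]
    simp only [mul_assoc (T _) (σ' _ _)]
    rw [hT.star_mul_sum (fun a => σ' a y * star (T a)), map_mul]
    simp only [mul_assoc]
  map_zero' := by simp
  map_add' x y := by simp [mul_add, add_mul, Finset.sum_add_distrib]
  commutes' c := by
    simp only [Algebra.algebraMap_eq_smul_one, map_smul, map_one, mul_smul_comm, mul_one,
      smul_mul_assoc]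
    rw [← Finset.smul_sum, hT.complete]
  map_star' x := by simp [star_sum, map_star, mul_assoc]

theorem star_mul_sumEnd (x : A) (a : κ) :
    star (T a) * hT.sumEnd σ' x = σ' a x * star (T a) := by
  change star (T a) * ∑ a, T a * σ' a x * star (T a) = _
  simp only [mul_assoc]
  exact hT.star_mul_sum (fun a => σ' a x * star (T a)) a

theorem sumEnd_mul (x : A) (a : κ) : hT.sumEnd σ' x * T a = T a * σ' a x :=
  hT.sum_mul_self (fun a => T a * σ' a x) a

theorem star_mul_apply (x : A) (a : κ) : star (T a) * Θ x = σ a x * star (T a) :=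
  star_mem_Hom (hT.mem a) x

/-- The components of the direct sum of solutions. -/
def sumSol (T : κ → A) (σ : κ → End A) (R : κ → A) : A := ∑ a, T a * (σ a (T a) * R a)

theorem star_mul_sumSol (σ : κ → End A) (R : κ → A) (a : κ) :
    star (T a) * sumSol T σ R = σ a (T a) * R a :=
  hT.star_mul_sum (fun a => σ a (T a) * R a) a

omit hT in
theorem star_sumSol_mul (σ : κ → End A) (R : κ → A) (x : A) :
    star (sumSol T σ R) * x = ∑ a, star (R a) * σ a (star (T a)) * (star (T a) * x) := by
  rw [sumSol, star_sum, Finset.sum_mul]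
  refine Finset.sum_congr rfl fun a _ => ?_
  simp only [star_mul, map_star, mul_assoc]

theorem isConjPair_sum (h : ∀ a, IsConjPair (σ a) (σ' a) (R a) (R' a)) :
    IsConjPair Θ (hT.sumEnd σ') (sumSol T σ' R) (sumSol T σ R') := by
  refine ⟨fun x => hT.ext_left fun a => ?_, fun x => hT.ext_left fun a => ?_, ?_, ?_⟩
  · change star (T a) * (sumSol T σ' R * x) = star (T a) * (hT.sumEnd σ' (Θ x) * sumSol T σ' R)
    rw [← mul_assoc, ← mul_assoc, hT.star_mul_sumEnd, hT.star_mul_sumSol,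
      mul_assoc (σ' a (Θ x)), hT.star_mul_sumSol, mul_assoc, (h a).mul_left, ← mul_assoc, ← mul_assoc, ← map_mul,
      ← map_mul, hT.mem a x]
  · change star (T a) * (sumSol T σ R' * x) = star (T a) * (Θ (hT.sumEnd σ' x) * sumSol T σ R')
    rw [← mul_assoc, ← mul_assoc, hT.star_mul_apply, hT.star_mul_sumSol,
      mul_assoc (σ a (hT.sumEnd σ' x)), hT.star_mul_sumSol, mul_assoc, (h a).mul_right, ← mul_assoc, ← mul_assoc, ← map_mul,
      ← map_mul, hT.sumEnd_mul]
  · rw [star_sumSol_mul, ← hT.complete]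
    refine Finset.sum_congr rfl fun a _ => ?_
    rw [hT.star_mul_apply, ← mul_assoc, mul_assoc (star (R' a)), ← map_mul, hT.star_mul_sumSol,
      map_mul, ← mul_assoc, (h a).star_mul_right, mul_assoc (T a), (h a).zigzag, mul_one]
  · rw [star_sumSol_mul, ← hT.complete]
    refine Finset.sum_congr rfl fun a _ => ?_
    rw [hT.star_mul_sumEnd, ← mul_assoc, mul_assoc (star (R a)), ← map_mul, hT.star_mul_sumSol,
      map_mul, ← mul_assoc, (h a).star_mul_left, mul_assoc (T a), (h a).zigzag', mul_one]

theorem left_trace_sum (σ' : κ → End A) (R : κ → A) (x : A) :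
    star (sumSol T σ' R) * hT.sumEnd σ' x * sumSol T σ' R =
      ∑ a, star (R a) * σ' a (star (T a) * x * T a) * R a := by
  rw [mul_assoc, star_sumSol_mul]
  refine Finset.sum_congr rfl fun a _ => ?_
  rw [← mul_assoc (star (T a)), hT.star_mul_sumEnd, mul_assoc (σ' a x), hT.star_mul_sumSol]
  simp only [map_mul, mul_assoc]

theorem right_trace_sum (σ : κ → End A) (hT' : ∀ a, T a ∈ Hom (σ a) Θ) (R' : κ → A) (x : A) :
    star (sumSol T σ R') * Θ x * sumSol T σ R' =
      ∑ a, star (R' a) * σ a (star (T a) * x * T a) * R' a := by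
  rw [mul_assoc, star_sumSol_mul]
  refine Finset.sum_congr rfl fun a _ => ?_
  have := star_mem_Hom (hT' a) x
  rw [← mul_assoc (star (T a)), this, mul_assoc (σ a x), hT.star_mul_sumSol]
  simp only [map_mul, mul_assoc]

/-- Since `sumEnd` is a direct sum along the same `T`, each block `T_a^* t T_b` intertwines `σ' b`
and `σ' a`. Moving it past `σ' b (T b)` brings `σ' a (T_a^* T_b)` together, which kills the
off-diagonal blocks. On a diagonal block the two traces agree by hypothesis. -/
theorem isSphericalPair_sum (h : ∀ a, IsSphericalPair (σ a) (σ' a) (R a) (R' a) (d a)) :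
    IsSphericalPair Θ (hT.sumEnd σ') (sumSol T σ' R) (sumSol T σ R') (∑ a, d a) := by
  refine ⟨hT.isConjPair_sum fun a => (h a).isConj, ?_, ?_, fun t ht => ?_⟩
  · have := hT.left_trace_sum σ' R 1
    simpa [hT.isometry, (h _).norm_left, Finset.sum_smul] using this
  · have := hT.right_trace_sum σ hT.mem R' 1
    simpa [hT.isometry, (h _).norm_right, Finset.sum_smul] using this
  · rw [hT.right_trace_sum σ hT.mem R' t, mul_assoc, star_sumSol_mul]
    refine Finset.sum_congr rfl fun a _ => ?_
    have hm : ∀ b, star (T a) * t * T b ∈ Hom (σ' b) (σ' a) := by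
      intro b x
      rw [mul_assoc, ← hT.sumEnd_mul, ← mul_assoc, mul_assoc _ t, ht, ← mul_assoc,
        hT.star_mul_sumEnd]
      simp only [mul_assoc]
    rw [← (h a).trace_eq _ (hm a), sumSol, Finset.mul_sum, Finset.mul_sum, Finset.mul_sum,
      Finset.sum_eq_single a]
    · rw [show star (R a) * σ' a (star (T a)) * (star (T a) * (t * (T a * (σ' a (T a) * R a))))
          = star (R a) * σ' a (star (T a)) * (star (T a) * t * T a * σ' a (T a)) * R a by
          simp only [mul_assoc], hm a,
        show star (R a) * σ' a (star (T a)) * (σ' a (T a) * (star (T a) * t * T a)) * R a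
          = star (R a) * (σ' a (star (T a)) * σ' a (T a)) * (star (T a) * t * T a) * R a by
          simp only [mul_assoc], ← map_mul, hT.isometry, map_one, mul_one]
    · intro b _ hb
      rw [show star (R a) * σ' a (star (T a)) * (star (T a) * (t * (T b * (σ' b (T b) * R b))))
          = star (R a) * σ' a (star (T a)) * (star (T a) * t * T b * σ' b (T b)) * R b by
          simp only [mul_assoc], hm b,
        show star (R a) * σ' a (star (T a)) * (σ' a (T b) * (star (T a) * t * T b)) * R b
          = star (R a) * (σ' a (star (T a)) * σ' a (T b)) * (star (T a) * t * T b) * R b by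
          simp only [mul_assoc], ← map_mul, hT.orthogonal _ _ hb.symm]
      simp
    · simp

section Minimal

variable (hσ : ∀ a, IsIrred (σ a)) (hR : ∀ a, IsStandardPair (σ a) (σ' a) (R a) (R' a))

include hσ hR

/-- The direct sum of standard solutions of irreducibles has equal traces, hence is minimal. -/
theorem dim_eq [Nontrivial A] : dim Θ = ∑ a, dim (σ a) :=
  (hT.isSphericalPair_sum fun a => (hR a).isSphericalPair (hσ a)).dim_eq

variable {Θ' : End A} {P P' : A} (hP : IsStandardPair Θ Θ' P P')

include hP

/-- All minimal solutions give the same trace, so it may be computed with the direct sum of the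
standard solutions. -/
theorem left_trace [Nontrivial A] [DecidableEq κ] (a b : κ) :
    star P * Θ' (T a * star (T b)) * P = if a = b then (dim (σ a) : ℂ) • (1 : A) else 0 := by
  have hS := hT.isSphericalPair_sum fun a => (hR a).isSphericalPair (hσ a)
  rw [hS.left_trace_eq hP.1 hP.2.1 hP.2.2 hS.dim_eq, hT.left_trace_sum, Finset.sum_eq_single a]
  · split_ifs with h
    · subst h
      rw [← mul_assoc, hT.isometry, one_mul, hT.isometry, map_one, mul_one, (hR a).2.1]
    · rw [mul_assoc (star (T a)), mul_assoc (T a), hT.orthogonal _ _ (Ne.symm h)]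
      simp
  · intro c _ hc
    rw [← mul_assoc (star (T c)), hT.orthogonal _ _ hc]
    simp
  · simp

/-- Unlike the left traces, the right traces of different minimal solutions are only compared on
self-intertwiners of `Θ`; `hab` makes `T_a T_b^*` one. -/
theorem right_trace [Nontrivial A] [DecidableEq κ] (a b : κ) (hab : σ a = σ b) :
    star P' * (T a * star (T b)) * P' = if a = b then (dim (σ a) : ℂ) • (1 : A) else 0 := by
  have hS := hT.isSphericalPair_sum fun a => (hR a).isSphericalPair (hσ a)
  have hm : T a * star (T b) ∈ Hom Θ Θ :=
    mul_mem_Hom (hT.mem a) (by rw [hab]; exact star_mem_Hom (hT.mem b))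
  have h1 : star (sumSol T σ R') * T a = star (R' a) * σ a (star (T a)) := by
    rw [← star_star (T a), ← star_mul, hT.star_mul_sumSol, star_mul, map_star, star_star]
  rw [hS.right_trace_eq hP.1 hP.2.1 hP.2.2 hS.dim_eq hm, mul_assoc, mul_assoc,
    hT.star_mul_sumSol, ← mul_assoc, h1, ← hab, ← mul_assoc, mul_assoc (star (R' a)), ← map_mul]
  split_ifs with h
  · subst h
    rw [hT.isometry, map_one, mul_one, (hR a).2.2]
  · rw [hT.orthogonal _ _ h]
    simp

end Minimal

end IsOrthDecomp

end Basic

end Sectors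

end

noncomputable section

open scoped ComplexConjugate

namespace Sectors

section Basic

variable {A : Type*} [CStarAlgebra A]

/-! ### Q-systems -/

namespace QSystem

variable (Q : QSystem A)

theorem star_x_mul_θ_w : star Q.x * Q.θ Q.w = 1 := by
  simpa [map_star] using congrArg star Q.unit_right

theorem star_r : star Q.r = star Q.w * star Q.x := by rw [r, star_mul]

/-- The Frobenius relation turns `x^* θ(x)` into `x x^*`, and the unit laws remove both factors. -/
theorem isConjPair_r : IsConjPair Q.θ Q.θ Q.r Q.r := by
  have hz : star Q.r * Q.θ Q.r = 1 := by
    rw [star_r, r, map_mul, mul_assoc, ← mul_assoc (star Q.x), star_x_mul_θ_x, mul_assoc,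
      star_x_mul_θ_w, mul_one, Q.unit_left]
  have hm : Q.r ∈ Hom (idEnd A) (Q.θ.comp Q.θ) := mul_mem_Hom Q.x_mem Q.w_mem
  exact ⟨hm, hm, hz, hz⟩

theorem star_r_mul_r : star Q.r * Q.r = ((Q.d ^ 2 : ℝ) : ℂ) • (1 : A) := by
  rw [star_r, r, mul_assoc, ← mul_assoc (star Q.x), Q.star_x_mul, smul_mul_assoc, one_mul,
    mul_smul_comm, Q.star_w_mul, smul_smul]
  congr 1
  push_cast
  ring

theorem d_pos [Nontrivial A] : 0 < Q.d := by
  refine lt_of_le_of_ne (nonneg_of_star_mul_self Q.star_w_mul) fun h0 => ?_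
  have h1 := Q.star_w_mul
  rw [← h0, Complex.ofReal_zero, zero_smul, CStarRing.star_mul_self_eq_zero_iff] at h1
  have h2 := Q.unit_left
  rw [h1, star_zero, zero_mul] at h2
  exact zero_ne_one h2

variable {Q}

theorem IsStandard.dim_eq [Nontrivial A] (h : Q.IsStandard) : dim Q.θ = Q.d ^ 2 := by
  -- Positivity of `d` excludes the default value `0` of `Real.sqrt` at nonpositive arguments.
  have h1 : 0 < Real.sqrt (dim Q.θ) := h ▸ Q.d_pos
  have h2 : Q.d = Real.sqrt (dim Q.θ) := h
  rw [h2, Real.sq_sqrt (Real.sqrt_pos.1 h1).le]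

/-- As `r^* r = d^2`, the condition `d = √(dim θ)` makes `r` attain the dimension of `θ`. -/
theorem IsStandard.isStandardPair [Nontrivial A] (h : Q.IsStandard) :
    IsStandardPair Q.θ Q.θ Q.r Q.r := by
  refine ⟨Q.isConjPair_r, ?_, ?_⟩ <;> rw [h.dim_eq, star_r_mul_r]

end QSystem

/-! ### Decompositions and their conjugates -/

section Decomposition

variable [Nontrivial A] {ι : Type*} [Fintype ι] {Q : QSystem A} {ρ ρ' : ι → End A} {n : ι → ℕ}
  {W : (i : ι) → Fin (n i) → A} {R R' : ι → A}

/-- The isometries proportional to the `W i k`. -/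
def IsDecomposition.isom (Q : QSystem A) (ρ : ι → End A) (W : (i : ι) → Fin (n i) → A)
    (a : (i : ι) × Fin (n i)) : A :=
  ((Real.sqrt (dim (ρ a.1) / Q.d) : ℝ) : ℂ) • W a.1 a.2

omit [Fintype ι] in
theorem IsDecomposition.isom_mul_star (hpos : ∀ i, 0 < dim (ρ i)) (i : ι) (k l : Fin (n i)) :
    isom Q ρ W ⟨i, k⟩ * star (isom Q ρ W ⟨i, l⟩) =
      ((dim (ρ i) / Q.d : ℝ) : ℂ) • (W i k * star (W i l)) := by
  simp only [isom]
  rw [star_smul, smul_mul_smul_comm, RCLike.star_def, Complex.conj_ofReal, ← Complex.ofReal_mul,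
    Real.mul_self_sqrt (div_nonneg (hpos i).le Q.d_pos.le)]

/-- Orthogonality is assumed only within one sector; between different sectors it is Schur's lemma.
-/
theorem IsDecomposition.isOrthDecomp (hW : IsDecomposition Q ρ n W) (hρ : ∀ i, IsIrred (ρ i))
    (hne : ∀ i j, Equivalent (ρ i) (ρ j) → i = j) (hpos : ∀ i, 0 < dim (ρ i)) :
    IsOrthDecomp Q.θ (fun a : (i : ι) × Fin (n i) => ρ a.1) (isom Q ρ W) where
  mem a := Submodule.smul_mem _ _ (hW.mem a.1 a.2)
  isometry a := by
    have hd := Q.d_pos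
    have hr := hpos a.1
    rw [isom, star_smul, smul_mul_smul_comm, hW.orthonormal, if_pos rfl, smul_smul,
      RCLike.star_def, Complex.conj_ofReal, ← Complex.ofReal_mul, ← Complex.ofReal_mul,
      Real.mul_self_sqrt (div_nonneg hr.le hd.le), div_mul_div_cancel₀ hd.ne', div_self hr.ne',
      Complex.ofReal_one, one_smul]
  orthogonal := by
    rintro ⟨i, k⟩ ⟨j, l⟩ hab
    rw [isom, isom, star_smul, smul_mul_smul_comm]
    by_cases hij : i = j
    · subst hij
      rw [hW.orthonormal, if_neg (by rintro rfl; exact hab rfl), smul_zero]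
    · rw [eq_zero_of_not_equivalent (hρ j) (hρ i) (fun h => hij (hne _ _ h).symm)
        (mul_mem_Hom (star_mem_Hom (hW.mem i k)) (hW.mem j l)), smul_zero]
  complete := by
    rw [Fintype.sum_sigma, ← hW.complete]
    refine Finset.sum_congr rfl fun i _ => Finset.sum_congr rfl fun k _ => ?_
    exact isom_mul_star hpos i k k

section Traces

variable (hQ : Q.IsStandard) (hW : IsDecomposition Q ρ n W) (hρ : ∀ i, IsIrred (ρ i))
  (hne : ∀ i j, Equivalent (ρ i) (ρ j) → i = j)
  (hR : ∀ i, IsStandardPair (ρ i) (ρ' i) (R i) (R' i))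

include hQ hW hρ hne hR

/-- For isometries the trace is `dim (ρ i)`, because `r` is minimal; the normalization `d / dim` of
the charges changes this to `d`. -/
theorem IsDecomposition.right_trace (i : ι) (k l : Fin (n i)) :
    star Q.r * (W i k * star (W i l)) * Q.r = if k = l then (Q.d : ℂ) • (1 : A) else 0 := by
  classical
  have hpos : ∀ i, 0 < dim (ρ i) := fun i => (hR i).dim_pos
  have h := (hW.isOrthDecomp hρ hne hpos).right_trace (fun a => hρ a.1) (fun a => hR a.1)
    hQ.isStandardPair ⟨i, k⟩ ⟨i, l⟩ rfl
  have hc : ((dim (ρ i) / Q.d : ℝ) : ℂ) ≠ 0 :=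
    Complex.ofReal_ne_zero.2 (div_pos (hpos i) Q.d_pos).ne'
  rw [isom_mul_star hpos, mul_smul_comm, smul_mul_assoc] at h
  apply smul_right_injective A hc
  dsimp only
  rw [h]
  by_cases hkl : k = l
  · rw [if_pos hkl, if_pos (by rw [hkl]), smul_smul, ← Complex.ofReal_mul,
      div_mul_cancel₀ _ Q.d_pos.ne']
  · rw [if_neg hkl, if_neg (by simpa using hkl), smul_zero]

theorem IsDecomposition.left_trace (i : ι) (k : Fin (n i)) :
    star Q.r * Q.θ (W i k * star (W i k)) * Q.r = (Q.d : ℂ) • (1 : A) := by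
  classical
  have hpos : ∀ i, 0 < dim (ρ i) := fun i => (hR i).dim_pos
  have h := (hW.isOrthDecomp hρ hne hpos).left_trace (fun a => hρ a.1) (fun a => hR a.1)
    hQ.isStandardPair ⟨i, k⟩ ⟨i, k⟩
  have hc : ((dim (ρ i) / Q.d : ℝ) : ℂ) ≠ 0 :=
    Complex.ofReal_ne_zero.2 (div_pos (hpos i) Q.d_pos).ne'
  rw [isom_mul_star hpos, map_smul, mul_smul_comm, smul_mul_assoc, if_pos rfl] at h
  apply smul_right_injective A hc
  dsimp only
  rw [h, smul_smul, ← Complex.ofReal_mul, div_mul_cancel₀ _ Q.d_pos.ne']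

end Traces

end Decomposition

/-! ### Frobenius conjugates of charge intertwiners -/

section ConjCharge

variable {Q : QSystem A} {ρ ρ' : End A} {R R' W : A}

theorem conjCharge_mem (h : IsConjPair ρ ρ' R R') (hW : W ∈ Hom ρ Q.θ) :
    conjCharge Q ρ' R W ∈ Hom ρ' Q.θ := by
  intro a
  have h1 : star W * Q.r * a = ρ (Q.θ a) * (star W * Q.r) := by
    rw [mul_assoc, Q.isConjPair_r.mul_left, ← mul_assoc, star_mem_Hom hW, mul_assoc]
  rw [conjCharge, mul_assoc, ← map_mul, h1, map_mul, ← mul_assoc, h.star_mul_left, mul_assoc]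

theorem map_conjCharge_mul (h : IsConjPair ρ ρ' R R') :
    ρ (conjCharge Q ρ' R W) * R' = star W * Q.r := by
  rw [conjCharge, map_mul, mul_assoc, ← h.mul_right, ← mul_assoc, h.star_zigzag, one_mul]

variable [Nontrivial A]

/-- The left side is a scalar `z` by irreducibility of `ρ'`. Closing it with `R'` undoes the bending
and yields the trace of `V W^*`, so that `z dim ρ = d`. -/
theorem star_conjCharge_mul (hρ : IsIrred ρ) (h : IsStandardPair ρ ρ' R R') {V : A}
    (hW : W ∈ Hom ρ Q.θ) (hV : V ∈ Hom ρ Q.θ) {d : ℂ}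
    (ht : star Q.r * (V * star W) * Q.r = d • (1 : A)) :
    star (conjCharge Q ρ' R V) * conjCharge Q ρ' R W = (d / (dim ρ : ℂ)) • (1 : A) := by
  have hd : (dim ρ : ℂ) ≠ 0 := Complex.ofReal_ne_zero.2 h.dim_pos.ne'
  obtain ⟨z, hz⟩ := hρ.conj h.1 _
    (mul_mem_Hom (star_mem_Hom (conjCharge_mem h.1 hV)) (conjCharge_mem h.1 hW))
  have h1 : star (ρ (conjCharge Q ρ' R V) * R') * (ρ (conjCharge Q ρ' R W) * R') =
      (z * (dim ρ : ℂ)) • (1 : A) := by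
    rw [star_mul, mul_assoc, ← mul_assoc (star (ρ _)), ← map_star, ← map_mul, hz, map_smul,
      map_one, smul_mul_assoc, one_mul, mul_smul_comm, h.2.2, smul_smul]
  rw [map_conjCharge_mul h.1, map_conjCharge_mul h.1, star_mul, star_star, mul_assoc,
    ← mul_assoc V, ← mul_assoc, ht] at h1
  rw [hz, smul_one_injective h1, mul_div_cancel_right₀ _ hd]

/-- Bending `W` to the other side gives a second conjugate charge `D = θ(R'^* W^*) r`, and the claim
is a bent form of `D = c`. Both have squared norm `d / dim ρ`, one from the right trace, the other
from the left trace, and their inner product has the same value. -/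
theorem map_star_conjCharge_mul_r (hρ : IsIrred ρ) (h : IsStandardPair ρ ρ' R R') {d : ℂ}
    (hW : W ∈ Hom ρ Q.θ) (hn : star W * W = (d / (dim ρ : ℂ)) • (1 : A))
    (hr : star Q.r * (W * star W) * Q.r = d • (1 : A))
    (hl : star Q.r * Q.θ (W * star W) * Q.r = d • (1 : A)) :
    Q.θ (star (conjCharge Q ρ' R W)) * Q.r = W * R' := by
  have hd : (dim ρ : ℂ) ≠ 0 := Complex.ofReal_ne_zero.2 h.dim_pos.ne'
  have hρ' := hρ.conj h.1
  have hQr := Q.isConjPair_r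
  have hc := conjCharge_mem h.1 hW
  have hcc := star_conjCharge_mul hρ h hW hW hr
  have hmap := map_conjCharge_mul (Q := Q) (W := W) h.1
  generalize conjCharge Q ρ' R W = c at *
  have hD : Q.θ (star R' * star W) * Q.r ∈ Hom ρ' Q.θ := by
    intro a
    rw [mul_assoc, hQr.mul_left, ← mul_assoc, ← map_mul, mul_assoc, star_mem_Hom hW, ← mul_assoc,
      h.1.star_mul_right, map_mul, map_mul, map_mul]
    simp only [mul_assoc]
  have hDr : Q.θ (star (Q.θ (star R' * star W) * Q.r)) * Q.r = W * R' := by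
    rw [star_mul, ← map_star, map_mul, mul_assoc, ← hQr.mul_left, ← mul_assoc, map_star,
      ← map_star, hQr.star_zigzag, one_mul, star_mul, star_star, star_star]
  have hDR : Q.θ (star R' * star W) * Q.r * R = Q.θ (star W) * Q.r := by
    rw [mul_assoc, hQr.mul_left, ← mul_assoc, ← map_mul, mul_assoc, star_mem_Hom hW, ← mul_assoc,
      h.1.zigzag, one_mul]
  generalize Q.θ (star R' * star W) * Q.r = D at *
  have hDD : star D * D = (d / (dim ρ : ℂ)) • (1 : A) := by
    obtain ⟨z, hz⟩ := hρ' _ (mul_mem_Hom (star_mem_Hom hD) hD)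
    have h1 : star (D * R) * (D * R) = (z * (dim ρ : ℂ)) • (1 : A) := by
      rw [star_mul, mul_assoc, ← mul_assoc (star D), hz, smul_mul_assoc, one_mul, mul_smul_comm,
        h.2.1, smul_smul]
    rw [hDR, star_mul, ← map_star, star_star, mul_assoc, ← mul_assoc (Q.θ W), ← map_mul,
      ← mul_assoc, hl] at h1
    rw [hz, smul_one_injective h1, mul_div_cancel_right₀ _ hd]
  -- The scalar is found by closing with `R'`: bending `c` and `D` back leaves `R'^* W^* W R'`,
  -- where only the normalization of `W` is needed.
  have hDc : star D * c = (d / (dim ρ : ℂ)) • (1 : A) := by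
    obtain ⟨z, hz⟩ := hρ' _ (mul_mem_Hom (star_mem_Hom hD) hc)
    have h1 : star R' * ρ (star D * c) * R' = (z * (dim ρ : ℂ)) • (1 : A) := by
      rw [hz, map_smul, map_one, mul_smul_comm, mul_one, smul_mul_assoc, h.2.2, smul_smul]
    have h2 : star R' * ρ (star D * c) * R' = (d / (dim ρ : ℂ) * (dim ρ : ℂ)) • (1 : A) := by
      rw [map_mul, mul_assoc, mul_assoc, hmap, ← mul_assoc (ρ _), ← star_mem_Hom hW, mul_assoc,
        hDr, ← mul_assoc (star W), hn, smul_mul_assoc, one_mul, mul_smul_comm, h.2.2, smul_smul]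
    rw [hz, mul_right_cancel₀ hd (smul_one_injective (h1.symm.trans h2))]
  rw [← eq_of_star_sub_mul_sub hDD hcc hDc, hDr]

end ConjCharge

end Basic

end Sectors

end

noncomputable section

open scoped ComplexConjugate

namespace Sectors

section Basic

variable {A : Type*} [CStarAlgebra A]

/-! ### The centre of the extension by a braided product -/

namespace BraidedEnd

variable (C : BraidedEnd A) {ρ σ : End A}

/-- The hexagon for `id id = id` makes this unitary idempotent. -/
theorem ε_id_right (hρ : ρ ∈ C.obj) : C.ε ρ (idEnd A) = 1 := by
  have h1 := C.hexagon_right hρ C.id_mem C.id_mem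
  have h3 := C.star_ε_mul hρ C.id_mem
  change C.ε ρ (idEnd A) = C.ε ρ (idEnd A) * C.ε ρ (idEnd A) at h1
  rw [← h3]; nth_rw 3 [h1]
  rw [← mul_assoc, h3, one_mul]

theorem ε_id_left (hσ : σ ∈ C.obj) : C.ε (idEnd A) σ = 1 := by
  have h1 := C.hexagon_left C.id_mem C.id_mem hσ
  have h3 := C.star_ε_mul C.id_mem hσ
  change C.ε (idEnd A) σ = C.ε (idEnd A) σ * C.ε (idEnd A) σ at h1
  rw [← h3]; nth_rw 3 [h1]
  rw [← mul_assoc, h3, one_mul]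

end BraidedEnd

/-- The two conditions are commutation with `ι(A)` and with `v`, which generate the extension. -/
theorem Ext.mem_center_iff {Q : QSystem A} {b : Ext Q} :
    b ∈ Subalgebra.center ℂ (Ext Q) ↔
      Ext.coeff b ∈ Hom Q.θ (idEnd A) ∧ Q.θ (Ext.coeff b) * Q.x = Ext.coeff b * Q.x := by
  rw [Subalgebra.mem_center_iff]
  constructor
  · intro h
    constructor
    · intro a
      have h1 := congrArg Ext.coeff (h (Ext.incl Q a))
      simp only [Ext.incl, Ext.mul_def, Ext.coeff_mk, map_mul, mul_assoc, Q.unit_right,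
        mul_one] at h1
      rw [← mul_assoc (star Q.w), Q.star_w_mul_θ, mul_assoc, Q.unit_left, mul_one] at h1
      exact h1.symm
    · have h1 := congrArg Ext.coeff (h (Ext.v Q))
      simpa [Ext.v, Ext.mul_def] using h1
  · rintro ⟨h1, h2⟩ c
    apply Ext.ext'
    have h3 : Ext.coeff b * Q.θ (Ext.coeff c) = Ext.coeff c * Ext.coeff b := h1 (Ext.coeff c)
    simp only [Ext.mul_def, Ext.coeff_mk]
    rw [h3, mul_assoc, mul_assoc, h2]

/-- The coefficient of the element of the relative commutant given by `T : θR → θL`. -/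
def bdCoeff (QL : QSystem A) (T : A) : A := star QL.r * QL.θ T

variable {QL QR : QSystem A}

theorem bdCoeff_mem {T : A} (hT : T ∈ Hom QR.θ QL.θ) :
    bdCoeff QL T ∈ Hom (QL.θ.comp QR.θ) (idEnd A) := by
  intro a
  change star QL.r * QL.θ T * QL.θ (QR.θ a) = a * (star QL.r * QL.θ T)
  rw [mul_assoc, ← map_mul, hT, map_mul, ← mul_assoc, QL.isConjPair_r.star_mul_left, mul_assoc]

theorem map_mul_r_mem {a : A} (ha : a ∈ Hom (QL.θ.comp QR.θ) (idEnd A)) :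
    QL.θ a * QL.r ∈ Hom QR.θ QL.θ := by
  intro c
  have ha' : a * QL.θ (QR.θ c) = c * a := ha c
  rw [mul_assoc, QL.isConjPair_r.mul_left, ← mul_assoc, ← map_mul, ha', map_mul, mul_assoc]

/-- Together with `map_bdCoeff_mul_r`, this is Frobenius reciprocity between `Hom(θL θR, id)` and
`Hom(θR, θL)`, from the two zigzag relations of `r`. -/
theorem bdCoeff_map_mul_r (a : A) : bdCoeff QL (QL.θ a * QL.r) = a := by
  rw [bdCoeff, map_mul, ← mul_assoc, QL.isConjPair_r.star_mul_left, mul_assoc,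
    QL.isConjPair_r.zigzag, mul_one]

theorem map_bdCoeff_mul_r (T : A) : QL.θ (bdCoeff QL T) * QL.r = T := by
  rw [bdCoeff, map_mul, mul_assoc, ← QL.isConjPair_r.mul_left, ← mul_assoc,
    QL.isConjPair_r.star_zigzag, one_mul]

theorem bdCoeff_injective {T T' : A} (h : bdCoeff QL T = bdCoeff QL T') : T = T' := by
  rw [← map_bdCoeff_mul_r (QL := QL) T, h, map_bdCoeff_mul_r]

theorem ast_mem {T₁ T₂ : A} (h₁ : T₁ ∈ Hom QR.θ QL.θ) (h₂ : T₂ ∈ Hom QR.θ QL.θ) :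
    ast QL QR T₁ T₂ ∈ Hom QR.θ QL.θ := by
  intro a
  rw [ast, mul_assoc, QR.x_mul_θ, ← mul_assoc, mul_assoc (star QL.x), mul_assoc (QL.θ T₁), h₂,
    ← mul_assoc (QL.θ T₁), ← map_mul, h₁, map_mul, mul_assoc (QL.θ (QL.θ a)), ← mul_assoc,
    QL.star_x_mul_θθ, mul_assoc, mul_assoc]
  simp only [mul_assoc]

/-- Moving `T₁` past `r^*` collects both `T`s to the right of `r^* θ(r^*) x`; bending the legs of
`x` then turns it into the `x^*` of the product `∗`. -/
theorem bdCoeff_ast (T₁ T₂ : A) :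
    bdCoeff QL T₁ * QL.θ (bdCoeff QL T₂) * QL.x * QL.θ QR.x = bdCoeff QL (ast QL QR T₁ T₂) := by
  -- The bent `x` is `x^*`: Frobenius, the unit law and associativity, in this order.
  have h1 : star QL.r * QL.θ (star QL.r) * QL.x = star QL.r * QL.θ (star QL.x) := by
    rw [QL.star_r, map_mul]
    calc star QL.w * star QL.x * (QL.θ (star QL.w) * QL.θ (star QL.x)) * QL.x
        = star QL.w * star QL.x * QL.θ (star QL.w) * (QL.θ (star QL.x) * QL.x) := by
          simp only [mul_assoc]
      _ = star QL.w * star QL.x * (QL.θ (star QL.w) * QL.x) * star QL.x := by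
          rw [← QL.frobenius]; simp only [mul_assoc]
      _ = star QL.w * (star QL.x * star QL.x) := by
          rw [QL.unit_right, mul_one, mul_assoc]
      _ = _ := by rw [QL.star_x_mul_star_x, mul_assoc]
  have h2 : T₁ * star QL.r = star QL.r * QL.θ (QL.θ T₁) :=
    (QL.isConjPair_r.star_mul_left T₁).symm
  simp only [bdCoeff, ast]
  calc star QL.r * QL.θ T₁ * QL.θ (star QL.r * QL.θ T₂) * QL.x * QL.θ QR.x
      = star QL.r * QL.θ (T₁ * star QL.r) * QL.θ (QL.θ T₂) * QL.x * QL.θ QR.x := by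
        simp only [map_mul, mul_assoc]
    _ = star QL.r * QL.θ (star QL.r) * (QL.θ (QL.θ (QL.θ T₁ * T₂)) * QL.x) * QL.θ QR.x := by
        rw [h2]; simp only [map_mul, mul_assoc]
    _ = star QL.r * QL.θ (star QL.r) * QL.x * QL.θ (QL.θ T₁ * T₂) * QL.θ QR.x := by
        rw [← QL.x_mul_θ]; simp only [mul_assoc]
    _ = _ := by rw [h1]; simp only [map_mul, mul_assoc]

/-! ### Multiplication, adjoint and boundary operators in the braided product -/

section BraidedProduct

variable (C : BraidedEnd A) (QL QR : QSystem A) (hL : QL.θ ∈ C.obj) (hR : QR.θ ∈ C.obj)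


variable {QL QR}

include hL hR

/-- Naturality of `ε(θR, ·)` along `a : θL θR → id` and the hexagon give `θR(a) = a θL(ε_RR) ε_RL`.
The factor `ε_RL` cancels `ε⁻`, and `ε_RR` disappears into `xR`. -/
theorem map_mul_braidedProd_x (hcR : QR.IsCommutative C) {a : A}
    (ha : a ∈ Hom (QL.θ.comp QR.θ) (idEnd A)) :
    QL.θ (QR.θ a) * (QSystem.braidedProd C QL QR hL hR).x = QL.θ a * QL.x * QL.θ QR.x := by
  have h1 := C.natural_right hR (C.comp_mem hL hR) C.id_mem a ha
  rw [C.ε_id_right hR, one_mul, C.hexagon_right hR hL hR] at h1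
  have h2 : C.ε QR.θ QL.θ * QSystem.εMinus C QL QR = 1 := C.ε_mul_star hR hL
  have hc : C.ε QR.θ QR.θ * QR.x = QR.x := hcR
  change QL.θ (QR.θ a) * (QL.θ (QSystem.εMinus C QL QR) * QL.x * QL.θ QR.x) = _
  rw [h1]
  calc QL.θ (a * (QL.θ (C.ε QR.θ QR.θ) * C.ε QR.θ QL.θ)) * (QL.θ (QSystem.εMinus C QL QR) * QL.x * QL.θ QR.x)
      = QL.θ a * QL.θ (QL.θ (C.ε QR.θ QR.θ)) * QL.θ (C.ε QR.θ QL.θ * QSystem.εMinus C QL QR) * QL.x * QL.θ QR.x := by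
        simp only [map_mul, mul_assoc]
    _ = QL.θ a * (QL.θ (QL.θ (C.ε QR.θ QR.θ)) * QL.x) * QL.θ QR.x := by
        rw [h2, map_one, mul_one]; simp only [mul_assoc]
    _ = QL.θ a * QL.x * QL.θ (C.ε QR.θ QR.θ * QR.x) := by
        rw [← QL.x_mul_θ, map_mul]; simp only [mul_assoc]
    _ = _ := by rw [hc]

/-- The mirror image, with `a = θL(a) ε_LL θL(ε_RL)` and commutativity of the left Q-system. -/
theorem mul_braidedProd_x (hcL : QL.IsCommutative C) {a : A}
    (ha : a ∈ Hom (QL.θ.comp QR.θ) (idEnd A)) :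
    a * (QSystem.braidedProd C QL QR hL hR).x = QL.θ a * QL.x * QL.θ QR.x := by
  have h1 := C.natural_left (C.comp_mem hL hR) C.id_mem hL a ha
  rw [C.ε_id_left hL, one_mul, C.hexagon_left hL hR hL] at h1
  have h2 : C.ε QR.θ QL.θ * QSystem.εMinus C QL QR = 1 := C.ε_mul_star hR hL
  have hc : C.ε QL.θ QL.θ * QL.x = QL.x := hcL
  change a * (QL.θ (QSystem.εMinus C QL QR) * QL.x * QL.θ QR.x) = _
  calc a * (QL.θ (QSystem.εMinus C QL QR) * QL.x * QL.θ QR.x)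
      = QL.θ a * (C.ε QL.θ QL.θ * QL.θ (C.ε QR.θ QL.θ)) * (QL.θ (QSystem.εMinus C QL QR) * QL.x * QL.θ QR.x) := by
        rw [← h1]
    _ = QL.θ a * C.ε QL.θ QL.θ * QL.θ (C.ε QR.θ QL.θ * QSystem.εMinus C QL QR) * QL.x * QL.θ QR.x := by
        simp only [map_mul, mul_assoc]
    _ = QL.θ a * (C.ε QL.θ QL.θ * QL.x) * QL.θ QR.x := by
        rw [h2, map_one, mul_one]; simp only [mul_assoc]
    _ = _ := by rw [hc]

/-- The centre of the extension is its relative commutant. -/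
theorem mem_center_prodExt_iff (hcL : QL.IsCommutative C) (hcR : QR.IsCommutative C)
    {b : ProdExt C QL QR hL hR} :
    b ∈ Subalgebra.center ℂ (ProdExt C QL QR hL hR) ↔
      Ext.coeff b ∈ Hom (QL.θ.comp QR.θ) (idEnd A) := by
  rw [Ext.mem_center_iff]
  refine ⟨fun h => h.1, fun h => ⟨h, ?_⟩⟩
  rw [mul_braidedProd_x C hL hR hcL h]
  exact map_mul_braidedProd_x C hL hR hcR h

theorem bdCoeff_mul (hcR : QR.IsCommutative C) {T₁ T₂ : A} (h₂ : T₂ ∈ Hom QR.θ QL.θ) :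
    (Ext.mk _ (bdCoeff QL T₁) * Ext.mk _ (bdCoeff QL T₂) : ProdExt C QL QR hL hR) =
      Ext.mk _ (bdCoeff QL (ast QL QR T₁ T₂)) := by
  apply Ext.ext'
  rw [Ext.mul_def, Ext.coeff_mk, Ext.coeff_mk, Ext.coeff_mk, Ext.coeff_mk, ← bdCoeff_ast]
  change bdCoeff QL T₁ * QL.θ (QR.θ (bdCoeff QL T₂)) * _ = _
  rw [mul_assoc, map_mul_braidedProd_x C hL hR hcR (bdCoeff_mem h₂)]
  simp only [mul_assoc]

/-- The image of `T₁` in the extension is central, and `T ↦ rL^* θL(T)` is injective. -/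
theorem ast_comm (hcL : QL.IsCommutative C) (hcR : QR.IsCommutative C) {T₁ T₂ : A}
    (h₁ : T₁ ∈ Hom QR.θ QL.θ) (h₂ : T₂ ∈ Hom QR.θ QL.θ) :
    ast QL QR T₁ T₂ = ast QL QR T₂ T₁ := by
  have hc := (mem_center_prodExt_iff C hL hR hcL hcR
    (b := Ext.mk (QSystem.braidedProd C QL QR hL hR) (bdCoeff QL T₁))).2
    (bdCoeff_mem h₁)
  rw [Subalgebra.mem_center_iff] at hc
  have h := hc (Ext.mk (QSystem.braidedProd C QL QR hL hR) (bdCoeff QL T₂))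
  rw [bdCoeff_mul C hL hR hcR h₂, bdCoeff_mul C hL hR hcR h₁] at h
  exact (bdCoeff_injective (QL := QL) (congrArg Ext.coeff h)).symm

/-- `X W = θL(ε⁻) rL rR` for the braided product. -/
theorem braidedProd_r : (QSystem.braidedProd C QL QR hL hR).r = QL.θ (QSystem.εMinus C QL QR) * QL.r * QR.r := by
  change QL.θ (QSystem.εMinus C QL QR) * QL.x * QL.θ QR.x * (QL.θ QR.w * QL.w) = _
  calc QL.θ (QSystem.εMinus C QL QR) * QL.x * QL.θ QR.x * (QL.θ QR.w * QL.w)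
      = QL.θ (QSystem.εMinus C QL QR) * QL.x * (QL.θ (QR.x * QR.w) * QL.w) := by simp only [map_mul, mul_assoc]
    _ = _ := by rw [← QL.w_mul]; simp only [QSystem.r, mul_assoc]

theorem star_braidedProd_r : star (QSystem.braidedProd C QL QR hL hR).w *
    star (QSystem.braidedProd C QL QR hL hR).x = star QR.r * star QL.r * QL.θ (star (QSystem.εMinus C QL QR)) := by
  rw [← star_mul]
  change star (QSystem.braidedProd C QL QR hL hR).r = _
  rw [braidedProd_r]
  simp only [star_mul, map_star, mul_assoc]

theorem star_εMinus_mul_map_map (a : A) : star (QSystem.εMinus C QL QR) * QR.θ (QL.θ a) = QL.θ (QR.θ a) * star (QSystem.εMinus C QL QR) := by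
  have := congrArg star (QSystem.εMinus_mul_θθ C hL hR (star a))
  simpa [map_star] using this.symm

/-- The braiding is trivial against the units. This removes the `ε⁻` of the multiplication and the
adjoint `ε⁻` of the star, and the unit laws then reduce `rR^*` to `wR^*` and cancel `xL`. -/
theorem boundaryOp_eq (WL WR : A) :
    boundaryOp C QL QR hL hR WL WR = Ext.mk _ (bdCoeff QL (WL * star WR)) := by
  have hw := QSystem.θ_star_w_mul_εMinus C hL hR
  have hw' : QL.θ QR.w = star (QSystem.εMinus C QL QR) * QR.w := by
    have := congrArg star (QSystem.star_w_mul_εMinus C hL hR)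
    simpa [map_star] using this.symm
  have hee := QSystem.star_εMinus_mul C hL hR
  have hee' := QSystem.εMinus_mul_star C hL hR
  have hs := star_braidedProd_r C hL hR
  have hn := star_εMinus_mul_map_map C hL hR
  rw [boundaryOp, fieldL, fieldR, V, Ext.incl_mul_v, Ext.incl_mul_v]
  apply Ext.ext'
  rw [Ext.mul_def, Ext.star_def, Ext.coeff_mk, Ext.coeff_mk, Ext.coeff_mk, Ext.coeff_mk,
    Ext.coeff_mk]
  have hx : (QSystem.braidedProd C QL QR hL hR).x =
    QL.θ (QSystem.εMinus C QL QR) * QL.x * QL.θ QR.x := rfl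
  rw [hs, hx]
  change star QR.r * star QL.r * QL.θ (star (QSystem.εMinus C QL QR)) *
    QL.θ (QR.θ (star (star WL * QL.θ (star QR.w)))) * QL.θ (QR.θ (star WR * star QL.w)) *
    (QL.θ (QSystem.εMinus C QL QR) * QL.x * QL.θ QR.x) = _
  rw [bdCoeff]
  -- The right-hand side is inflated by the unit law of the right Q-system, to match the `xR` that
  -- remains on the left.
  have hT : star QR.w * (QR.θ (WL * star WR) * QR.x) = WL * star WR := by
    rw [← mul_assoc, QR.star_w_mul_θ, mul_assoc, QR.unit_left, mul_one]
  have hcomm : QR.θ (WL * star WR) * star QL.w = star QL.w * QL.θ (QR.θ (WL * star WR)) :=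
    (QL.star_w_mul_θ _).symm
  have hr : star QR.r * (star QL.r * QL.θ (QL.θ (QR.θ QR.w))) = star QL.r * QL.θ (QL.θ (star QR.w)) := by
    rw [QL.isConjPair_r.star_mul_left, QL.isConjPair_r.star_mul_left, ← mul_assoc, QR.star_r,
      mul_assoc (star QR.w), QR.star_x_mul_θ_w, mul_one]
  have hmid : QL.θ (star QR.w) * star (QSystem.εMinus C QL QR) = star QR.w := by
    rw [← QSystem.star_w_mul_εMinus C hL hR, mul_assoc, hee', mul_one]
  rw [← hT]
  generalize QSystem.εMinus C QL QR = f at *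
  generalize hTT : WL * star WR = T at *
  calc star QR.r * star QL.r * QL.θ (star f) *
        QL.θ (QR.θ (star (star WL * QL.θ (star QR.w)))) * QL.θ (QR.θ (star WR * star QL.w)) *
        (QL.θ f * QL.x * QL.θ QR.x)
      = star QR.r * star QL.r * QL.θ (star f * QR.θ (QL.θ QR.w) * QR.θ (WL * star WR) *
          (QR.θ (star QL.w) * f)) * QL.x * QL.θ QR.x := by
        simp only [star_mul, map_mul, mul_assoc, map_star, star_star]
    _ = star QR.r * star QL.r * QL.θ (QL.θ (QR.θ QR.w) * star f * (QR.θ T * star QL.w)) *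
          QL.x * QL.θ QR.x := by
        rw [hw, hn, hTT]; simp only [mul_assoc]
    _ = star QR.r * (star QL.r * QL.θ (QL.θ (QR.θ QR.w))) * QL.θ (star f) * QL.θ (star QL.w) *
          (QL.θ (QL.θ (QR.θ T)) * QL.x) * QL.θ QR.x := by
        rw [hcomm]; simp only [map_mul, mul_assoc]
    _ = star QL.r * QL.θ (QL.θ (star QR.w) * star f) * (QL.θ (star QL.w) * QL.x) *
          QL.θ (QR.θ T) * QL.θ QR.x := by
        rw [← QL.x_mul_θ, hr]; simp only [map_mul, mul_assoc]
    _ = _ := by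
        rw [hmid, QL.unit_right, mul_one]; simp only [map_mul, mul_assoc]

/-- The braiding slides through `rL`, a zigzag removes `rL`, and naturality along `T` leaves one
`ε(θR,θR)^*`, which `rR^*` absorbs by commutativity. -/
theorem star_mk_bdCoeff (hcR : QR.IsCommutative C) {T : A} (hT : T ∈ Hom QR.θ QL.θ) :
    star (Ext.mk _ (bdCoeff QL T) : ProdExt C QL QR hL hR) =
      Ext.mk _ (star QR.r * star T) := by
  have hee' := QSystem.εMinus_mul_star C hL hR
  have hs := star_braidedProd_r C hL hR
  have hn := star_εMinus_mul_map_map C hL hR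
  have hp := QSystem.θ_x_mul_εMinus C hL hR
  have hw : star (QSystem.εMinus C QL QR) * QR.θ QL.w = QL.w := by
    have := congrArg star (QSystem.θ_star_w_mul_εMinus C hL hR)
    simpa [map_star] using this
  have hee := QSystem.star_εMinus_mul C hL hR
  have hc : star QR.r * star (C.ε QR.θ QR.θ) = star QR.r := by
    have h : C.ε QR.θ QR.θ * QR.x = QR.x := hcR
    rw [← star_mul, QSystem.r, ← mul_assoc, h]
  have hnat : QR.θ (star T) * QSystem.εMinus C QL QR = star (C.ε QR.θ QR.θ) * star T := by
    have := congrArg star (C.natural_right hR hR hL T hT)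
    simpa [map_star, QSystem.εMinus] using this
  apply Ext.ext'
  rw [Ext.star_def, Ext.coeff_mk, Ext.coeff_mk, Ext.coeff_mk, hs]
  change star QR.r * star QL.r * QL.θ (star (QSystem.εMinus C QL QR)) *
    QL.θ (QR.θ (star (bdCoeff QL T))) = _
  generalize QSystem.εMinus C QL QR = f at *
  have hfr : star f * QR.θ QL.r = QL.θ f * QL.r := by
    calc star f * QR.θ (QL.x * QL.w)
        = star f * (QR.θ QL.x * f) * (star f * QR.θ QL.w) := by
          rw [map_mul, mul_assoc (star f), ← mul_assoc (QR.θ QL.x * f), mul_assoc (QR.θ QL.x) f,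
            hee', mul_one]
      _ = (star f * f) * QL.θ f * QL.x * QL.w := by rw [hp, hw]; simp only [mul_assoc]
      _ = _ := by rw [hee, one_mul, QSystem.r, mul_assoc]
  calc star QR.r * star QL.r * QL.θ (star f) * QL.θ (QR.θ (star (bdCoeff QL T)))
      = star QR.r * star QL.r * QL.θ ((star f * QR.θ (QL.θ (star T))) * QR.θ QL.r) := by
        rw [bdCoeff]; simp only [star_mul, map_mul, mul_assoc, map_star, star_star]
    _ = star QR.r * (star QL.r * QL.θ (QL.θ (QR.θ (star T)))) * QL.θ (star f * QR.θ QL.r) := by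
        rw [hn]; simp only [map_mul, mul_assoc]
    _ = star QR.r * QR.θ (star T) * (star QL.r * QL.θ (QL.θ f)) * QL.θ QL.r := by
        rw [hfr, QL.isConjPair_r.star_mul_left]; simp only [map_mul, mul_assoc]
    _ = star QR.r * (QR.θ (star T) * f) * (star QL.r * QL.θ QL.r) := by
        rw [QL.isConjPair_r.star_mul_left]; simp only [mul_assoc]
    _ = _ := by rw [QL.isConjPair_r.zigzag, mul_one, hnat, ← mul_assoc, hc]

/-- The adjoint of a boundary operator is formed with the conjugate charge intertwiners. -/
theorem star_boundaryOp (hcR : QR.IsCommutative C) {WL WR : A} {ρ ρ' : End A} {R R' : A}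
    (h : IsConjPair ρ ρ' R R') (hWL : WL ∈ Hom ρ QL.θ) (hWR : WR ∈ Hom ρ QR.θ)
    (hr : QL.θ (star (conjCharge QL ρ' R WL)) * QL.r = WL * R') :
    star (boundaryOp C QL QR hL hR WL WR) =
      boundaryOp C QL QR hL hR (conjCharge QL ρ' R WL) (conjCharge QR ρ' R WR) := by
  rw [boundaryOp_eq, boundaryOp_eq,
    star_mk_bdCoeff C hL hR hcR (mul_mem_Hom hWL (star_mem_Hom hWR))]
  have h1 := map_conjCharge_mul (Q := QR) (W := WR) h
  have h2 : star QL.r * QL.θ (conjCharge QL ρ' R WL) = star R' * star WL := by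
    have := congrArg star hr
    simpa [map_star] using this
  generalize conjCharge QL ρ' R WL = c at *
  generalize conjCharge QR ρ' R WR = c' at *
  congr 1
  rw [bdCoeff, map_mul, ← mul_assoc, h2, mul_assoc, star_mem_Hom hWL, ← mul_assoc]
  have h3 : star R' * ρ (star c') = star QR.r * WR := by
    have := congrArg star h1
    simpa [map_star] using this
  rw [h3]
  simp only [star_mul, star_star, mul_assoc]

end BraidedProduct

end Basic

end Sectors

end

noncomputable section

open scoped ComplexConjugate

namespace Sectors

section Basic

variable {A : Type*} [CStarAlgebra A]

/-! ### The basis of the centre and its structure constants -/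

section Basis

variable {C : BraidedEnd A} {QL QR : QSystem A} {ι : Type*}
  {ρ : ι → End A} {nL nR : ι → ℕ} {WL : (i : ι) → Fin (nL i) → A}
  {WR : (i : ι) → Fin (nR i) → A}

/-- The basis `WL WR^*` of `Hom(θR, θL)`. -/
def homBasis (WL : (i : ι) → Fin (nL i) → A) (WR : (i : ι) → Fin (nR i) → A)
    (a : (i : ι) × (Fin (nL i) × Fin (nR i))) : A := WL a.1 a.2.1 * star (WR a.1 a.2.2)

theorem homBasis_mem [Fintype ι] (hWL : IsDecomposition QL ρ nL WL) (hWR : IsDecomposition QR ρ nR WR)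
    (a : (i : ι) × (Fin (nL i) × Fin (nR i))) : homBasis WL WR a ∈ Hom QR.θ QL.θ :=
  mul_mem_Hom (hWL.mem _ _) (star_mem_Hom (hWR.mem _ _))

/-- The linear map from `Hom(θR, θL)` to the relative commutant. -/
def bdMap (C : BraidedEnd A) (hL : QL.θ ∈ C.obj) (hR : QR.θ ∈ C.obj) :
    A →ₗ[ℂ] ProdExt C QL QR hL hR where
  toFun T := Ext.mk _ (bdCoeff QL T)
  map_add' T T' := by apply Ext.ext'; simp [bdCoeff, mul_add]
  map_smul' z T := by apply Ext.ext'; simp [bdCoeff]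

theorem boundaryOp_eq_bdMap (hL : QL.θ ∈ C.obj) (hR : QR.θ ∈ C.obj)
    (a : (i : ι) × (Fin (nL i) × Fin (nR i))) :
    boundaryOp C QL QR hL hR (WL a.1 a.2.1) (WR a.1 a.2.2) = bdMap C hL hR (homBasis WL WR a) :=
  boundaryOp_eq C hL hR _ _

variable [Nontrivial A] [Fintype ι] (hρ : ∀ i, IsIrred (ρ i)) (hne : ∀ i j, Equivalent (ρ i) (ρ j) → i = j)
  (hpos : ∀ i, 0 < dim (ρ i)) (hWL : IsDecomposition QL ρ nL WL)
  (hWR : IsDecomposition QR ρ nR WR)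

include hρ hne hWL hWR

/-- The completeness relations are inserted on both sides of `T`; Schur's lemma removes the terms
with different sectors. -/
theorem hom_expand {T : A} (hT : T ∈ Hom QR.θ QL.θ) :
    T = ∑ c : (i : ι) × (Fin (nL i) × Fin (nR i)),
      ((dim (ρ c.1) ^ 2 / (QL.d * QR.d) : ℝ) : ℂ) •
        (WL c.1 c.2.1 * (star (WL c.1 c.2.1) * T * WR c.1 c.2.2) * star (WR c.1 c.2.2)) := by
  have h1 : T = (∑ i, ∑ k, ((dim (ρ i) / QL.d : ℝ) : ℂ) • (WL i k * star (WL i k))) * T *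
      ∑ i, ∑ k, ((dim (ρ i) / QR.d : ℝ) : ℂ) • (WR i k * star (WR i k)) := by
    rw [hWL.complete, hWR.complete, one_mul, mul_one]
  refine h1.trans ?_
  rw [Fintype.sum_sigma, Finset.sum_mul, Finset.sum_mul]
  refine Finset.sum_congr rfl fun i _ => ?_
  rw [Fintype.sum_prod_type, Finset.sum_mul, Finset.sum_mul]
  refine Finset.sum_congr rfl fun k _ => ?_
  rw [Finset.mul_sum, Finset.sum_eq_single i]
  · rw [Finset.mul_sum]
    refine Finset.sum_congr rfl fun l _ => ?_
    simp only [smul_mul_assoc, mul_smul_comm, smul_smul, mul_assoc, ← Complex.ofReal_mul]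
    congr 2
    rw [div_mul_div_comm, mul_comm QR.d, sq]
  · intro j _ hj
    rw [Finset.mul_sum]
    refine Finset.sum_eq_zero fun l _ => ?_
    have h0 : star (WL i k) * T * WR j l = 0 :=
      eq_zero_of_not_equivalent (hρ j) (hρ i) (fun h => hj (hne _ _ h))
        (mul_mem_Hom (mul_mem_Hom (star_mem_Hom (hWL.mem i k)) hT) (hWR.mem j l))
    have h1 : WL i k * star (WL i k) * T * (WR j l * star (WR j l)) = 0 := by
      calc _ = WL i k * (star (WL i k) * T * WR j l) * star (WR j l) := by simp only [mul_assoc]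
        _ = 0 := by rw [h0, mul_zero, zero_mul]
    simp only [smul_mul_assoc, mul_smul_comm, h1, smul_zero]
  · simp

theorem star_mul_homBasis_mul [DecidableEq ((i : ι) × (Fin (nL i) × Fin (nR i)))]
    (a b : (i : ι) × (Fin (nL i) × Fin (nR i))) :
    star (WL a.1 a.2.1) * homBasis WL WR b * WR a.1 a.2.2 =
      if a = b then ((QL.d * QR.d / dim (ρ a.1) ^ 2 : ℝ) : ℂ) • (1 : A) else 0 := by
  obtain ⟨i, k, l⟩ := a
  obtain ⟨j, m, n⟩ := b
  dsimp only [homBasis]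
  rw [show star (WL i k) * (WL j m * star (WR j n)) * WR i l =
    (star (WL i k) * WL j m) * (star (WR j n) * WR i l) by simp only [mul_assoc]]
  by_cases hij : i = j
  · subst hij
    rw [hWL.orthonormal, hWR.orthonormal]
    by_cases hkm : k = m
    · by_cases hnl : n = l
      · subst hkm hnl
        rw [if_pos rfl, if_pos rfl, if_pos rfl, smul_mul_smul_comm, mul_one, ← Complex.ofReal_mul,
          div_mul_div_comm, sq]
      · rw [if_neg hnl, mul_zero, if_neg]
        rintro h
        simp only [Sigma.mk.injEq, heq_eq_eq, Prod.mk.injEq, true_and] at h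
        exact hnl h.2.symm
    · rw [if_neg hkm, zero_mul, if_neg]
      rintro h
      simp only [Sigma.mk.injEq, heq_eq_eq, Prod.mk.injEq, true_and] at h
      exact hkm h.1
  · rw [eq_zero_of_not_equivalent (hρ j) (hρ i) (fun h => hij (hne _ _ h).symm)
      (mul_mem_Hom (star_mem_Hom (hWL.mem i k)) (hWL.mem j m)), zero_mul, if_neg]
    rintro h
    exact hij (congrArg Sigma.fst h)

include hpos

theorem linearIndependent_homBasis : LinearIndependent ℂ (homBasis WL WR) := by
  classical
  rw [Fintype.linearIndependent_iff]
  intro g hg c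
  have h1 : star (WL c.1 c.2.1) * (∑ b, g b • homBasis WL WR b) * WR c.1 c.2.2 = 0 := by
    rw [hg, mul_zero, zero_mul]
  simp only [Finset.mul_sum, Finset.sum_mul, mul_smul_comm, smul_mul_assoc,
    star_mul_homBasis_mul hρ hne hWL hWR] at h1
  rw [Finset.sum_eq_single c (fun b _ hb => by rw [if_neg hb.symm, smul_zero]) (by simp),
    if_pos rfl, smul_smul] at h1
  have h2 := smul_one_injective (h1.trans (zero_smul ℂ (1 : A)).symm)
  have h3 : ((QL.d * QR.d / dim (ρ c.1) ^ 2 : ℝ) : ℂ) ≠ 0 :=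
    Complex.ofReal_ne_zero.2
      (div_pos (mul_pos QL.d_pos QR.d_pos) (pow_pos (hpos c.1) 2)).ne'
  exact (mul_eq_zero.1 h2).resolve_right h3

theorem linearIndependent_boundaryOp (hL : QL.θ ∈ C.obj) (hR : QR.θ ∈ C.obj) :
    LinearIndependent ℂ fun a : (i : ι) × (Fin (nL i) × Fin (nR i)) =>
      boundaryOp C QL QR hL hR (WL a.1 a.2.1) (WR a.1 a.2.2) := by
  have h := (linearIndependent_homBasis hρ hne hpos hWL hWR).map' (bdMap C hL hR)
    (LinearMap.ker_eq_bot.2 fun T T' h => bdCoeff_injective (QL := QL) (congrArg Ext.coeff h))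
  simp only [boundaryOp_eq_bdMap]
  exact h

omit hpos

theorem hom_expand_smul {T : A} (hT : T ∈ Hom QR.θ QL.θ) :
    ∃ z : (i : ι) × (Fin (nL i) × Fin (nR i)) → ℂ,
      (∀ c, ((dim (ρ c.1) ^ 2 / (QL.d * QR.d) : ℝ) : ℂ) •
        (star (WL c.1 c.2.1) * T * WR c.1 c.2.2) = z c • (1 : A)) ∧
      T = ∑ c, z c • homBasis WL WR c := by
  have h : ∀ c : (i : ι) × (Fin (nL i) × Fin (nR i)),
      ∃ z : ℂ, ((dim (ρ c.1) ^ 2 / (QL.d * QR.d) : ℝ) : ℂ) •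
        (star (WL c.1 c.2.1) * T * WR c.1 c.2.2) = z • (1 : A) := fun c =>
    hρ c.1 _ (Submodule.smul_mem _ _
      (mul_mem_Hom (mul_mem_Hom (star_mem_Hom (hWL.mem _ _)) hT) (hWR.mem _ _)))
  choose z hz using h
  refine ⟨z, hz, ?_⟩
  conv_lhs => rw [hom_expand hρ hne hWL hWR hT]
  refine Finset.sum_congr rfl fun c _ => ?_
  rw [← smul_mul_assoc, ← mul_smul_comm, hz, mul_smul_comm, mul_one, smul_mul_assoc, homBasis]

/-- A central element is pulled back to `Hom(θR, θL)` by Frobenius reciprocity and expanded there in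
the products `WL WR^*`. -/
theorem span_boundaryOp (hL : QL.θ ∈ C.obj) (hR : QR.θ ∈ C.obj) (hcL : QL.IsCommutative C)
    (hcR : QR.IsCommutative C) :
    Submodule.span ℂ (Set.range fun a : (i : ι) × (Fin (nL i) × Fin (nR i)) =>
      boundaryOp C QL QR hL hR (WL a.1 a.2.1) (WR a.1 a.2.2)) =
    Subalgebra.toSubmodule (Subalgebra.center ℂ (ProdExt C QL QR hL hR)) := by
  simp only [boundaryOp_eq_bdMap]
  apply le_antisymm
  · rw [Submodule.span_le]
    rintro _ ⟨a, rfl⟩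
    exact (mem_center_prodExt_iff C hL hR hcL hcR).2 (bdCoeff_mem (homBasis_mem hWL hWR a))
  · intro b hb
    have hb' := (mem_center_prodExt_iff C hL hR hcL hcR).1 hb
    obtain ⟨z, -, hz⟩ := hom_expand_smul hρ hne hWL hWR (map_mul_r_mem hb')
    have h1 : b = bdMap C hL hR (QL.θ (Ext.coeff b) * QL.r) :=
      (bdCoeff_map_mul_r (QL := QL) (Ext.coeff b)).symm
    rw [h1, hz, map_sum]
    refine Submodule.sum_mem _ fun c _ => ?_
    rw [map_smul]
    exact Submodule.smul_mem _ _ (Submodule.subset_span ⟨c, rfl⟩)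

omit hne hWR in
-- The fusion element factors through the `K` below, an intertwiner into the irreducible `ρ c`. A
-- nonzero adjoint of `K` is proportional to an isometry.
theorem contained_of_fusionElement_ne_zero (hobj : ∀ i, ρ i ∈ C.obj)
    (a b c : (i : ι) × (Fin (nL i) × Fin (nR i)))
    (h : fusionElement QL QR (ρ c.1) (WL c.1 c.2.1) (WR c.1 c.2.2) (homBasis WL WR a)
      (homBasis WL WR b) ≠ 0) : Contained (ρ c.1) ((ρ a.1).comp (ρ b.1)) := by
  set K := star (WL c.1 c.2.1) * star QL.x * QL.θ (WL a.1 a.2.1) * WL b.1 b.2.1 with hK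
  have hKm : K ∈ Hom ((ρ b.1).comp (ρ a.1)) (ρ c.1) := by
    have h1 : QL.θ (WL a.1 a.2.1) * WL b.1 b.2.1 ∈
        Hom ((ρ b.1).comp (ρ a.1)) (QL.θ.comp QL.θ) := by
      have h2 := mul_mem_Hom (comp_mem_Hom QL.θ (hWL.mem b.1 b.2.1))
        (map_mem_Hom (ρ b.1) (hWL.mem a.1 a.2.1))
      rwa [← hWL.mem b.1 b.2.1]
    have h3 := mul_mem_Hom (star_mem_Hom (hWL.mem c.1 c.2.1))
      (mul_mem_Hom (star_mem_Hom QL.x_mem) h1)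
    rw [hK]
    simpa only [mul_assoc] using h3
  -- The source of `K` is the product in the opposite order, since `∗` applies `θL` to its first
  -- factor; the braiding exchanges the two.
  have hKs : C.ε (ρ b.1) (ρ a.1) * star K ∈ Hom (ρ c.1) ((ρ a.1).comp (ρ b.1)) :=
    mul_mem_Hom (C.ε_mem (hobj _) (hobj _)) (star_mem_Hom hKm)
  refine contained_of_ne_zero (hρ c.1) hKs fun h0 => h ?_
  have hK0 : K = 0 := by
    have h1 : star K = 0 := by
      rw [← one_mul (star K), ← C.star_ε_mul (hobj b.1) (hobj a.1), mul_assoc, h0, mul_zero]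
    rwa [star_eq_zero] at h1
  have h2 : star (WL c.1 c.2.1) * ast QL QR (homBasis WL WR a) (homBasis WL WR b) *
      WR c.1 c.2.2 = K * ρ b.1 (star (WR a.1 a.2.2)) * star (WR b.1 b.2.2) * QR.x *
        WR c.1 c.2.2 := by
    have h3 := hWL.mem b.1 b.2.1 (star (WR a.1 a.2.2))
    rw [hK, mul_assoc _ (WL b.1 b.2.1), h3, ast, homBasis, homBasis, map_mul]
    simp only [mul_assoc]
  rw [fusionElement, h2, hK0]
  simp

theorem boundaryOp_mul (hL : QL.θ ∈ C.obj) (hR : QR.θ ∈ C.obj) (hcL : QL.IsCommutative C)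
    (hcR : QR.IsCommutative C) :
    ∃ f : (i : ι) × (Fin (nL i) × Fin (nR i)) → (i : ι) × (Fin (nL i) × Fin (nR i)) →
        (i : ι) × (Fin (nL i) × Fin (nR i)) → ℂ,
      (∀ a b c, fusionElement QL QR (ρ c.1) (WL c.1 c.2.1) (WR c.1 c.2.2) (homBasis WL WR a)
        (homBasis WL WR b) = f a b c • (1 : A)) ∧ (∀ a b c, f a b c = f b a c) ∧
      ∀ a b, boundaryOp C QL QR hL hR (WL a.1 a.2.1) (WR a.1 a.2.2) *
        boundaryOp C QL QR hL hR (WL b.1 b.2.1) (WR b.1 b.2.2) =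
          ∑ c, f a b c • boundaryOp C QL QR hL hR (WL c.1 c.2.1) (WR c.1 c.2.2) := by
  have hm := homBasis_mem hWL hWR
  choose f hf hf' using fun a b => hom_expand_smul hρ hne hWL hWR (ast_mem (hm a) (hm b))
  refine ⟨f, hf, fun a b c => ?_, fun a b => ?_⟩
  · apply smul_one_injective (A := A)
    rw [← hf, ← hf, ast_comm C hL hR hcL hcR (hm a) (hm b)]
  · simp only [boundaryOp_eq_bdMap, ← map_smul, ← map_sum, ← hf' a b]
    exact bdCoeff_mul C hL hR hcR (hm b)

end Basis

end Basic

end Sectors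

end

/-! ### The centre: assembly of the general statement -/

noncomputable section

namespace Sectors

open Classical in
/-- The centre of the braided product of two commutative Q-systems. -/
theorem center_of_braided_product (A : Type*) [CStarAlgebra A] [Nontrivial A]
      (C : BraidedEnd A) (QL QR : QSystem A)
      (hL : QL.θ ∈ C.obj) (hR : QR.θ ∈ C.obj)
      (hsL : QL.IsStandard) (hsR : QR.IsStandard) (hcL : QL.IsCommutative C)
      (hcR : QR.IsCommutative C) (ι : Type*) [Fintype ι] (ρ : ι → End A)
      (hobj : ∀ i, ρ i ∈ C.obj) (hρ : ∀ i, IsIrred (ρ i))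
      (hne : ∀ i j, Equivalent (ρ i) (ρ j) → i = j)
      (nL nR : ι → ℕ) (WL : (i : ι) → Fin (nL i) → A) (WR : (i : ι) → Fin (nR i) → A)
      (hWL : IsDecomposition QL ρ nL WL) (hWR : IsDecomposition QR ρ nR WR)
      (ρc : ι → End A) (R R' : ι → A) (hRR : ∀ i, IsStandardPair (ρ i) (ρc i) (R i) (R' i)) :
      let I := (i : ι) × (Fin (nL i) × Fin (nR i))
      let B : I → ProdExt C QL QR hL hR := fun a =>
        boundaryOp C QL QR hL hR (WL a.1 a.2.1) (WR a.1 a.2.2)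
      let WLc : (i : ι) → Fin (nL i) → A := fun i k => conjCharge QL (ρc i) (R i) (WL i k)
      let WRc : (i : ι) → Fin (nR i) → A := fun i k => conjCharge QR (ρc i) (R i) (WR i k)
      let Bc : I → ProdExt C QL QR hL hR := fun a =>
        boundaryOp C QL QR hL hR (WLc a.1 a.2.1) (WRc a.1 a.2.2)
      let T : I → A := fun a => WL a.1 a.2.1 * star (WR a.1 a.2.2)
      (LinearIndependent ℂ B ∧ Submodule.span ℂ (Set.range B) =
        Subalgebra.toSubmodule (Subalgebra.center ℂ (ProdExt C QL QR hL hR))) ∧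
      (∀ i k, WLc i k ∈ Hom (ρc i) QL.θ) ∧ (∀ i k, WRc i k ∈ Hom (ρc i) QR.θ) ∧
      (∀ i k l, star (WLc i k) * WLc i l =
        if k = l then ((QL.d / dim (ρc i) : ℝ) : ℂ) • (1 : A) else 0) ∧
      (∀ i k l, star (WRc i k) * WRc i l =
        if k = l then ((QR.d / dim (ρc i) : ℝ) : ℂ) • (1 : A) else 0) ∧
      (∀ a, star (B a) = Bc a) ∧
      (∀ T₁ ∈ Hom QR.θ QL.θ, ∀ T₂ ∈ Hom QR.θ QL.θ, ast QL QR T₁ T₂ ∈ Hom QR.θ QL.θ ∧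
        ast QL QR T₁ T₂ = ast QL QR T₂ T₁) ∧
      ∃ f : I → I → I → ℂ,
        (∀ a b c, fusionElement QL QR (ρ c.1) (WL c.1 c.2.1) (WR c.1 c.2.2) (T a) (T b) =
          f a b c • (1 : A)) ∧
        (∀ a b c, f a b c = f b a c) ∧
        ∀ a b, B a * B b =
          ∑ c ∈ Finset.univ.filter (fun c : I => Contained (ρ c.1) ((ρ a.1).comp (ρ b.1))),
            f a b c • B c := by
  intro I B WLc WRc Bc T
  have hpos : ∀ i, 0 < dim (ρ i) := fun i => (hRR i).dim_pos
  have hnorm : ∀ (Q : QSystem A) (n : ι → ℕ) (W : (i : ι) → Fin (n i) → A), Q.IsStandard →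
      IsDecomposition Q ρ n W → ∀ i k l,
      star (conjCharge Q (ρc i) (R i) (W i k)) * conjCharge Q (ρc i) (R i) (W i l) =
        if k = l then ((Q.d / dim (ρc i) : ℝ) : ℂ) • (1 : A) else 0 := by
    intro Q n W hQ hW i k l
    have ht := hW.right_trace hQ hρ hne hRR i k l
    rw [(hRR i).dim_conj (hρ i)]
    by_cases hkl : k = l
    · rw [if_pos hkl] at ht ⊢
      rw [star_conjCharge_mul (hρ i) (hRR i) (hW.mem i l) (hW.mem i k) ht, Complex.ofReal_div]
    · rw [if_neg hkl] at ht ⊢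
      rw [star_conjCharge_mul (d := 0) (hρ i) (hRR i) (hW.mem i l) (hW.mem i k) (by simpa using ht),
        zero_div, zero_smul]
  refine ⟨⟨linearIndependent_boundaryOp hρ hne hpos hWL hWR hL hR,
    span_boundaryOp hρ hne hWL hWR hL hR hcL hcR⟩,
    fun i k => conjCharge_mem (hRR i).1 (hWL.mem i k),
    fun i k => conjCharge_mem (hRR i).1 (hWR.mem i k), hnorm QL nL WL hsL hWL,
    hnorm QR nR WR hsR hWR, ?_, fun T₁ h₁ T₂ h₂ => ⟨ast_mem h₁ h₂, ast_comm C hL hR hcL hcR h₁ h₂⟩,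
    ?_⟩
  · rintro ⟨i, k, l⟩
    refine star_boundaryOp C hL hR hcR (hRR i).1 (hWL.mem i k) (hWR.mem i l) ?_
    refine map_star_conjCharge_mul_r (d := QL.d) (hρ i) (hRR i) (hWL.mem i k) ?_ ?_ ?_
    · rw [hWL.orthonormal, if_pos rfl, Complex.ofReal_div]
    · rw [hWL.right_trace hsL hρ hne hRR, if_pos rfl]
    · exact hWL.left_trace hsL hρ hne hRR i k
  · obtain ⟨f, h1, h2, h3⟩ := boundaryOp_mul (C := C) hρ hne hWL hWR hL hR hcL hcR
    -- The product formula holds with the sum over all sectors; the coefficients outside `τ ≺ ρσ`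
    -- vanish.
    refine ⟨f, h1, h2, fun a b => (h3 a b).trans (Finset.sum_subset (Finset.subset_univ _) ?_).symm⟩
    intro c _ hc
    have hc' : ¬ Contained (ρ c.1) ((ρ a.1).comp (ρ b.1)) := fun h => hc (by simpa using h)
    have h0 : f a b c = 0 := by
      by_contra hf
      apply hc'
      apply contained_of_fusionElement_ne_zero hρ hWL hobj a b c (WR := WR) (QR := QR)
      rw [h1]
      exact smul_ne_zero hf one_ne_zero
    rw [h0, zero_smul]

end Sectors

end

noncomputable section

open scoped ComplexConjugate

namespace Sectors

section Basic

variable {A : Type*} [CStarAlgebra A]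

/-! ### Fusion systems -/

theorem IsStandardPair.comp [Nontrivial A] {ρ ρ' σ σ' : End A} {R R' S S' : A} (hρ : IsIrred ρ)
    (hσ : IsIrred σ) (h₁ : IsStandardPair ρ ρ' R R') (h₂ : IsStandardPair σ σ' S S') :
    IsStandardPair (ρ.comp σ) (σ'.comp ρ') (σ' R * S) (ρ S' * R') := by
  have h := (h₁.isSphericalPair hρ).comp hρ hσ (h₂.isSphericalPair hσ)
  refine ⟨h.isConj, ?_, ?_⟩ <;> rw [h.dim_eq]
  exacts [h.norm_left, h.norm_right]

section Fusion

variable [Nontrivial A] {C : BraidedEnd A} {ι : Type*} [Fintype ι] {ρ ρc : ι → End A} {i₀ : ι}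
  {t : (i j k : ι) → Fin (fusionN (ρ i) (ρ j) (ρ k)) → A} {R R' : ι → A}

/-- The intertwiners `ρ s → ρ j ρ̄ n` dual to the `t s n j c`. -/
def dualCharge (ρ : ι → End A) (t : (i j k : ι) → Fin (fusionN (ρ i) (ρ j) (ρ k)) → A)
    (R' : ι → A) (s n j : ι) (c : Fin (fusionN (ρ s) (ρ n) (ρ j))) : A :=
  star (t s n j c) * ρ s (R' n)

/-- The basis `ρ i (t_c^*) t_b` of `Hom(ρ m ρ n, ρ i ρ j)`. -/
def crossBasis (ρ : ι → End A) (t : (i j k : ι) → Fin (fusionN (ρ i) (ρ j) (ρ k)) → A)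
    (i j m n s : ι) (c : Fin (fusionN (ρ s) (ρ n) (ρ j))) (b : Fin (fusionN (ρ i) (ρ s) (ρ m))) :
    A := ρ i (star (t s n j c)) * t i s m b

namespace IsFusionSystem

variable (H : IsFusionSystem C ρ i₀ t)

include H

theorem hom_eq_zero {i j : ι} (h : i ≠ j) {x : A} (hx : x ∈ Hom (ρ i) (ρ j)) : x = 0 :=
  eq_zero_of_not_equivalent (H.irred i) (H.irred j) (fun he => h (H.inequivalent _ _ he)) hx

theorem isOrthDecomp (i j : ι) : IsOrthDecomp ((ρ i).comp (ρ j))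
    (fun x : (k : ι) × Fin (fusionN (ρ i) (ρ j) (ρ k)) => ρ x.1) (fun x => t i j x.1 x.2) where
  mem x := H.t_mem _ _ _ _
  isometry x := by rw [H.t_orthonormal, if_pos rfl]
  orthogonal := by
    rintro ⟨k, a⟩ ⟨k', b⟩ hab
    by_cases hk : k = k'
    · subst hk
      rw [H.t_orthonormal, if_neg (by rintro rfl; exact hab rfl)]
    · exact H.hom_eq_zero (Ne.symm hk)
        (mul_mem_Hom (star_mem_Hom (H.t_mem i j k a)) (H.t_mem i j k' b))
  complete := by rw [Fintype.sum_sigma]; exact H.t_complete i j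

theorem expand {i j k : ι} {x : A} (hx : x ∈ Hom (ρ k) ((ρ i).comp (ρ j))) :
    x = ∑ a, t i j k a * (star (t i j k a) * x) := by
  conv_lhs => rw [(H.isOrthDecomp i j).eq_sum x]
  rw [Fintype.sum_sigma, Finset.sum_eq_single k]
  · intro k' _ hk'
    refine Finset.sum_eq_zero fun a _ => ?_
    rw [H.hom_eq_zero hk'.symm (mul_mem_Hom (star_mem_Hom (H.t_mem i j k' a)) hx), mul_zero]
  · simp

theorem expand_two {i j m n : ι} {x : A}
    (hx : x ∈ Hom ((ρ m).comp (ρ n)) ((ρ i).comp (ρ j))) :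
    x = ∑ k, ∑ a, ∑ b, t i j k a * (star (t i j k a) * x * t m n k b) * star (t m n k b) := by
  conv_lhs => rw [(H.isOrthDecomp m n).eq_sum_right x]
  rw [Fintype.sum_sigma]
  refine Finset.sum_congr rfl fun k _ => ?_
  rw [Finset.sum_comm]
  refine Finset.sum_congr rfl fun b _ => ?_
  conv_lhs => rw [H.expand (mul_mem_Hom hx (H.t_mem m n k b))]
  rw [Finset.sum_mul]
  simp only [mul_assoc]

/-! ### Partial traces, bent intertwiners and the crossed basis -/

section Traces

variable (hR : ∀ i, IsStandardPair (ρ i) (ρc i) (R i) (R' i))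

include hR

/-- Tracing out `ρ j` leaves a scalar `z` on `ρ i`. Closing with `R' i` gives the full right trace
for the product solution, which is standard, so `z dim(ρ i)` is `dim(ρ k)` or `0`. -/
theorem partial_trace (i j k : ι) (a b : Fin (fusionN (ρ i) (ρ j) (ρ k))) :
    ρ i (star (R' j)) * (t i j k a * star (t i j k b)) * ρ i (R' j) =
      if a = b then ((dim (ρ k) / dim (ρ i) : ℝ) : ℂ) • (1 : A) else 0 := by
  classical
  have hi : (dim (ρ i) : ℂ) ≠ 0 := Complex.ofReal_ne_zero.2 (hR i).dim_pos.ne'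
  have htr := (H.isOrthDecomp i j).right_trace (fun x => H.irred x.1) (fun x => hR x.1)
    ((hR i).comp (H.irred i) (H.irred j) (hR j)) ⟨k, a⟩ ⟨k, b⟩ rfl
  dsimp only at htr
  have hm : ρ i (star (R' j)) * (t i j k a * star (t i j k b)) * ρ i (R' j) ∈
      Hom (ρ i) (ρ i) := by
    have h1 : R' j ∈ Hom (idEnd A) ((ρ j).comp (ρc j)) := (hR j).1.2.1
    have h2 : t i j k a * star (t i j k b) ∈
        Hom (((ρ i).comp (ρ j)).comp (ρc j)) (((ρ i).comp (ρ j)).comp (ρc j)) :=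
      comp_mem_Hom (ρc j) (mul_mem_Hom (H.t_mem i j k a) (star_mem_Hom (H.t_mem i j k b)))
    exact mul_mem_Hom (mul_mem_Hom (map_mem_Hom (ρ i) (star_mem_Hom h1)) h2)
      (map_mem_Hom (ρ i) h1)
  obtain ⟨z, hz⟩ := H.irred i _ hm
  have h1 : star (ρ i (R' j) * R' i) * (t i j k a * star (t i j k b)) * (ρ i (R' j) * R' i) =
      (z * (dim (ρ i) : ℂ)) • (1 : A) := by
    calc _ = star (R' i) * (ρ i (star (R' j)) * (t i j k a * star (t i j k b)) *
          ρ i (R' j)) * R' i := by simp only [star_mul, map_star, mul_assoc]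
      _ = _ := by rw [hz, mul_smul_comm, mul_one, smul_mul_assoc, (hR i).2.2, smul_smul]
  rw [h1] at htr
  rw [hz]
  by_cases hab : a = b
  · rw [if_pos (by rw [hab])] at htr
    rw [if_pos hab, Complex.ofReal_div, ← smul_one_injective htr, mul_div_cancel_right₀ _ hi]
  · rw [if_neg (by simpa using hab)] at htr
    have := smul_one_injective (htr.trans (zero_smul ℂ (1 : A)).symm)
    rw [if_neg hab, (mul_eq_zero.1 this).resolve_right hi, zero_smul]

omit [Nontrivial A] in
theorem dualCharge_mem (s n j : ι) (c : Fin (fusionN (ρ s) (ρ n) (ρ j))) :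
    dualCharge ρ t R' s n j c ∈ Hom (ρ s) ((ρ j).comp (ρc n)) := by
  have h1 : R' n ∈ Hom (idEnd A) ((ρ n).comp (ρc n)) := (hR n).1.2.1
  have h2 := comp_mem_Hom (ρc n) (star_mem_Hom (H.t_mem s n j c))
  exact mul_mem_Hom h2 (map_mem_Hom (ρ s) h1)

theorem star_dualCharge_mul (s n j : ι) (c c' : Fin (fusionN (ρ s) (ρ n) (ρ j))) :
    star (dualCharge ρ t R' s n j c) * dualCharge ρ t R' s n j c' =
      if c = c' then ((dim (ρ j) / dim (ρ s) : ℝ) : ℂ) • (1 : A) else 0 := by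
  rw [← H.partial_trace hR]
  simp only [dualCharge, star_mul, star_star, map_star, mul_assoc]

/-- Bending with `R n` sends `g` into `Hom(ρ s ρ n, ρ j)`, which is spanned by the adjoints of the
`t s n j c`; bending back gives the dual charges. -/
theorem dualCharge_expand {s n j : ι} {g : A} (hg : g ∈ Hom (ρ s) ((ρ j).comp (ρc n))) :
    ∃ z : Fin (fusionN (ρ s) (ρ n) (ρ j)) → ℂ, g = ∑ c, z c • dualCharge ρ t R' s n j c := by
  have hf : ρ j (star (R n)) * g ∈ Hom ((ρ s).comp (ρ n)) (ρ j) := by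
    have h1 : R n ∈ Hom (idEnd A) ((ρc n).comp (ρ n)) := (hR n).1.1
    exact mul_mem_Hom (map_mem_Hom (ρ j) (star_mem_Hom h1)) (comp_mem_Hom (ρ n) hg)
  have hgf : g = ρ j (star (R n)) * g * ρ s (R' n) := by
    have h1 := hg (R' n)
    change g * ρ s (R' n) = ρ j (ρc n (R' n)) * g at h1
    rw [mul_assoc, h1, ← mul_assoc, ← map_mul, (hR n).1.zigzag', map_one, one_mul]
  have hc : ∀ c, ∃ z : ℂ, star (t s n j c) * star (ρ j (star (R n)) * g) = z • (1 : A) :=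
    fun c => H.irred j _ (mul_mem_Hom (star_mem_Hom (H.t_mem s n j c)) (star_mem_Hom hf))
  choose z hz using hc
  refine ⟨fun c => conj (z c), ?_⟩
  have h2 := H.expand (star_mem_Hom hf)
  have h3 : ρ j (star (R n)) * g = ∑ c, conj (z c) • star (t s n j c) := by
    rw [← star_star (ρ j (star (R n)) * g), h2, star_sum]
    refine Finset.sum_congr rfl fun c _ => ?_
    rw [hz, mul_smul_comm, mul_one, star_smul, RCLike.star_def]
  rw [hgf, h3, Finset.sum_mul]
  refine Finset.sum_congr rfl fun c _ => ?_
  rw [smul_mul_assoc, dualCharge]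

variable (hρc : ∀ i, ρc i ∈ C.obj)

include hρc

/-- By orthogonality the sum `p` fixes every dual charge, hence every intertwiner from a
representative into `ρ j ρ̄ n`. Ranges of such intertwiners exhaust the product. -/
theorem dualCharge_complete (n j : ι) :
    ∑ s, ∑ c, ((dim (ρ s) / dim (ρ j) : ℝ) : ℂ) •
      (dualCharge ρ t R' s n j c * star (dualCharge ρ t R' s n j c)) = 1 := by
  set p := ∑ s, ∑ c, ((dim (ρ s) / dim (ρ j) : ℝ) : ℂ) •
      (dualCharge ρ t R' s n j c * star (dualCharge ρ t R' s n j c)) with hp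
  have hd := H.dualCharge_mem hR
  have h1 : ∀ u c, p * dualCharge ρ t R' u n j c = dualCharge ρ t R' u n j c := by
    intro u c
    rw [hp, Finset.sum_mul, Finset.sum_eq_single u]
    · rw [Finset.sum_mul, Finset.sum_eq_single c]
      · rw [smul_mul_assoc, mul_assoc, H.star_dualCharge_mul hR, if_pos rfl, mul_smul_comm,
          mul_one, smul_smul, ← Complex.ofReal_mul,
          div_mul_div_cancel₀ (hR j).dim_pos.ne', div_self (hR u).dim_pos.ne',
          Complex.ofReal_one, one_smul]
      · intro c' _ hc'
        rw [smul_mul_assoc, mul_assoc, H.star_dualCharge_mul hR, if_neg hc', mul_zero, smul_zero]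
      · simp
    · intro s _ hs
      rw [Finset.sum_mul]
      refine Finset.sum_eq_zero fun c' _ => ?_
      rw [smul_mul_assoc, mul_assoc, H.hom_eq_zero hs.symm
        (mul_mem_Hom (star_mem_Hom (hd s n j c')) (hd u n j c)), mul_zero, smul_zero]
    · simp
  have h2 : ∀ u, ∀ g ∈ Hom (ρ u) ((ρ j).comp (ρc n)), p * g = g := by
    intro u g hg
    obtain ⟨z, rfl⟩ := H.dualCharge_expand hR hg
    rw [Finset.mul_sum]
    refine Finset.sum_congr rfl fun c _ => ?_
    rw [mul_smul_comm, h1]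
  -- The conjugate of `ρ n` is only equivalent to a representative, so the decomposition of `ρ j ρ
  -- m` is transported by the unitary `v`.
  obtain ⟨m, v, hv, hv1, hv2⟩ := H.exhaustive (ρc n) (hρc n) ((H.irred n).conj (hR n).1)
  have h3 : ∑ k, ∑ a, ρ j v * t j m k a * star (ρ j v * t j m k a) = 1 := by
    calc _ = ρ j v * (∑ k, ∑ a, t j m k a * star (t j m k a)) * ρ j (star v) := by
          simp only [Finset.mul_sum, Finset.sum_mul, star_mul, map_star, mul_assoc]
      _ = 1 := by rw [H.t_complete, mul_one, ← map_mul, hv2, map_one]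
  rw [← mul_one p]
  conv_lhs => rw [← h3]
  rw [← h3, Finset.mul_sum]
  refine Finset.sum_congr rfl fun k _ => ?_
  rw [Finset.mul_sum]
  refine Finset.sum_congr rfl fun a _ => ?_
  rw [← mul_assoc, h2 k _ (mul_mem_Hom (map_mem_Hom (ρ j) hv) (H.t_mem j m k a))]

/-- Completeness of the dual charges between `ρ j (R n)^*` and `ρ j (R n)`: the identity yields
`dim(ρ n)`, and each dual charge bends back to an isometry and contributes `dim(ρ s) / dim(ρ j)`. -/
theorem sum_fusionN_mul_dim (n j : ι) :
    ∑ s, (fusionN (ρ s) (ρ n) (ρ j) : ℝ) * dim (ρ s) = dim (ρ j) * dim (ρ n) := by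
  have hj := (hR j).dim_pos
  have hd : ∀ s c, ρ j (star (R n)) * dualCharge ρ t R' s n j c = star (t s n j c) := by
    intro s c
    have h1 := star_mem_Hom (H.t_mem s n j c) (star (R n))
    change star (t s n j c) * ρ s (ρ n (star (R n))) = ρ j (star (R n)) * star (t s n j c) at h1
    rw [dualCharge, ← mul_assoc, ← h1, mul_assoc, ← map_mul, (hR n).1.star_zigzag, map_one,
      mul_one]
  have h1 : ρ j (star (R n)) * (∑ s, ∑ c, ((dim (ρ s) / dim (ρ j) : ℝ) : ℂ) •
      (dualCharge ρ t R' s n j c * star (dualCharge ρ t R' s n j c))) * ρ j (R n) =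
      ∑ s, ∑ _c : Fin (fusionN (ρ s) (ρ n) (ρ j)), ((dim (ρ s) / dim (ρ j) : ℝ) : ℂ) •
        (1 : A) := by
    simp only [Finset.mul_sum, Finset.sum_mul, mul_smul_comm, smul_mul_assoc]
    refine Finset.sum_congr rfl fun s _ => Finset.sum_congr rfl fun c _ => ?_
    have h2 : star (dualCharge ρ t R' s n j c) * ρ j (R n) = t s n j c := by
      have := congrArg star (hd s c)
      simpa [map_star] using this
    rw [← mul_assoc, hd, mul_assoc, h2, H.t_orthonormal, if_pos rfl]
  rw [H.dualCharge_complete hR hρc, mul_one, ← map_mul, (hR n).2.1, map_smul, map_one] at h1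
  simp only [← Finset.sum_smul] at h1
  have h2 := smul_one_injective h1
  simp only [Finset.sum_const, Finset.card_univ, Fintype.card_fin, nsmul_eq_mul] at h2
  have h3 : dim (ρ n) = ∑ s, (fusionN (ρ s) (ρ n) (ρ j) : ℝ) * (dim (ρ s) / dim (ρ j)) := by
    exact_mod_cast h2
  rw [h3, Finset.mul_sum]
  refine Finset.sum_congr rfl fun s _ => ?_
  field_simp

/-- Bending `ρ n` upwards turns `x` into an intertwiner from `ρ m` to `ρ i ρ j ρ̄ n`, which is
expanded in the dual charges and then in the `t i s m b`. Bending back gives the crossed basis, with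
coefficients that are partial traces. -/
theorem cross_expand {i j m n : ι} {x : A}
    (hx : x ∈ Hom ((ρ m).comp (ρ n)) ((ρ i).comp (ρ j))) :
    x = ∑ s, ∑ c, ∑ b, ((dim (ρ s) / dim (ρ j) : ℝ) : ℂ) •
      (crossBasis ρ t i j m n s c b *
        (ρ m (star (R' n)) * (star (crossBasis ρ t i j m n s c b) * x) * ρ m (R' n))) := by
  have hxm : x * ρ m (R' n) ∈ Hom (ρ m) ((ρ i).comp ((ρ j).comp (ρc n))) := by
    have h1 : R' n ∈ Hom (idEnd A) ((ρ n).comp (ρc n)) := (hR n).1.2.1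
    exact mul_mem_Hom (comp_mem_Hom (ρc n) hx) (map_mem_Hom (ρ m) h1)
  have h0 : x = ρ i (ρ j (star (R n))) * (x * ρ m (R' n)) := by
    have h1 := hx (star (R n))
    change x * ρ m (ρ n (star (R n))) = ρ i (ρ j (star (R n))) * x at h1
    rw [← mul_assoc, ← h1, mul_assoc, ← map_mul, (hR n).1.star_zigzag, map_one, mul_one]
  have h2 : x * ρ m (R' n) = ∑ s, ∑ c, ((dim (ρ s) / dim (ρ j) : ℝ) : ℂ) •
      (ρ i (dualCharge ρ t R' s n j c) *
        (ρ i (star (dualCharge ρ t R' s n j c)) * (x * ρ m (R' n)))) := by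
    have h3 := congrArg (fun y => ρ i y * (x * ρ m (R' n))) (H.dualCharge_complete hR hρc n j)
    simp only [map_one, one_mul, map_sum, map_smul, map_mul, Finset.sum_mul, smul_mul_assoc,
      mul_assoc] at h3
    exact h3.symm
  have hd : ∀ s c, ρ j (star (R n)) * dualCharge ρ t R' s n j c = star (t s n j c) := by
    intro s c
    have h1 := star_mem_Hom (H.t_mem s n j c) (star (R n))
    change star (t s n j c) * ρ s (ρ n (star (R n))) = ρ j (star (R n)) * star (t s n j c) at h1
    rw [dualCharge, ← mul_assoc, ← h1, mul_assoc, ← map_mul, (hR n).1.star_zigzag, map_one,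
      mul_one]
  rw [h2] at h0
  refine h0.trans ?_
  simp only [Finset.mul_sum, mul_smul_comm]
  refine Finset.sum_congr rfl fun s _ => Finset.sum_congr rfl fun c _ => ?_
  have hm : ρ i (star (dualCharge ρ t R' s n j c)) * (x * ρ m (R' n)) ∈
      Hom (ρ m) ((ρ i).comp (ρ s)) :=
    mul_mem_Hom (map_mem_Hom (ρ i) (star_mem_Hom (H.dualCharge_mem hR s n j c))) hxm
  rw [H.expand hm, ← Finset.smul_sum, Finset.mul_sum, Finset.mul_sum]
  congr 1
  refine Finset.sum_congr rfl fun b _ => ?_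
  have h4 := star_mem_Hom (H.t_mem i s m b) (star (R' n))
  change star (t i s m b) * ρ i (ρ s (star (R' n))) = ρ m (star (R' n)) * star (t i s m b) at h4
  calc ρ i (ρ j (star (R n))) * (ρ i (dualCharge ρ t R' s n j c) * (t i s m b *
        (star (t i s m b) * (ρ i (star (dualCharge ρ t R' s n j c)) * (x * ρ m (R' n))))))
      = ρ i (ρ j (star (R n)) * dualCharge ρ t R' s n j c) * t i s m b *
          ((star (t i s m b) * ρ i (ρ s (star (R' n)))) * ρ i (t s n j c) * x * ρ m (R' n)) := by
        simp only [dualCharge, star_mul, star_star, map_mul, map_star, mul_assoc]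
    _ = _ := by
        rw [hd, h4]
        simp only [crossBasis, star_mul, star_star, map_star, mul_assoc]

/-- The partial trace contributes `dim(ρ k) / dim(ρ m)`. The prefactor `1 / dim(ρ k)` is chosen so
that the weights no longer depend on `k`. -/
theorem cross_expand_mul_star (i j m n k : ι) (a : Fin (fusionN (ρ i) (ρ j) (ρ k)))
    (b : Fin (fusionN (ρ m) (ρ n) (ρ k))) :
    (((dim (ρ k))⁻¹ : ℝ) : ℂ) • (t i j k a * star (t m n k b)) =
      ∑ s, ∑ c, ∑ e, ((dim (ρ s) / (dim (ρ j) * dim (ρ m)) : ℝ) : ℂ) •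
        (crossBasis ρ t i j m n s c e *
          (star (t m n k b) * (star (crossBasis ρ t i j m n s c e) * t i j k a))) := by
  have hx : t i j k a * star (t m n k b) ∈ Hom ((ρ m).comp (ρ n)) ((ρ i).comp (ρ j)) :=
    mul_mem_Hom (H.t_mem i j k a) (star_mem_Hom (H.t_mem m n k b))
  conv_lhs => rw [H.cross_expand hR hρc hx]
  simp only [Finset.smul_sum]
  refine Finset.sum_congr rfl fun s _ => Finset.sum_congr rfl fun c _ =>
    Finset.sum_congr rfl fun e _ => ?_
  have hg : crossBasis ρ t i j m n s c e ∈ Hom ((ρ m).comp (ρ n)) ((ρ i).comp (ρ j)) :=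
    mul_mem_Hom (map_mem_Hom (ρ i) (star_mem_Hom (H.t_mem s n j c)))
      (comp_mem_Hom (ρ n) (H.t_mem i s m e))
  generalize crossBasis ρ t i j m n s c e = g at *
  have hga : star g * t i j k a ∈ Hom (ρ k) ((ρ m).comp (ρ n)) :=
    mul_mem_Hom (star_mem_Hom hg) (H.t_mem i j k a)
  have hz : ∀ b', ∃ z : ℂ, star (t m n k b') * (star g * t i j k a) = z • (1 : A) :=
    fun b' => H.irred k _ (mul_mem_Hom (star_mem_Hom (H.t_mem m n k b')) hga)
  choose z hz using hz
  have h1 : star g * t i j k a = ∑ b', z b' • t m n k b' := by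
    conv_lhs => rw [H.expand hga]
    refine Finset.sum_congr rfl fun b' _ => ?_
    rw [hz, mul_smul_comm, mul_one]
  have h2 : ρ m (star (R' n)) * (star g * (t i j k a * star (t m n k b))) * ρ m (R' n) =
      (z b * ((dim (ρ k) / dim (ρ m) : ℝ) : ℂ)) • (1 : A) := by
    rw [← mul_assoc (star g), h1, Finset.sum_mul, Finset.mul_sum, Finset.sum_mul,
      Finset.sum_eq_single b]
    · rw [smul_mul_assoc, mul_smul_comm, smul_mul_assoc, H.partial_trace hR, if_pos rfl, smul_smul]
    · intro b' _ hb'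
      rw [smul_mul_assoc, mul_smul_comm, smul_mul_assoc, H.partial_trace hR, if_neg hb', smul_zero]
    · simp
  rw [h2, hz b, mul_smul_comm, mul_smul_comm, smul_smul, smul_smul, smul_smul]
  congr 1
  have hk : (dim (ρ k) : ℂ) ≠ 0 := Complex.ofReal_ne_zero.2 (hR k).dim_pos.ne'
  have hj : (dim (ρ j) : ℂ) ≠ 0 := Complex.ofReal_ne_zero.2 (hR j).dim_pos.ne'
  have hm : (dim (ρ m) : ℂ) ≠ 0 := Complex.ofReal_ne_zero.2 (hR m).dim_pos.ne'
  push_cast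
  field_simp

end Traces

end IsFusionSystem

end Fusion

end Basic

end Sectors

end

noncomputable section

open scoped ComplexConjugate

namespace Sectors

section Basic

variable {A : Type*} [CStarAlgebra A]

/-! ### Q-systems from fusion tensors -/

/-- Intertwiners `E i j k : σ k → σ i σ j` with the properties of the canonical elements
`∑ a, t_a ⊗ j(t_a)` of a fusion system with dimensions `d` and multiplicities `N`. -/
structure FusionTensor {ι : Type*} [Fintype ι] [DecidableEq ι] (σ : ι → End A) (i₀ : ι)
    (d : ι → ℝ) (N : ι → ι → ι → ℕ) (E : ι → ι → ι → A) : Prop where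
  unit : σ i₀ = idEnd A
  pos : ∀ i, 0 < d i
  dim_unit : d i₀ = 1
  mem : ∀ i j k, E i j k ∈ Hom (σ k) ((σ i).comp (σ j))
  orthogonal : ∀ i j k k', k ≠ k' → star (E i j k) * E i j k' = 0
  norm : ∀ i j k, star (E i j k) * E i j k = (N i j k : ℂ) • (1 : A)
  count : ∀ k, ∑ i, ∑ j, (N i j k : ℝ) * (d i * d j) = d k * ∑ i, d i ^ 2
  unit_left : ∀ j k, E i₀ j k = if j = k then 1 else 0
  unit_right : ∀ i k, E i i₀ k = if i = k then 1 else 0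
  assoc : ∀ i j l k, ∑ s, E i j s * E s l k = ∑ s, σ i (E j l s) * E i s k
  frobenius : ∀ i j m n, ∑ k, (((d k)⁻¹ : ℝ) : ℂ) • (E i j k * star (E m n k)) =
    ∑ s, ((d s / (d j * d m) : ℝ) : ℂ) • (σ i (star (E s n j)) * E i s m)

theorem IsOrthDecomp.map_ext_left {κ : Type*} [Fintype κ] {Θ : End A} {σ : κ → End A} {T : κ → A}
    (hT : IsOrthDecomp Θ σ T) (φ : End A) {x y : A}
    (h : ∀ a, φ (star (T a)) * x = φ (star (T a)) * y) : x = y := by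
  have h1 : ∀ z, z = ∑ a, φ (T a) * (φ (star (T a)) * z) := by
    intro z
    have := congrArg φ hT.complete
    simp only [map_sum, map_mul, map_one] at this
    conv_lhs => rw [← one_mul z, ← this, Finset.sum_mul]
    simp only [mul_assoc]
  rw [h1 x, h1 y]
  simp only [h]

theorem IsOrthDecomp.ext_right {κ : Type*} [Fintype κ] {Θ : End A} {σ : κ → End A} {T : κ → A}
    (hT : IsOrthDecomp Θ σ T) {x y : A} (h : ∀ a, x * T a = y * T a) : x = y := by
  rw [hT.eq_sum_right x, hT.eq_sum_right y]
  simp only [h]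

theorem IsOrthDecomp.map_ext_right {κ : Type*} [Fintype κ] {Θ : End A} {σ : κ → End A} {T : κ → A}
    (hT : IsOrthDecomp Θ σ T) (φ : End A) {x y : A}
    (h : ∀ a, x * φ (T a) = y * φ (T a)) : x = y := by
  apply star_injective
  apply hT.map_ext_left φ
  intro a
  have := congrArg star (h a)
  simpa [map_star] using this

theorem IsOrthDecomp.mul_insert {κ : Type*} [Fintype κ] {Θ : End A} {σ : κ → End A} {T : κ → A}
    (hT : IsOrthDecomp Θ σ T) (x y : A) : x * y = ∑ a, (x * T a) * (star (T a) * y) := by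
  conv_lhs => rw [hT.eq_sum y, Finset.mul_sum]
  simp only [mul_assoc]

theorem IsOrthDecomp.mul_map_insert {κ : Type*} [Fintype κ] {Θ : End A} {σ : κ → End A}
    {T : κ → A} (hT : IsOrthDecomp Θ σ T) (φ : End A) (x y : A) :
    φ x * y = ∑ a, φ (x * T a) * (φ (star (T a)) * y) := by
  conv_lhs => rw [hT.eq_sum_right x, map_sum, Finset.sum_mul]
  simp only [map_mul, mul_assoc]

namespace FusionTensor

variable {ι : Type*} [Fintype ι] [DecidableEq ι] {σ : ι → End A} {i₀ : ι} {d : ι → ℝ}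
  {N : ι → ι → ι → ℕ} {E : ι → ι → ι → A} {Θ : End A} {T : ι → A}

/-- The dimension of the Q-system. -/
def qdim (d : ι → ℝ) : ℝ := Real.sqrt (∑ i, d i ^ 2)

/-- The comultiplication of the Q-system. -/
def comult (d : ι → ℝ) (E : ι → ι → ι → A) (Θ : End A) (T : ι → A) : A :=
  ((Real.sqrt (qdim d))⁻¹ : ℂ) • ∑ i, ∑ j, ∑ k, (Real.sqrt (d i * d j / d k) : ℂ) •
    (Θ (T j) * T i * E i j k * star (T k))

/-- The coefficients of the comultiplication. -/
def comultCoeff (d : ι → ℝ) (i j k : ι) : ℂ :=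
  (((Real.sqrt (qdim d))⁻¹ * Real.sqrt (d i * d j / d k) : ℝ) : ℂ)

variable (F : FusionTensor σ i₀ d N E) (hT : IsOrthDecomp Θ σ T)

include F in
theorem qdim_pos : 0 < qdim d := by
  apply Real.sqrt_pos.2
  exact Finset.sum_pos (fun i _ => pow_pos (F.pos i) 2) ⟨i₀, Finset.mem_univ _⟩

include F in
theorem qdim_sq : qdim d * qdim d = ∑ i, d i ^ 2 :=
  Real.mul_self_sqrt (Finset.sum_nonneg fun i _ => (pow_pos (F.pos i) 2).le)

include F in
theorem comultCoeff_mul (i j k l m n : ι) :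
    comultCoeff d i j k * comultCoeff d l m n =
      (((qdim d)⁻¹ * Real.sqrt ((d i * d j / d k) * (d l * d m / d n)) : ℝ) : ℂ) := by
  have h1 : (Real.sqrt (qdim d))⁻¹ * (Real.sqrt (qdim d))⁻¹ = (qdim d)⁻¹ := by
    rw [← mul_inv, Real.mul_self_sqrt F.qdim_pos.le]
  rw [comultCoeff, comultCoeff, ← Complex.ofReal_mul, mul_mul_mul_comm, h1, Real.sqrt_mul]
  exact div_nonneg (mul_nonneg (F.pos i).le (F.pos j).le) (F.pos k).le

include hT in
-- The Q-system identities are checked on these matrix components, where they become identities for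
-- the `E i j k`.
theorem component (i j k : ι) :
    star (T i) * Θ (star (T j)) * comult d E Θ T * T k = comultCoeff d i j k • E i j k := by
  have h1 : ∀ i' j' k', star (T i) * Θ (star (T j)) *
      (Θ (T j') * T i' * E i' j' k' * star (T k')) * T k =
      if i' = i then if j' = j then if k' = k then E i j k else 0 else 0 else 0 := by
    intro i' j' k'
    have h2 : star (T i) * Θ (star (T j)) * (Θ (T j') * T i' * E i' j' k' * star (T k')) * T k
        = star (T i) * Θ (star (T j) * T j') * T i' * E i' j' k' * (star (T k') * T k) := by
      simp only [map_mul, mul_assoc]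
    rw [h2]
    split_ifs with hi hj hk
    · subst hi hj hk
      rw [hT.isometry, hT.isometry, map_one, mul_one, mul_one, hT.isometry, one_mul]
    · rw [hT.orthogonal _ _ hk, mul_zero]
    · rw [hT.orthogonal _ _ (Ne.symm hj), map_zero, mul_zero]; simp
    · by_cases hj : j = j'
      · rw [hj, hT.isometry, map_one, mul_one, hT.orthogonal _ _ (Ne.symm hi)]; simp
      · rw [hT.orthogonal _ _ hj, map_zero, mul_zero]; simp
  rw [comult, mul_smul_comm, smul_mul_assoc]
  simp only [Finset.mul_sum, Finset.sum_mul, mul_smul_comm, smul_mul_assoc, h1]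
  rw [Finset.sum_eq_single i (fun i' _ hi => by simp [hi]) (by simp),
    Finset.sum_eq_single j (fun j' _ hj => by simp [hj]) (by simp),
    Finset.sum_eq_single k (fun k' _ hk => by simp [hk]) (by simp), if_pos rfl, if_pos rfl,
    if_pos rfl, smul_smul, comultCoeff, Complex.ofReal_mul, Complex.ofReal_inv]

include hT in
theorem star_component (i j k : ι) :
    star (T k) * star (comult d E Θ T) * Θ (T j) * T i =
      comultCoeff d i j k • star (E i j k) := by
  have := congrArg star (component (d := d) (E := E) hT i j k)
  rw [star_smul, RCLike.star_def, comultCoeff, Complex.conj_ofReal] at this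
  rw [comultCoeff, ← this]
  simp only [star_mul, map_star, star_star, mul_assoc]

omit [DecidableEq ι] in
include hT in
theorem ext_component {x y : A}
    (h : ∀ i j k, star (T i) * Θ (star (T j)) * x * T k = star (T i) * Θ (star (T j)) * y * T k) :
    x = y := by
  apply hT.ext_right; intro k
  apply hT.map_ext_left Θ; intro j
  apply hT.ext_left; intro i
  simpa only [mul_assoc] using h i j k

include F hT in
theorem comult_mem : comult d E Θ T ∈ Hom Θ (Θ.comp Θ) := by
  refine Submodule.smul_mem _ _ (Submodule.sum_mem _ fun i _ => Submodule.sum_mem _ fun j _ =>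
    Submodule.sum_mem _ fun k _ => Submodule.smul_mem _ _ ?_)
  have h1 : Θ (T j) * T i ∈ Hom ((σ i).comp (σ j)) (Θ.comp Θ) :=
    mul_mem_Hom (map_mem_Hom Θ (hT.mem j)) (comp_mem_Hom (σ j) (hT.mem i))
  exact mul_mem_Hom (mul_mem_Hom h1 (F.mem i j k)) (star_mem_Hom (hT.mem k))

include F hT in
theorem star_unit_mul (x : A) : star (T i₀) * Θ x = x * star (T i₀) := by
  have := hT.star_mul_apply x i₀
  rwa [F.unit] at this

include F in
theorem sqrt_mul_comultCoeff {i j k : ι} (h : d i * d j = d k) :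
    (Real.sqrt (qdim d) : ℂ) * comultCoeff d i j k = 1 := by
  have h1 : Real.sqrt (qdim d) ≠ 0 := (Real.sqrt_pos.2 F.qdim_pos).ne'
  rw [comultCoeff, ← Complex.ofReal_mul, h, div_self (F.pos k).ne', Real.sqrt_one, mul_one,
    mul_inv_cancel₀ h1, Complex.ofReal_one]

include F hT in
theorem comult_unit_left :
    star ((Real.sqrt (qdim d) : ℂ) • T i₀) * comult d E Θ T = 1 := by
  apply hT.ext_right; intro k
  apply hT.ext_left; intro j
  have h1 := component (d := d) (E := E) hT i₀ j k
  rw [F.star_unit_mul hT, F.unit_left] at h1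
  rw [star_smul, RCLike.star_def, Complex.conj_ofReal, smul_mul_assoc, smul_mul_assoc,
    mul_smul_comm, ← mul_assoc, ← mul_assoc, h1, one_mul]
  split_ifs with hjk
  · subst hjk
    rw [hT.isometry, smul_smul, F.sqrt_mul_comultCoeff (by rw [F.dim_unit, one_mul]), one_smul]
  · rw [hT.orthogonal _ _ hjk, smul_zero, smul_zero]

include F hT in
theorem comult_unit_right :
    Θ (star ((Real.sqrt (qdim d) : ℂ) • T i₀)) * comult d E Θ T = 1 := by
  apply hT.ext_right; intro k
  apply hT.ext_left; intro i
  have h1 := component (d := d) (E := E) hT i i₀ k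
  rw [F.unit_right] at h1
  rw [star_smul, RCLike.star_def, Complex.conj_ofReal, map_smul, smul_mul_assoc, smul_mul_assoc,
    mul_smul_comm, ← mul_assoc, ← mul_assoc, h1, one_mul]
  split_ifs with hjk
  · subst hjk
    rw [hT.isometry, smul_smul, F.sqrt_mul_comultCoeff (by rw [F.dim_unit, mul_one]), one_smul]
  · rw [hT.orthogonal _ _ hjk, smul_zero, smul_zero]

include F hT in
-- In the component from `k` to `i, j, l`, the coefficients on either side are `√(d_i d_j d_l / d_k)
-- / q` with `q = qdim d`, independently of the intermediate sector `s`.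
theorem comult_assoc :
    comult d E Θ T * comult d E Θ T = Θ (comult d E Θ T) * comult d E Θ T := by
  have hx : ∀ a, comult d E Θ T * Θ a = Θ (Θ a) * comult d E Θ T := F.comult_mem hT
  have hc := component (d := d) (E := E) hT
  generalize comult d E Θ T = x at *
  apply hT.map_ext_left (Θ.comp Θ); intro l
  apply ext_component hT
  intro i j k
  change star (T i) * Θ (star (T j)) * (Θ (Θ (star (T l))) * (x * x)) * T k =
    star (T i) * Θ (star (T j)) * (Θ (Θ (star (T l))) * (Θ x * x)) * T k
  have hl : star (T i) * Θ (star (T j)) * (Θ (Θ (star (T l))) * (x * x)) * T k =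
      ∑ s, (comultCoeff d i j s * comultCoeff d s l k) • (E i j s * E s l k) := by
    calc _ = (star (T i) * Θ (star (T j)) * x) * (Θ (star (T l)) * x * T k) := by
          rw [← mul_assoc (Θ (Θ _)), ← hx]; simp only [mul_assoc]
      _ = _ := by
          rw [hT.mul_insert]
          refine Finset.sum_congr rfl fun s _ => ?_
          rw [hc, show star (T s) * (Θ (star (T l)) * x * T k) =
            star (T s) * Θ (star (T l)) * x * T k by simp only [mul_assoc], hc,
            smul_mul_smul_comm]
  have hr : star (T i) * Θ (star (T j)) * (Θ (Θ (star (T l))) * (Θ x * x)) * T k =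
      ∑ s, (comultCoeff d j l s * comultCoeff d i s k) • (σ i (E j l s) * E i s k) := by
    calc _ = star (T i) * (Θ (star (T j) * Θ (star (T l)) * x) * (x * T k)) := by
          simp only [map_mul, mul_assoc]
      _ = ∑ s, star (T i) * (Θ (star (T j) * Θ (star (T l)) * x * T s) *
            (Θ (star (T s)) * (x * T k))) := by
          rw [hT.mul_map_insert, Finset.mul_sum]
      _ = _ := by
          refine Finset.sum_congr rfl fun s _ => ?_
          rw [hc, ← mul_assoc (star (T i)), hT.star_mul_apply, mul_assoc (σ i _),
            show star (T i) * (Θ (star (T s)) * (x * T k)) =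
              star (T i) * Θ (star (T s)) * x * T k by simp only [mul_assoc], hc, map_smul,
            smul_mul_smul_comm]
  have hcc : ∀ s, comultCoeff d i j s * comultCoeff d s l k =
      (((qdim d)⁻¹ * Real.sqrt (d i * d j * d l / d k) : ℝ) : ℂ) := by
    intro s
    have := (F.pos s).ne'
    rw [F.comultCoeff_mul]
    congr 3
    field_simp
  have hcc' : ∀ s, comultCoeff d j l s * comultCoeff d i s k =
      (((qdim d)⁻¹ * Real.sqrt (d i * d j * d l / d k) : ℝ) : ℂ) := by
    intro s
    have := (F.pos s).ne'
    rw [F.comultCoeff_mul]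
    congr 3
    field_simp
  rw [hl, hr]
  simp only [hcc, hcc', ← Finset.smul_sum]
  rw [F.assoc]

include F hT in
-- Both sides share the factor `√(d_i d_j d_m d_n) / q`, with `q = qdim d`. What remains is `1 /
-- d_k` on the left and `d_s / (d_j d_m)` on the right, the weights in the Frobenius property of
-- `E`.
theorem comult_frobenius :
    comult d E Θ T * star (comult d E Θ T) = Θ (star (comult d E Θ T)) * comult d E Θ T := by
  have hx : ∀ a, comult d E Θ T * Θ a = Θ (Θ a) * comult d E Θ T := F.comult_mem hT
  have hc := component (d := d) (E := E) hT
  have hs := star_component (d := d) (E := E) hT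
  generalize comult d E Θ T = x at *
  apply hT.map_ext_right Θ; intro n
  apply ext_component hT
  intro i j m
  have hl : star (T i) * Θ (star (T j)) * (x * star x * Θ (T n)) * T m =
      ∑ k, (comultCoeff d i j k * comultCoeff d m n k) • (E i j k * star (E m n k)) := by
    calc _ = (star (T i) * Θ (star (T j)) * x) * (star x * Θ (T n) * T m) := by
          simp only [mul_assoc]
      _ = _ := by
          rw [hT.mul_insert]
          refine Finset.sum_congr rfl fun s _ => ?_
          rw [hc, show star (T s) * (star x * Θ (T n) * T m) =
            star (T s) * star x * Θ (T n) * T m by simp only [mul_assoc], hs,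
            smul_mul_smul_comm]
  have hr : star (T i) * Θ (star (T j)) * (Θ (star x) * x * Θ (T n)) * T m =
      ∑ s, (comultCoeff d s n j * comultCoeff d i s m) • (σ i (star (E s n j)) * E i s m) := by
    calc _ = star (T i) * (Θ (star (T j) * star x * Θ (T n)) * (x * T m)) := by
          rw [mul_assoc (Θ (star x)), hx]; simp only [map_mul, mul_assoc]
      _ = ∑ s, star (T i) * (Θ (star (T j) * star x * Θ (T n) * T s) *
            (Θ (star (T s)) * (x * T m))) := by
          rw [hT.mul_map_insert, Finset.mul_sum]
      _ = _ := by
          refine Finset.sum_congr rfl fun s _ => ?_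
          rw [hs, ← mul_assoc (star (T i)), hT.star_mul_apply, mul_assoc (σ i _),
            show star (T i) * (Θ (star (T s)) * (x * T m)) =
              star (T i) * Θ (star (T s)) * x * T m by simp only [mul_assoc], hc, map_smul,
            smul_mul_smul_comm]
  have hi := F.pos i
  have hj := F.pos j
  have hm := F.pos m
  have hn := F.pos n
  have hcc : ∀ k, comultCoeff d i j k * comultCoeff d m n k =
      (((qdim d)⁻¹ * Real.sqrt (d i * d j * d m * d n) : ℝ) : ℂ) * (((d k)⁻¹ : ℝ) : ℂ) := by
    intro k
    have hk := F.pos k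
    rw [F.comultCoeff_mul, ← Complex.ofReal_mul, mul_assoc]
    congr 2
    rw [show d i * d j / d k * (d m * d n / d k) = (d i * d j * d m * d n) / (d k) ^ 2 by
      field_simp, Real.sqrt_div' _ (sq_nonneg _), Real.sqrt_sq hk.le, div_eq_mul_inv]
  have hcc' : ∀ s, comultCoeff d s n j * comultCoeff d i s m =
      (((qdim d)⁻¹ * Real.sqrt (d i * d j * d m * d n) : ℝ) : ℂ) *
        ((d s / (d j * d m) : ℝ) : ℂ) := by
    intro s
    have hs := F.pos s
    rw [F.comultCoeff_mul, ← Complex.ofReal_mul, mul_assoc]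
    congr 2
    rw [show d s * d n / d j * (d i * d s / d m) =
      (d i * d j * d m * d n) * (d s / (d j * d m)) ^ 2 by field_simp,
      Real.sqrt_mul (by positivity), Real.sqrt_sq (by positivity)]
  rw [hl, hr]
  simp only [hcc, hcc', mul_smul, ← Finset.smul_sum]
  rw [F.frobenius]

include F hT in
-- The diagonal component is `∑ N d_i d_j / (q d_k)`, which counting turns into `(∑ d_i^2) / q = q`,
-- where `q = qdim d`.
theorem star_comult_mul :
    star (comult d E Θ T) * comult d E Θ T = ((qdim d : ℝ) : ℂ) • (1 : A) := by
  have hc := component (d := d) (E := E) hT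
  have hs := star_component (d := d) (E := E) hT
  generalize comult d E Θ T = x at *
  apply hT.ext_right; intro k'
  apply hT.ext_left; intro k
  have h1 : star (T k) * (star x * x * T k') =
      ∑ j, ∑ i, (comultCoeff d i j k * comultCoeff d i j k') • (star (E i j k) * E i j k') := by
    calc _ = (star (T k) * star x) * (Θ 1 * (x * T k')) := by
          rw [map_one]; simp only [mul_assoc, one_mul]
      _ = ∑ j, (star (T k) * star x * Θ (T j)) * (Θ (star (T j)) * x * T k') := by
          rw [hT.mul_map_insert, Finset.mul_sum]
          refine Finset.sum_congr rfl fun s _ => ?_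
          simp only [one_mul, mul_assoc]
      _ = _ := by
          refine Finset.sum_congr rfl fun j _ => ?_
          rw [hT.mul_insert]
          refine Finset.sum_congr rfl fun i _ => ?_
          rw [hs, show star (T i) * (Θ (star (T j)) * x * T k') =
            star (T i) * Θ (star (T j)) * x * T k' by simp only [mul_assoc], hc,
            smul_mul_smul_comm]
  rw [h1, smul_mul_assoc, one_mul, mul_smul_comm]
  by_cases hk : k = k'
  · subst hk
    have hdk := F.pos k
    have h2 : ∀ i j, comultCoeff d i j k * comultCoeff d i j k * (N i j k : ℂ) =
        (((qdim d)⁻¹ * (d k)⁻¹ * ((N i j k : ℝ) * (d i * d j)) : ℝ) : ℂ) := by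
      intro i j
      have := F.pos i
      have := F.pos j
      rw [F.comultCoeff_mul, Real.sqrt_mul_self (by positivity)]
      push_cast
      ring
    simp only [F.norm, smul_smul, h2]
    rw [hT.isometry, Finset.sum_comm]
    simp only [← Finset.sum_smul, ← Complex.ofReal_sum, ← Finset.mul_sum]
    rw [F.count, ← F.qdim_sq]
    congr 2
    have := F.qdim_pos
    field_simp
  · rw [hT.orthogonal _ _ hk, smul_zero]
    refine Finset.sum_eq_zero fun j _ => Finset.sum_eq_zero fun i _ => ?_
    rw [F.orthogonal _ _ _ _ hk, smul_zero]

/-- The Q-system of a fusion tensor. -/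
def qSystem : QSystem A where
  θ := Θ
  w := (Real.sqrt (qdim d) : ℂ) • T i₀
  x := comult d E Θ T
  d := qdim d
  w_mem := by
    have := hT.mem i₀
    rw [F.unit] at this
    exact Submodule.smul_mem _ _ this
  x_mem := F.comult_mem hT
  unit_left := F.comult_unit_left hT
  unit_right := F.comult_unit_right hT
  assoc := F.comult_assoc hT
  frobenius := F.comult_frobenius hT
  star_w_mul := by
    rw [star_smul, smul_mul_smul_comm, hT.isometry, RCLike.star_def, Complex.conj_ofReal,
      ← Complex.ofReal_mul, Real.mul_self_sqrt F.qdim_pos.le]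
  star_x_mul := F.star_comult_mul hT

end FusionTensor

end Basic

end Sectors

end

noncomputable section

open scoped ComplexConjugate

namespace Sectors

section Basic

variable {A : Type*} [CStarAlgebra A]

/-! ### Standardness, commutativity and fusion coefficients for a fusion tensor -/

namespace FusionTensor

variable {ι : Type*} [Fintype ι] [DecidableEq ι] {σ : ι → End A} {i₀ : ι} {d : ι → ℝ}
  {N : ι → ι → ι → ℕ} {E : ι → ι → ι → A} {Θ : End A} {T : ι → A}
  (F : FusionTensor σ i₀ d N E) (hT : IsOrthDecomp Θ σ T)

theorem qSystem_isStandard [Nontrivial A] (hσ : ∀ i, IsIrred (σ i)) {σ' : ι → End A}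
    {R R' : ι → A} (hR : ∀ i, IsStandardPair (σ i) (σ' i) (R i) (R' i))
    (hd : ∀ i, dim (σ i) = d i ^ 2) : (F.qSystem hT).IsStandard := by
  change qdim d = Real.sqrt (dim Θ)
  rw [hT.dim_eq hσ hR]
  simp only [hd]
  rfl

/-- Naturality moves the `T`s through the braiding and exchanges the indices `i` and `j`; the
coefficients are symmetric in these indices. -/
theorem qSystem_isCommutative {C : BraidedEnd A} (hΘ : Θ ∈ C.obj) (hσ : ∀ i, σ i ∈ C.obj)
    (hcomm : ∀ i j k, C.ε (σ j) (σ i) * E j i k = E i j k) :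
    (F.qSystem hT).IsCommutative C := by
  change C.ε Θ Θ * comult d E Θ T = comult d E Θ T
  have hc := component (d := d) (E := E) hT
  generalize comult d E Θ T = x at *
  apply ext_component hT
  intro i j k
  have h1 := C.natural_left hΘ (hσ j) hΘ _ (star_mem_Hom (hT.mem j))
  have h2 := C.natural_right (hσ j) hΘ (hσ i) _ (star_mem_Hom (hT.mem i))
  have h3 := hT.star_mul_apply (star (T i)) j
  calc star (T i) * Θ (star (T j)) * (C.ε Θ Θ * x) * T k
      = star (T i) * (Θ (star (T j)) * C.ε Θ Θ) * x * T k := by simp only [mul_assoc]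
    _ = (star (T i) * C.ε (σ j) Θ) * star (T j) * x * T k := by rw [← h1]; simp only [mul_assoc]
    _ = C.ε (σ j) (σ i) * (star (T j) * Θ (star (T i)) * x * T k) := by
        rw [← h2, h3]; simp only [mul_assoc]
    _ = _ := by
        rw [hc, hc, mul_smul_comm, hcomm, comultCoeff, comultCoeff, mul_comm (d j)]

section Coefficients

variable [Nontrivial A] (hne : ∀ i j, i ≠ j → ∀ t ∈ Hom (σ i) (σ j), t = 0)
  (hσ : ∀ i, IsIrred (σ i)) (hd : ∀ i, dim (σ i) = d i ^ 2) {W : ι → A}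
  (hW : ∀ i, W i ∈ Hom (σ i) Θ)
  (hWn : ∀ i, star (W i) * W i = ((qdim d / dim (σ i) : ℝ) : ℂ) • (1 : A))

include hT hne hσ hW hWn

omit [DecidableEq ι] in
-- Each sector occurs once, so Schur's lemma fixes `W i` up to a phase. Phases cancel below, where
-- only `z * conj z` enters.
theorem exists_phase (i : ι) : ∃ z : ℂ, W i = z • T i ∧
    z * conj z = ((qdim d / dim (σ i) : ℝ) : ℂ) := by
  obtain ⟨z, hz⟩ := hσ i _ (mul_mem_Hom (star_mem_Hom (hT.mem i)) (hW i))
  have h1 : W i = z • T i := by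
    rw [hT.eq_sum (W i), Finset.sum_eq_single i, hz, mul_smul_comm, mul_one]
    · intro j _ hj
      rw [hne i j hj.symm _ (mul_mem_Hom (star_mem_Hom (hT.mem j)) (hW i)), mul_zero]
    · simp
  refine ⟨z, h1, smul_one_injective (A := A) ?_⟩
  rw [← hWn, h1, star_smul, smul_mul_smul_comm, hT.isometry, RCLike.star_def, mul_comm]

omit [DecidableEq ι] in
theorem mul_star_eq (i : ι) :
    W i * star (W i) = ((qdim d / dim (σ i) : ℝ) : ℂ) • (T i * star (T i)) := by
  obtain ⟨z, h1, h2⟩ := exists_phase hT hne hσ hW hWn i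
  rw [h1, star_smul, smul_mul_smul_comm, RCLike.star_def, h2]

omit [DecidableEq ι] in
theorem star_mul_mul_eq (i : ι) (y : A) :
    star (W i) * y * W i = ((qdim d / dim (σ i) : ℝ) : ℂ) • (star (T i) * y * T i) := by
  obtain ⟨z, h1, h2⟩ := exists_phase hT hne hσ hW hWn i
  rw [h1, star_smul, smul_mul_assoc, smul_mul_assoc, mul_smul_comm, smul_smul, RCLike.star_def,
    mul_comm, h2]

include F hd

/-- The projections `T_i T_i^*` and `T_j T_j^*` select one component of the comultiplication and its
adjoint, whose product is `d_i d_j N / (q d_k)` with `q = qdim d`. The index order `j, i` arises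
since `∗` applies `θ` to its first argument. -/
theorem fusionElement_eq (i j k : ι) :
    fusionElement (F.qSystem hT) (F.qSystem hT) (σ k) (W k) (W k) (W i * star (W i))
      (W j * star (W j)) = ((N j i k * d k / (d i * d j) : ℝ) : ℂ) • (1 : A) := by
  have hc := component (d := d) (E := E) hT
  have hs := star_component (d := d) (E := E) hT
  have hq := F.qdim_pos
  have hi := F.pos i
  have hj := F.pos j
  have hk := F.pos k
  rw [fusionElement, ast, mul_star_eq hT hne hσ hW hWn, mul_star_eq hT hne hσ hW hWn,
    star_mul_mul_eq hT hne hσ hW hWn, hd, hd, hd]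
  change (((d k ^ 2) ^ 2 / (qdim d * qdim d) : ℝ) : ℂ) • (((qdim d / d k ^ 2 : ℝ) : ℂ) •
    (star (T k) * (star (comult d E Θ T) * (Θ (((qdim d / d i ^ 2 : ℝ) : ℂ) • (T i * star (T i))) *
      ((qdim d / d j ^ 2 : ℝ) : ℂ) • (T j * star (T j))) * comult d E Θ T) * T k)) = _
  generalize comult d E Θ T = x at *
  have h1 : star (T k) * (star x * (Θ (T i * star (T i)) * (T j * star (T j))) * x) * T k =
      (comultCoeff d j i k * comultCoeff d j i k * N j i k) • (1 : A) := by
    have h2 : Θ (star (T i)) * (T j * star (T j)) = T j * (star (T j) * Θ (star (T i))) := by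
      rw [hT.star_mul_apply, ← mul_assoc, ← hT.mem j, mul_assoc]
    calc _ = star (T k) * star x * Θ (T i) * (Θ (star (T i)) * (T j * star (T j))) * x * T k := by
          simp only [map_mul, mul_assoc]
      _ = (star (T k) * star x * Θ (T i) * T j) * (star (T j) * Θ (star (T i)) * x * T k) := by
          rw [h2]; simp only [mul_assoc]
      _ = _ := by rw [hs, hc, smul_mul_smul_comm, F.norm, smul_smul]
  simp only [map_smul, smul_mul_assoc, mul_smul_comm, h1, smul_smul]
  rw [F.comultCoeff_mul, Real.sqrt_mul_self (by positivity)]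
  congr 1
  norm_cast
  field_simp

theorem isDecomposition_single :
    IsDecomposition (F.qSystem hT) σ (fun _ => 1) (fun i (_ : Fin 1) => W i) where
  mem i _ := hW i
  orthonormal i k l := by
    rw [if_pos (Subsingleton.elim k l)]
    exact hWn i
  complete := by
    have hq := F.qdim_pos
    rw [← hT.complete]
    refine Finset.sum_congr rfl fun i _ => ?_
    have hi := F.pos i
    rw [Fin.sum_univ_one, mul_star_eq hT hne hσ hW hWn, smul_smul]
    change (((dim (σ i) / qdim d : ℝ) : ℂ) * ((qdim d / dim (σ i) : ℝ) : ℂ)) • _ = _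
    rw [hd, ← Complex.ofReal_mul, div_mul_div_cancel₀ hq.ne', div_self (pow_pos hi 2).ne',
      Complex.ofReal_one, one_smul]

theorem boundaryOp_mul_eq {C : BraidedEnd A} (hQ : (F.qSystem hT).θ ∈ C.obj)
    (hcomm : (F.qSystem hT).IsCommutative C) (i j : ι) :
    boundaryOp C _ _ hQ hQ (W i) (W i) * boundaryOp C _ _ hQ hQ (W j) (W j) =
      ∑ k, ((N j i k * d k / (d i * d j) : ℝ) : ℂ) • boundaryOp C _ _ hQ hQ (W k) (W k) := by
  have hdec := isDecomposition_single F hT hne hσ hd hW hWn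
  have hne' : ∀ i j, Equivalent (σ i) (σ j) → i = j := by
    rintro i j ⟨u, hu, hu1, -⟩
    by_contra hij
    rw [hne i j hij u hu, mul_zero] at hu1
    exact zero_ne_one hu1
  obtain ⟨f, h1, -, h3⟩ := boundaryOp_mul hσ hne' hdec hdec hQ hQ hcomm hcomm
  refine (h3 ⟨i, 0, 0⟩ ⟨j, 0, 0⟩).trans ?_
  rw [Fintype.sum_sigma]
  refine Finset.sum_congr rfl fun k _ => ?_
  rw [Fintype.sum_prod_type, Fin.sum_univ_one, Fin.sum_univ_one]
  congr 1
  apply smul_one_injective (A := A)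
  rw [← h1]
  exact fusionElement_eq F hT hne hσ hd hW hWn i j k

/-- Up to a phase `W i₀` is the unit `w`, and `r^* θ(w w^*)` reduces by the unit law to the
coefficient of `1`. -/
theorem boundaryOp_unit {C : BraidedEnd A} (hQ : (F.qSystem hT).θ ∈ C.obj) :
    boundaryOp C _ _ hQ hQ (W i₀) (W i₀) = 1 := by
  set Q := F.qSystem hT
  have hw : W i₀ * star (W i₀) = Q.w * star Q.w := by
    rw [mul_star_eq hT hne hσ hW hWn, hd, F.dim_unit]
    change _ = ((Real.sqrt (qdim d) : ℂ) • T i₀) * star ((Real.sqrt (qdim d) : ℂ) • T i₀)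
    rw [star_smul, smul_mul_smul_comm, RCLike.star_def, Complex.conj_ofReal, ← Complex.ofReal_mul,
      Real.mul_self_sqrt F.qdim_pos.le, one_pow, div_one]
  rw [boundaryOp_eq]
  apply Ext.ext'
  rw [Ext.one_def, Ext.coeff_mk, Ext.coeff_mk]
  change bdCoeff Q (W i₀ * star (W i₀)) = star (Q.θ Q.w * Q.w)
  rw [hw, bdCoeff, Q.star_r, map_mul, mul_assoc, ← mul_assoc (star Q.x), Q.star_x_mul_θ_w, one_mul,
    star_mul, map_star]

end Coefficients

end FusionTensor

end Basic

/-! ### The canonical fusion tensor -/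

section Canonical

variable {A A₂ : Type*} [CStarAlgebra A] [CStarAlgebra A₂] {C : BraidedEnd A} {C₂ : BraidedEnd A₂}
  (J : Conjugation C) (S : TensorSquare C C₂)

namespace Conjugation

theorem map_mem {ρ σ : End A} {x : A} (hx : x ∈ Hom ρ σ) :
    J.j x ∈ Hom (J.conjEnd ρ) (J.conjEnd σ) := by
  intro a
  rw [J.conjEnd_apply, J.conjEnd_apply, ← map_mul, hx, map_mul]

theorem conjEnd_comp (ρ σ : End A) :
    J.conjEnd (ρ.comp σ) = (J.conjEnd ρ).comp (J.conjEnd σ) := by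
  ext a
  change J.conjEnd (ρ.comp σ) a = J.conjEnd ρ (J.conjEnd σ a)
  rw [J.conjEnd_apply, J.conjEnd_apply, J.conjEnd_apply, J.j_j]
  rfl

theorem conjEnd_id : J.conjEnd (idEnd A) = idEnd A := by
  ext a
  rw [J.conjEnd_apply]
  exact J.j_j a

theorem j_sum {κ : Type*} (s : Finset κ) (f : κ → A) : J.j (∑ a ∈ s, f a) = ∑ a ∈ s, J.j (f a) :=
  map_sum J.j f s

end Conjugation

/-- The element `x ⊗ j(x)`. -/
def tens (x : A) : A₂ := S.l x * S.r (J.j x)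

/-- The object `ρ ⊗ ρ̄`. -/
def dbl (ρ : End A) : End A₂ := S.box ρ (J.conjEnd ρ)

theorem tens_mul (x y : A) : tens J S (x * y) = tens J S x * tens J S y := by
  simp only [tens, map_mul]
  rw [mul_assoc, ← mul_assoc (S.l y), S.commute]
  simp only [mul_assoc]

theorem tens_star (x : A) : tens J S (star x) = star (tens J S x) := by
  rw [tens, tens, star_mul, map_star, map_star, map_star, ← map_star, ← map_star S.r, S.commute]

theorem tens_zero : tens J S 0 = 0 := by simp [tens]

theorem tens_one : tens J S 1 = 1 := by simp [tens]

/-- Antilinearity of `j` makes `x ↦ x ⊗ j(x)` insensitive to phases. -/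
theorem tens_smul_one (z : ℂ) : tens J S (z • (1 : A)) = (z * conj z) • (1 : A₂) := by
  rw [tens, J.j_smul, map_smul, map_smul, map_one, map_one, map_one, smul_mul_smul_comm, mul_one]

theorem tens_mem {ρ σ : End A} (hρ : ρ ∈ C.obj) (hσ : σ ∈ C.obj) {x : A} (hx : x ∈ Hom ρ σ) :
    tens J S x ∈ Hom (dbl J S ρ) (dbl J S σ) := by
  rw [dbl, dbl, S.hom_box hρ (J.conjEnd_mem _ hρ) hσ (J.conjEnd_mem _ hσ)]
  exact Submodule.subset_span ⟨x, hx, _, J.map_mem hx, rfl⟩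

theorem dbl_tens {ρ : End A} (hρ : ρ ∈ C.obj) (x : A) :
    dbl J S ρ (tens J S x) = tens J S (ρ x) := by
  rw [dbl, tens, S.box_apply hρ (J.conjEnd_mem _ hρ), J.conjEnd_apply, J.j_j, tens]

theorem dbl_comp {ρ σ : End A} (hρ : ρ ∈ C.obj) (hσ : σ ∈ C.obj) :
    (dbl J S ρ).comp (dbl J S σ) = dbl J S (ρ.comp σ) := by
  rw [dbl, dbl, dbl, S.box_comp hρ (J.conjEnd_mem _ hρ) hσ (J.conjEnd_mem _ hσ), J.conjEnd_comp]

theorem dbl_id : dbl J S (idEnd A) = idEnd A₂ := by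
  rw [dbl, J.conjEnd_id, S.box_id]

/-- The opposite braiding on the second factor is what `j` makes of the braiding on the first. -/
theorem ε_dbl {ρ σ : End A} (hρ : ρ ∈ C.obj) (hσ : σ ∈ C.obj) :
    C₂.ε (dbl J S ρ) (dbl J S σ) = tens J S (C.ε ρ σ) := by
  rw [dbl, dbl, S.ε_box hρ (J.conjEnd_mem _ hρ) hσ (J.conjEnd_mem _ hσ), tens, J.j_ε _ hρ _ hσ]

/-- The element `∑ a, e_a ⊗ j(e_a)` does not depend on the choice of the basis `e`. -/
theorem sum_tens_eq {κ κ' : Type*} [Fintype κ] [Fintype κ'] {e : κ → A} {g : κ' → A}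
    {α : κ → ℝ} {β : κ' → ℝ} (U : κ' → κ → ℂ) (hg : ∀ k', g k' = ∑ k, U k' k • e k)
    (he : ∀ k, (α k : ℂ) • e k = ∑ k', ((β k' : ℂ) * conj (U k' k)) • g k') :
    ∑ k, (α k : ℂ) • tens J S (e k) = ∑ k', (β k' : ℂ) • tens J S (g k') := by
  -- Both sums become the same double sum over `g ⊗ j(e)`: here the conjugate of `U` comes from
  -- `he`, in `h2` from the antilinearity of `j`.
  have h1 : ∀ k, (α k : ℂ) • tens J S (e k) =
      ∑ k', ((β k' : ℂ) * conj (U k' k)) • (S.l (g k') * S.r (J.j (e k))) := by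
    intro k
    rw [tens, ← smul_mul_assoc, ← map_smul, he, map_sum, Finset.sum_mul]
    simp only [map_smul, smul_mul_assoc]
  have h2 : ∀ k', (β k' : ℂ) • tens J S (g k') =
      ∑ k, ((β k' : ℂ) * conj (U k' k)) • (S.l (g k') * S.r (J.j (e k))) := by
    intro k'
    rw [tens]
    conv_lhs => rw [show J.j (g k') = J.j (∑ k, U k' k • e k) by rw [← hg]]
    rw [J.j_sum, map_sum, Finset.mul_sum, Finset.smul_sum]
    refine Finset.sum_congr rfl fun k _ => ?_
    rw [J.j_smul, map_smul, mul_smul_comm, smul_smul]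
  simp only [h1, h2]
  exact Finset.sum_comm

theorem TensorSquare.star_mul_mul (x y x' y' : A) :
    star (S.l x * S.r y) * (S.l x' * S.r y') = S.l (star x * x') * S.r (star y * y') := by
  rw [star_mul, ← map_star, ← map_star, mul_assoc, ← mul_assoc (S.l (star x)), ← map_mul,
    ← mul_assoc, ← S.commute, mul_assoc, ← map_mul]

theorem TensorSquare.star_mul_self {x y : A} {p q : ℂ} (hx : star x * x = p • (1 : A))
    (hy : star y * y = q • (1 : A)) :
    star (S.l x * S.r y) * (S.l x * S.r y) = (p * q) • (1 : A₂) := by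
  rw [S.star_mul_mul, hx, hy, map_smul, map_smul, map_one, map_one, smul_mul_smul_comm, mul_one]

/-! ### Irreducibility and dimension of the doubled sectors -/

section Irreducible

variable {ρ : End A} {R R' : A}

theorem isIrred_dbl (hobj : ρ ∈ C.obj) (hρ : IsIrred ρ)
    (hR : IsStandardPair ρ (J.conjEnd ρ) R R') : IsIrred (dbl J S ρ) := by
  intro x hx
  rw [dbl, S.hom_box hobj (J.conjEnd_mem _ hobj) hobj (J.conjEnd_mem _ hobj)] at hx
  induction hx using Submodule.span_induction with
  | mem x h =>
    obtain ⟨t, ht, s, hs, rfl⟩ := h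
    obtain ⟨y, rfl⟩ := hρ t ht
    obtain ⟨z, rfl⟩ := hρ.conj hR.1 s hs
    exact ⟨y * z, by rw [map_smul, map_smul, map_one, map_one, smul_mul_smul_comm, mul_one]⟩
  | zero => exact ⟨0, by rw [zero_smul]⟩
  | add x y _ _ hx hy =>
    obtain ⟨a, rfl⟩ := hx
    obtain ⟨b, rfl⟩ := hy
    exact ⟨a + b, by rw [add_smul]⟩
  | smul a x _ hx =>
    obtain ⟨b, rfl⟩ := hx
    exact ⟨a * b, by rw [smul_smul]⟩

/-- In the second tensor factor `ρ` is the conjugate of `ρ̄`, so `R` and `R'` exchange their roles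
there. -/
theorem isConjPair_dbl (hobj : ρ ∈ C.obj) (hR : IsStandardPair ρ (J.conjEnd ρ) R R') :
    IsConjPair (dbl J S ρ) (S.box (J.conjEnd ρ) ρ) (S.l R * S.r R') (S.l R' * S.r R) := by
  have hc := J.conjEnd_mem _ hobj
  have hid := C.id_mem
  refine ⟨?_, ?_, ?_, ?_⟩
  · rw [dbl, ← S.box_id, S.box_comp hc hobj hobj hc,
      S.hom_box hid hid (C.comp_mem hc hobj) (C.comp_mem hobj hc)]
    exact Submodule.subset_span ⟨R, hR.1.1, R', hR.1.2.1, rfl⟩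
  · rw [dbl, ← S.box_id, S.box_comp hobj hc hc hobj,
      S.hom_box hid hid (C.comp_mem hobj hc) (C.comp_mem hc hobj)]
    exact Submodule.subset_span ⟨R', hR.1.2.1, R, hR.1.1, rfl⟩
  · rw [dbl, S.box_apply hobj hc, S.star_mul_mul, hR.1.zigzag, hR.1.zigzag', map_one, map_one,
      one_mul]
  · rw [S.box_apply hc hobj, S.star_mul_mul, hR.1.zigzag, hR.1.zigzag', map_one, map_one, one_mul]

variable [Nontrivial A₂]

theorem dim_dbl (hobj : ρ ∈ C.obj) (hρ : IsIrred ρ)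
    (hR : IsStandardPair ρ (J.conjEnd ρ) R R') : dim (dbl J S ρ) = dim ρ ^ 2 := by
  apply (isIrred_dbl J S hobj hρ hR).dim_eq (isConjPair_dbl J S hobj hR)
  · rw [S.star_mul_self hR.2.1 hR.2.2, ← Complex.ofReal_mul, sq]
  · rw [S.star_mul_self hR.2.2 hR.2.1, ← Complex.ofReal_mul, sq]

theorem isStandardPair_dbl (hobj : ρ ∈ C.obj) (hρ : IsIrred ρ)
    (hR : IsStandardPair ρ (J.conjEnd ρ) R R') :
    IsStandardPair (dbl J S ρ) (S.box (J.conjEnd ρ) ρ) (S.l R * S.r R') (S.l R' * S.r R) := by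
  refine ⟨isConjPair_dbl J S hobj hR, ?_, ?_⟩ <;> rw [dim_dbl J S hobj hρ hR]
  · rw [S.star_mul_self hR.2.1 hR.2.2, ← Complex.ofReal_mul, sq]
  · rw [S.star_mul_self hR.2.2 hR.2.1, ← Complex.ofReal_mul, sq]

end Irreducible

end Canonical

end Sectors

end

noncomputable section

open scoped ComplexConjugate

namespace Sectors

section Canonical

variable {A A₂ : Type*} [CStarAlgebra A] [CStarAlgebra A₂] [Nontrivial A]
  {C : BraidedEnd A} {C₂ : BraidedEnd A₂} (J : Conjugation C) (S : TensorSquare C C₂)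
  {ι : Type*} [Fintype ι] {ρ : ι → End A} {i₀ : ι}
  {t : (i j k : ι) → Fin (fusionN (ρ i) (ρ j) (ρ k)) → A}

/-- The canonical element `∑ a, t_a ⊗ j(t_a)` of `Hom(ρ k ⊗ ρ̄ k, (ρ i ⊗ ρ̄ i)(ρ j ⊗ ρ̄ j))`. -/
def canTensor (t : (i j k : ι) → Fin (fusionN (ρ i) (ρ j) (ρ k)) → A) (i j k : ι) : A₂ :=
  ∑ a, tens J S (t i j k a)

/-! ### Basis independence and the axioms of a fusion tensor -/

namespace IsFusionSystem

variable (H : IsFusionSystem C ρ i₀ t)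

include H

omit [Nontrivial A] in
theorem canTensor_mem (i j k : ι) : canTensor J S t i j k ∈
    Hom (dbl J S (ρ k)) ((dbl J S (ρ i)).comp (dbl J S (ρ j))) := by
  rw [dbl_comp J S (H.mem i) (H.mem j)]
  exact Submodule.sum_mem _ fun a _ =>
    tens_mem J S (H.mem k) (C.comp_mem (H.mem i) (H.mem j)) (H.t_mem i j k a)

theorem star_canTensor_mul_of_ne {i j k k' : ι} (h : k ≠ k') :
    star (canTensor J S t i j k) * canTensor J S t i j k' = 0 := by
  rw [canTensor, canTensor, star_sum, Finset.sum_mul_sum]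
  refine Finset.sum_eq_zero fun a _ => Finset.sum_eq_zero fun b _ => ?_
  rw [← tens_star, ← tens_mul, H.hom_eq_zero h.symm
    (mul_mem_Hom (star_mem_Hom (H.t_mem i j k a)) (H.t_mem i j k' b)), tens_zero]

omit [Nontrivial A] in
theorem star_canTensor_mul (i j k : ι) :
    star (canTensor J S t i j k) * canTensor J S t i j k =
      (fusionN (ρ i) (ρ j) (ρ k) : ℂ) • (1 : A₂) := by
  have h1 : ∀ a, ∑ b, star (tens J S (t i j k a)) * tens J S (t i j k b) = 1 := by
    intro a
    rw [Finset.sum_eq_single a]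
    · rw [← tens_star, ← tens_mul, H.t_orthonormal, if_pos rfl, tens_one]
    · intro b _ hb
      rw [← tens_star, ← tens_mul, H.t_orthonormal, if_neg hb.symm, tens_zero]
    · simp
  rw [canTensor, star_sum, Finset.sum_mul_sum]
  simp only [h1, Finset.sum_const, Finset.card_univ, Fintype.card_fin]
  rw [← Nat.cast_smul_eq_nsmul ℂ]

/-- Canonical elements formed with intertwiners of an irreducible endomorphism. -/
theorem sum_tens_eq_one {i j k₀ : ι} (h : ∀ k a, t i j k a ∈ Hom (ρ k) (ρ k₀)) (k : ι)
    [Decidable (k₀ = k)] : canTensor J S t i j k = if k₀ = k then 1 else 0 := by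
  split_ifs with hk
  · subst hk
    choose z hz using fun a => H.irred k₀ _ (h k₀ a)
    -- Only `k₀` contributes, and completeness becomes `∑ |z_a|^2 = 1`, which is also the
    -- coefficient of the canonical element.
    have h1 := H.t_complete i j
    rw [Finset.sum_eq_single k₀] at h1
    · simp only [hz, star_smul, star_one, smul_mul_smul_comm, mul_one, RCLike.star_def,
        ← Finset.sum_smul] at h1
      have h2 := smul_one_injective (h1.trans (one_smul ℂ (1 : A)).symm)
      simp only [canTensor, hz, tens_smul_one, ← Finset.sum_smul, h2, one_smul]
    · intro k _ hk
      refine Finset.sum_eq_zero fun a _ => ?_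
      rw [H.hom_eq_zero hk (h k a), zero_mul]
    · simp
  · refine Finset.sum_eq_zero fun a _ => ?_
    rw [H.hom_eq_zero (Ne.symm hk) (h k a), tens_zero]

theorem canTensor_unit_left (j k : ι) [Decidable (j = k)] :
    canTensor J S t i₀ j k = if j = k then 1 else 0 := by
  refine H.sum_tens_eq_one J S (fun k a => ?_) k
  have := H.t_mem i₀ j k a
  rwa [H.unit] at this

theorem canTensor_unit_right (i k : ι) [Decidable (i = k)] :
    canTensor J S t i i₀ k = if i = k then 1 else 0 := by
  refine H.sum_tens_eq_one J S (fun k a => ?_) k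
  have := H.t_mem i i₀ k a
  rwa [H.unit] at this

theorem expand_assoc_left {i j l k : ι} {x : A}
    (hx : x ∈ Hom (ρ k) ((ρ i).comp ((ρ j).comp (ρ l)))) :
    x = ∑ s, ∑ a, ∑ b, t i j s a * t s l k b * (star (t i j s a * t s l k b) * x) := by
  conv_lhs => rw [(H.isOrthDecomp i j).eq_sum x]
  rw [Fintype.sum_sigma]
  refine Finset.sum_congr rfl fun s _ => Finset.sum_congr rfl fun a _ => ?_
  have h1 : star (t i j s a) * x ∈ Hom (ρ k) ((ρ s).comp (ρ l)) :=
    mul_mem_Hom (comp_mem_Hom (ρ l) (star_mem_Hom (H.t_mem i j s a))) hx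
  conv_lhs => rw [H.expand h1, Finset.mul_sum]
  simp only [star_mul, mul_assoc]

theorem expand_assoc_right {i j l k : ι} {x : A}
    (hx : x ∈ Hom (ρ k) ((ρ i).comp ((ρ j).comp (ρ l)))) :
    x = ∑ s, ∑ a, ∑ b, ρ i (t j l s a) * t i s k b *
      (star (ρ i (t j l s a) * t i s k b) * x) := by
  have h0 := congrArg (fun y => ρ i y * x) (H.isOrthDecomp j l).complete
  simp only [map_sum, map_one, one_mul, Finset.sum_mul, map_mul] at h0
  rw [Fintype.sum_sigma] at h0
  refine h0.symm.trans ?_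
  refine Finset.sum_congr rfl fun s _ => Finset.sum_congr rfl fun a _ => ?_
  have h1 : ρ i (star (t j l s a)) * x ∈ Hom (ρ k) ((ρ i).comp (ρ s)) :=
    mul_mem_Hom (map_mem_Hom (ρ i) (star_mem_Hom (H.t_mem j l s a))) hx
  conv_lhs => rw [mul_assoc, H.expand h1, Finset.mul_sum]
  simp only [star_mul, map_star, mul_assoc]

/-- Both sides are `∑ e ⊗ j(e)`, for the two orthonormal bases of `Hom(ρ k, ρ i ρ j ρ l)` that come
from the two bracketings. The overlaps `U` are scalars because `ρ k` is irreducible. -/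
theorem canTensor_assoc (i j l k : ι) :
    ∑ s, canTensor J S t i j s * canTensor J S t s l k =
      ∑ s, dbl J S (ρ i) (canTensor J S t j l s) * canTensor J S t i s k := by
  let e : (s : ι) × (Fin (fusionN (ρ i) (ρ j) (ρ s)) × Fin (fusionN (ρ s) (ρ l) (ρ k))) → A :=
    fun p => t i j p.1 p.2.1 * t p.1 l k p.2.2
  let g : (s : ι) × (Fin (fusionN (ρ j) (ρ l) (ρ s)) × Fin (fusionN (ρ i) (ρ s) (ρ k))) → A :=
    fun p => ρ i (t j l p.1 p.2.1) * t i p.1 k p.2.2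
  have he : ∀ p, e p ∈ Hom (ρ k) ((ρ i).comp ((ρ j).comp (ρ l))) := fun p =>
    mul_mem_Hom (comp_mem_Hom (ρ l) (H.t_mem i j p.1 p.2.1)) (H.t_mem p.1 l k p.2.2)
  have hg : ∀ p, g p ∈ Hom (ρ k) ((ρ i).comp ((ρ j).comp (ρ l))) := fun p =>
    mul_mem_Hom (map_mem_Hom (ρ i) (H.t_mem j l p.1 p.2.1)) (H.t_mem i p.1 k p.2.2)
  choose U hU using fun q p => H.irred k _ (mul_mem_Hom (star_mem_Hom (he p)) (hg q))
  have hU' : ∀ q p, star (g q) * e p = conj (U q p) • (1 : A) := by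
    intro q p
    have := congrArg star (hU q p)
    simpa using this
  have h := sum_tens_eq J S (e := e) (g := g) (α := fun _ => 1) (β := fun _ => 1) U
    (fun q => by
      conv_lhs => rw [H.expand_assoc_left (hg q)]
      rw [Fintype.sum_sigma]
      refine Finset.sum_congr rfl fun s _ => ?_
      rw [Fintype.sum_prod_type]
      refine Finset.sum_congr rfl fun a _ => Finset.sum_congr rfl fun b _ => ?_
      have := hU q ⟨s, a, b⟩
      dsimp only [e] at this ⊢
      rw [this, mul_smul_comm, mul_one])
    (fun p => by
      conv_lhs => rw [Complex.ofReal_one, one_smul, H.expand_assoc_right (he p)]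
      rw [Fintype.sum_sigma]
      refine Finset.sum_congr rfl fun s _ => ?_
      rw [Fintype.sum_prod_type]
      refine Finset.sum_congr rfl fun a _ => Finset.sum_congr rfl fun b _ => ?_
      have := hU' ⟨s, a, b⟩ p
      dsimp only [g] at this ⊢
      rw [this, mul_smul_comm, mul_one, Complex.ofReal_one, one_mul])
  simp only [Complex.ofReal_one, one_smul] at h
  rw [Fintype.sum_sigma, Fintype.sum_sigma] at h
  refine Eq.trans ?_ (h.trans ?_)
  · refine Finset.sum_congr rfl fun s _ => ?_
    rw [Fintype.sum_prod_type, canTensor, canTensor, Finset.sum_mul_sum]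
    simp only [e, tens_mul]
  · refine Finset.sum_congr rfl fun s _ => ?_
    rw [Fintype.sum_prod_type, canTensor, canTensor, map_sum, Finset.sum_mul_sum]
    simp only [g, tens_mul, dbl_tens J S (H.mem i)]

/-- By unitarity of the braiding, the `ε t_a` with `t_a` in `Hom(ρ k, ρ j ρ i)` are another
orthonormal basis of `Hom(ρ k, ρ i ρ j)`. -/
theorem ε_mul_canTensor (i j k : ι) :
    C₂.ε (dbl J S (ρ j)) (dbl J S (ρ i)) * canTensor J S t j i k = canTensor J S t i j k := by
  have hεm := C.ε_mem (H.mem j) (H.mem i)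
  have hε := C.star_ε_mul (H.mem j) (H.mem i)
  have hε' := C.ε_mul_star (H.mem j) (H.mem i)
  rw [ε_dbl J S (H.mem j) (H.mem i)]
  generalize C.ε (ρ j) (ρ i) = u at *
  have he : ∀ p, u * t j i k p ∈ Hom (ρ k) ((ρ i).comp (ρ j)) := fun p =>
    mul_mem_Hom hεm (H.t_mem j i k p)
  choose U hU using fun q p =>
    H.irred k _ (mul_mem_Hom (star_mem_Hom (he p)) (H.t_mem i j k q))
  have hU' : ∀ q p, star (t i j k q) * (u * t j i k p) = conj (U q p) • (1 : A) := by
    intro q p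
    have := congrArg star (hU q p)
    simpa using this
  have h := sum_tens_eq J S (e := fun p => u * t j i k p) (g := t i j k)
    (α := fun _ => 1) (β := fun _ => 1) U
    (fun q => by
      have h1 := H.expand (mul_mem_Hom (star_mem_Hom hεm) (H.t_mem i j k q))
      have h2 := congrArg (fun y => u * y) h1
      simp only [← mul_assoc, hε', one_mul, Finset.mul_sum] at h2
      refine h2.trans (Finset.sum_congr rfl fun p _ => ?_)
      have := hU q p
      rw [star_mul] at this
      rw [mul_assoc _ _ (star u), mul_assoc _ (_ * star u), this, mul_smul_comm, mul_one])
    (fun p => by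
      rw [Complex.ofReal_one, one_smul]
      conv_lhs => rw [H.expand (he p)]
      refine Finset.sum_congr rfl fun q _ => ?_
      rw [hU', mul_smul_comm, mul_one, one_mul])
  simp only [Complex.ofReal_one, one_smul, tens_mul] at h
  rw [canTensor, canTensor, Finset.mul_sum]
  exact h

variable {ρc : ι → End A} {R R' : ι → A}
  (hR : ∀ i, IsStandardPair (ρ i) (ρc i) (R i) (R' i)) (hρc : ∀ i, ρc i ∈ C.obj)

include hR hρc

/-- Basis independence for the direct basis `t t^*` and the crossed basis of `Hom(ρ m ρ n, ρ i ρ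
j)`. These are not normalized alike, which accounts for the weights. -/
theorem canTensor_frobenius (i j m n : ι) :
    ∑ k, (((dim (ρ k))⁻¹ : ℝ) : ℂ) •
      (canTensor J S t i j k * star (canTensor J S t m n k)) =
    ∑ s, ((dim (ρ s) / (dim (ρ j) * dim (ρ m)) : ℝ) : ℂ) •
      (dbl J S (ρ i) (star (canTensor J S t s n j)) * canTensor J S t i s m) := by
  let e : (k : ι) × (Fin (fusionN (ρ i) (ρ j) (ρ k)) × Fin (fusionN (ρ m) (ρ n) (ρ k))) → A :=
    fun p => t i j p.1 p.2.1 * star (t m n p.1 p.2.2)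
  let g : (s : ι) × (Fin (fusionN (ρ s) (ρ n) (ρ j)) × Fin (fusionN (ρ i) (ρ s) (ρ m))) → A :=
    fun p => crossBasis ρ t i j m n p.1 p.2.1 p.2.2
  have hg : ∀ p, g p ∈ Hom ((ρ m).comp (ρ n)) ((ρ i).comp (ρ j)) := fun p =>
    mul_mem_Hom (map_mem_Hom (ρ i) (star_mem_Hom (H.t_mem p.1 n j p.2.1)))
      (comp_mem_Hom (ρ n) (H.t_mem i p.1 m p.2.2))
  choose U hU using fun (q : (s : ι) × (Fin (fusionN (ρ s) (ρ n) (ρ j)) ×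
      Fin (fusionN (ρ i) (ρ s) (ρ m)))) (p : (k : ι) × (Fin (fusionN (ρ i) (ρ j) (ρ k)) ×
      Fin (fusionN (ρ m) (ρ n) (ρ k)))) =>
    H.irred p.1 _ (mul_mem_Hom (mul_mem_Hom (star_mem_Hom (H.t_mem i j p.1 p.2.1)) (hg q))
      (H.t_mem m n p.1 p.2.2))
  have hU' : ∀ q p, star (t m n p.1 p.2.2) * (star (g q) * t i j p.1 p.2.1) =
      conj (U q p) • (1 : A) := by
    intro q p
    have := congrArg star (hU q p)
    simpa using this
  have h := sum_tens_eq J S (e := e) (g := g) (α := fun p => (dim (ρ p.1))⁻¹)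
    (β := fun p => dim (ρ p.1) / (dim (ρ j) * dim (ρ m))) U
    (fun q => by
      conv_lhs => rw [H.expand_two (hg q)]
      rw [Fintype.sum_sigma]
      refine Finset.sum_congr rfl fun k _ => ?_
      rw [Fintype.sum_prod_type]
      refine Finset.sum_congr rfl fun a _ => Finset.sum_congr rfl fun b _ => ?_
      rw [hU q ⟨k, a, b⟩, mul_smul_comm, mul_one, smul_mul_assoc])
    (fun p => by
      dsimp only [e]
      rw [H.cross_expand_mul_star hR hρc, Fintype.sum_sigma]
      refine Finset.sum_congr rfl fun s _ => ?_
      rw [Fintype.sum_prod_type]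
      refine Finset.sum_congr rfl fun a _ => Finset.sum_congr rfl fun b _ => ?_
      have := hU' ⟨s, a, b⟩ p
      dsimp only [g] at this ⊢
      rw [this, mul_smul_comm, mul_one, smul_smul])
  rw [Fintype.sum_sigma, Fintype.sum_sigma] at h
  refine Eq.trans ?_ (h.trans ?_)
  · refine Finset.sum_congr rfl fun s _ => ?_
    rw [Fintype.sum_prod_type, canTensor, canTensor, star_sum, Finset.sum_mul_sum, Finset.smul_sum]
    simp only [e, tens_mul, tens_star, Finset.smul_sum]
  · refine Finset.sum_congr rfl fun s _ => ?_
    rw [Fintype.sum_prod_type, canTensor, canTensor, star_sum, map_sum, Finset.sum_mul_sum,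
      Finset.smul_sum]
    simp only [g, crossBasis, tens_mul, ← dbl_tens J S (H.mem i), tens_star, Finset.smul_sum]

theorem fusionTensor [DecidableEq ι] :
    FusionTensor (fun i => dbl J S (ρ i)) i₀ (fun i => dim (ρ i))
      (fun i j k => fusionN (ρ i) (ρ j) (ρ k)) (canTensor J S t) where
  unit := by rw [H.unit, dbl_id]
  pos i := (hR i).dim_pos
  dim_unit := by rw [H.unit]; exact dim_idEnd C.simple
  mem := H.canTensor_mem J S
  orthogonal i j k k' h := H.star_canTensor_mul_of_ne J S h
  norm := H.star_canTensor_mul J S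
  count k := by
    rw [Finset.sum_comm, Finset.mul_sum]
    refine Finset.sum_congr rfl fun j _ => ?_
    have h := H.sum_fusionN_mul_dim hR hρc j k
    calc _ = (∑ s, (fusionN (ρ s) (ρ j) (ρ k) : ℝ) * dim (ρ s)) * dim (ρ j) := by
          rw [Finset.sum_mul]
          exact Finset.sum_congr rfl fun i _ => by ring
      _ = _ := by rw [h]; ring
  unit_left j k := H.canTensor_unit_left J S j k
  unit_right i k := H.canTensor_unit_right J S i k
  assoc := H.canTensor_assoc J S
  frobenius := H.canTensor_frobenius J S hR hρc

omit hR hρc in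
-- The multiplicity is the squared norm of the canonical element, and the unitary braiding maps one
-- canonical element to the other.
theorem fusionN_comm [Nontrivial A₂] (J : Conjugation C) (S : TensorSquare C C₂) (i j k : ι) :
    fusionN (ρ i) (ρ j) (ρ k) = fusionN (ρ j) (ρ i) (ρ k) := by
  have hε : star (C₂.ε (dbl J S (ρ j)) (dbl J S (ρ i))) * C₂.ε (dbl J S (ρ j)) (dbl J S (ρ i)) =
      1 := C₂.star_ε_mul (S.box_mem (H.mem j) (J.conjEnd_mem _ (H.mem j)))
    (S.box_mem (H.mem i) (J.conjEnd_mem _ (H.mem i)))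
  have h1 := H.star_canTensor_mul J S i j k
  rw [← H.ε_mul_canTensor J S i j k, star_mul, mul_assoc, ← mul_assoc (star (C₂.ε _ _)), hε,
    one_mul, H.star_canTensor_mul J S] at h1
  exact_mod_cast (smul_one_injective h1).symm

omit hR hρc in
theorem hom_dbl_eq_zero {i j : ι} (hij : i ≠ j) {x : A₂}
    (hx : x ∈ Hom (dbl J S (ρ i)) (dbl J S (ρ j))) : x = 0 := by
  rw [dbl, dbl, S.hom_box (H.mem i) (J.conjEnd_mem _ (H.mem i)) (H.mem j)
    (J.conjEnd_mem _ (H.mem j))] at hx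
  refine (Submodule.mem_bot ℂ).1 (Submodule.span_le.2 ?_ hx)
  rintro _ ⟨y, hy, s, -, rfl⟩
  rw [H.hom_eq_zero hij hy, map_zero, zero_mul]
  exact Submodule.zero_mem _

end IsFusionSystem

/-- The Q-system of the canonical extension, and the centre of its braided product with itself. -/
theorem canonical_case (A A₂ : Type*) [CStarAlgebra A] [CStarAlgebra A₂] [Nontrivial A]
    [Nontrivial A₂] (C : BraidedEnd A) (C₂ : BraidedEnd A₂) (J : Conjugation C)
    (S : TensorSquare C C₂) (ι : Type*) [Fintype ι] (ρ : ι → End A) (i₀ : ι)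
    (t : (i j k : ι) → Fin (fusionN (ρ i) (ρ j) (ρ k)) → A) (H : IsFusionSystem C ρ i₀ t)
    (hR : ∀ i, ∃ R R', IsStandardPair (ρ i) (J.conjEnd (ρ i)) R R')
    (Θ : End A₂) (T : ι → A₂) (hΘ : Θ ∈ C₂.obj) (hT : IsDirectSum J S ρ Θ T) :
    ∃ (Q : QSystem A₂) (hQ : Q.θ ∈ C₂.obj),
      IsCanonical J S ρ i₀ t Θ T Q ∧ Q.IsStandard ∧ Q.IsCommutative C₂ ∧
      ∀ W : ι → A₂, (∀ i, W i ∈ Hom (S.box (ρ i) (J.conjEnd (ρ i))) Q.θ) →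
        (∀ i, star (W i) * W i =
          ((Q.d / dim (S.box (ρ i) (J.conjEnd (ρ i))) : ℝ) : ℂ) • (1 : A₂)) →
        let B : ι → ProdExt C₂ Q Q hQ hQ := fun i => boundaryOp C₂ Q Q hQ hQ (W i) (W i)
        (∀ i j k, fusionElement Q Q (S.box (ρ k) (J.conjEnd (ρ k))) (W k) (W k)
            (W i * star (W i)) (W j * star (W j)) =
          ((fusionN (ρ i) (ρ j) (ρ k) * dim (ρ k) / (dim (ρ i) * dim (ρ j)) : ℝ) : ℂ) •
            (1 : A₂)) ∧
        B i₀ = 1 ∧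
        ∀ i j, ((dim (ρ i) : ℂ) • B i) * ((dim (ρ j) : ℂ) • B j) =
          ∑ k, (fusionN (ρ i) (ρ j) (ρ k) : ℂ) • ((dim (ρ k) : ℂ) • B k) := by
  classical
  choose R R' hR using hR
  have F := H.fusionTensor J S hR fun i => J.conjEnd_mem _ (H.mem i)
  have hO : IsOrthDecomp Θ (fun i => dbl J S (ρ i)) T :=
    ⟨hT.mem, hT.isometry, hT.orthogonal, hT.complete⟩
  have hσ : ∀ i, IsIrred (dbl J S (ρ i)) := fun i =>
    isIrred_dbl J S (H.mem i) (H.irred i) (hR i)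
  have hd : ∀ i, dim (dbl J S (ρ i)) = dim (ρ i) ^ 2 := fun i =>
    dim_dbl J S (H.mem i) (H.irred i) (hR i)
  have hobj : ∀ i, dbl J S (ρ i) ∈ C₂.obj := fun i =>
    S.box_mem (H.mem i) (J.conjEnd_mem _ (H.mem i))
  have hne : ∀ i j, i ≠ j → ∀ x ∈ Hom (dbl J S (ρ i)) (dbl J S (ρ j)), x = 0 :=
    fun i j hij x hx => H.hom_dbl_eq_zero J S hij hx
  have hcomm := F.qSystem_isCommutative hO hΘ hobj (H.ε_mul_canTensor J S)
  refine ⟨F.qSystem hO, hΘ, ⟨rfl, rfl, rfl, rfl⟩, F.qSystem_isStandard hO hσ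
    (fun i => isStandardPair_dbl J S (H.mem i) (H.irred i) (hR i)) hd, hcomm, ?_⟩
  intro W hW hWn B
  refine ⟨fun i j k => ?_, F.boundaryOp_unit hO hne hσ hd hW hWn hΘ, fun i j => ?_⟩
  -- The coefficient was computed with the first two indices exchanged.
  · rw [H.fusionN_comm J S i j k]
    exact F.fusionElement_eq hO hne hσ hd hW hWn i j k
  · have h := F.boundaryOp_mul_eq hO hne hσ hd hW hWn hΘ hcomm i j
    rw [smul_mul_smul_comm]
    refine (congrArg _ h).trans ?_
    rw [Finset.smul_sum]
    refine Finset.sum_congr rfl fun k _ => ?_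
    rw [smul_smul, smul_smul, H.fusionN_comm J S i j k]
    congr 1
    have hi := (F.pos i).ne'
    have hj := (F.pos j).ne'
    norm_cast
    field_simp

end Canonical

end Sectors

end

open Sectors in
open Classical in
theorem proposition5p1 :
    -- the centre of the braided product of two commutative Q-systems
    (∀ (A : Type*) [CStarAlgebra A] [Nontrivial A] (C : BraidedEnd A) (QL QR : QSystem A)
      (hL : QL.θ ∈ C.obj) (hR : QR.θ ∈ C.obj),
      QL.IsStandard → QR.IsStandard → QL.IsCommutative C → QR.IsCommutative C →
      -- pairwise inequivalent irreducible sectors which decompose both endomorphisms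
      ∀ (ι : Type*) [Fintype ι] (ρ : ι → End A), (∀ i, ρ i ∈ C.obj) → (∀ i, IsIrred (ρ i)) →
      (∀ i j, Equivalent (ρ i) (ρ j) → i = j) →
      ∀ (nL nR : ι → ℕ) (WL : (i : ι) → Fin (nL i) → A) (WR : (i : ι) → Fin (nR i) → A),
      IsDecomposition QL ρ nL WL → IsDecomposition QR ρ nR WR →
      -- conjugates of the sectors
      ∀ (ρc : ι → End A) (R R' : ι → A), (∀ i, IsStandardPair (ρ i) (ρc i) (R i) (R' i)) →
      let I := (i : ι) × (Fin (nL i) × Fin (nR i))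
      let B : I → ProdExt C QL QR hL hR := fun a =>
        boundaryOp C QL QR hL hR (WL a.1 a.2.1) (WR a.1 a.2.2)
      let WLc : (i : ι) → Fin (nL i) → A := fun i k => conjCharge QL (ρc i) (R i) (WL i k)
      let WRc : (i : ι) → Fin (nR i) → A := fun i k => conjCharge QR (ρc i) (R i) (WR i k)
      let Bc : I → ProdExt C QL QR hL hR := fun a =>
        boundaryOp C QL QR hL hR (WLc a.1 a.2.1) (WRc a.1 a.2.2)
      let T : I → A := fun a => WL a.1 a.2.1 * star (WR a.1 a.2.2)
      -- the `B` are a basis of the centre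
      (LinearIndependent ℂ B ∧ Submodule.span ℂ (Set.range B) =
        Subalgebra.toSubmodule (Subalgebra.center ℂ (ProdExt C QL QR hL hR))) ∧
      -- the conjugate charge intertwiners belong to the conjugate sectors and are normalized
      (∀ i k, WLc i k ∈ Hom (ρc i) QL.θ) ∧ (∀ i k, WRc i k ∈ Hom (ρc i) QR.θ) ∧
      (∀ i k l, star (WLc i k) * WLc i l =
        if k = l then ((QL.d / dim (ρc i) : ℝ) : ℂ) • (1 : A) else 0) ∧
      (∀ i k l, star (WRc i k) * WRc i l =
        if k = l then ((QR.d / dim (ρc i) : ℝ) : ℂ) • (1 : A) else 0) ∧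
      -- the adjoint
      (∀ a, star (B a) = Bc a) ∧
      -- the product
      (∀ T₁ ∈ Hom QR.θ QL.θ, ∀ T₂ ∈ Hom QR.θ QL.θ, ast QL QR T₁ T₂ ∈ Hom QR.θ QL.θ ∧
        ast QL QR T₁ T₂ = ast QL QR T₂ T₁) ∧
      ∃ f : I → I → I → ℂ,
        (∀ a b c, fusionElement QL QR (ρ c.1) (WL c.1 c.2.1) (WR c.1 c.2.2) (T a) (T b) =
          f a b c • (1 : A)) ∧
        (∀ a b c, f a b c = f b a c) ∧
        ∀ a b, B a * B b =
          ∑ c ∈ Finset.univ.filter (fun c : I => Contained (ρ c.1) ((ρ a.1).comp (ρ b.1))),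
            f a b c • B c) ∧
    -- the case where both Q-systems are the canonical Q-system
    (∀ (A A₂ : Type*) [CStarAlgebra A] [CStarAlgebra A₂] [Nontrivial A] [Nontrivial A₂]
      (C : BraidedEnd A) (C₂ : BraidedEnd A₂) (J : Conjugation C) (S : TensorSquare C C₂)
      (ι : Type*) [Fintype ι] (ρ : ι → End A) (i₀ : ι)
      (t : (i j k : ι) → Fin (fusionN (ρ i) (ρ j) (ρ k)) → A),
      IsFusionSystem C ρ i₀ t →
      (∀ i, ∃ R R', IsStandardPair (ρ i) (J.conjEnd (ρ i)) R R') →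
      ∀ (Θ : End A₂) (T : ι → A₂), Θ ∈ C₂.obj → IsDirectSum J S ρ Θ T →
      ∃ (Q : QSystem A₂) (hQ : Q.θ ∈ C₂.obj),
        IsCanonical J S ρ i₀ t Θ T Q ∧ Q.IsStandard ∧ Q.IsCommutative C₂ ∧
        ∀ W : ι → A₂, (∀ i, W i ∈ Hom (S.box (ρ i) (J.conjEnd (ρ i))) Q.θ) →
          (∀ i, star (W i) * W i =
            ((Q.d / dim (S.box (ρ i) (J.conjEnd (ρ i))) : ℝ) : ℂ) • (1 : A₂)) →
          let B : ι → ProdExt C₂ Q Q hQ hQ := fun i => boundaryOp C₂ Q Q hQ hQ (W i) (W i)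
          (∀ i j k, fusionElement Q Q (S.box (ρ k) (J.conjEnd (ρ k))) (W k) (W k)
              (W i * star (W i)) (W j * star (W j)) =
            ((fusionN (ρ i) (ρ j) (ρ k) * dim (ρ k) / (dim (ρ i) * dim (ρ j)) : ℝ) : ℂ) •
              (1 : A₂)) ∧
          B i₀ = 1 ∧
          ∀ i j, ((dim (ρ i) : ℂ) • B i) * ((dim (ρ j) : ℂ) • B j) =
            ∑ k, (fusionN (ρ i) (ρ j) (ρ k) : ℂ) • ((dim (ρ k) : ℂ) • B k)) := by
  refine ⟨?_, ?_⟩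
  · intro A _ _ C QL QR hL hR hsL hsR hcL hcR ι _ ρ hobj hρ hne nL nR WL WR hWL hWR ρc R R' hRR
    exact center_of_braided_product A C QL QR hL hR hsL hsR hcL hcR ι ρ hobj hρ hne nL nR WL WR
      hWL hWR ρc R R' hRR
  · intro A A₂ _ _ _ _ C C₂ J S ι _ ρ i₀ t H hR Θ T hΘ hT
    exact canonical_case A A₂ C C₂ J S ι ρ i₀ t H hR Θ T hΘ hT
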